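/- Let $m\ge 1$ be an integer and $\alpha$ a real number with $\alpha-2m+1>0$, and put $2^*=2(\alpha+1)/(\alpha-2m+1)$. For functions on $(0,\infty)$ write $\|f\|_{L^q_\alpha}=\big(\int_0^\infty |f|^q r^\alpha\,dr\big)^{1/q}$, $\Delta_\alpha u=u''+\frac{\alpha}{r}u'$, and $\nabla^m_\alpha u=\Delta_\alpha^{k}u$ if $m=2k$, $\nabla^m_\alpha u=(\Delta_\alpha^{k}u)'$ if $m=2k+1$. Let $\mathcal D^{m,2}_\infty(\alpha)$ be the completion, in the norm $\|u^{(m)}\|_{L^2_\alpha}$, of the space of functions $u\in C^{m-1}(0,\infty)$ with $u^{(m-1)}$ locally absolutely continuous, $u^{(j)}(r)\to0$ as $r\to\infty$ for $0\le j\le m-1$, and $u^{(m)}\in L^2_\alpha$ (since $\alpha-2m+1>0$, this space is already complete). Let $$\mathcal S=\mathcal S(m,2,\alpha,\alpha,\infty)=\inf\Big\{\frac{\|\nabla^m_\alpha u\|^2_{L^2_\alpha}}{\|u\|^2_{L^{2^*}_\alpha}} : u\in\mathcal D^{m,2}_\infty(\alpha)\setminus\{0\}\Big\},$$ and call $z\in\mathcal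 D^{m,2}_\infty(\alpha)\setminus\{0\}$ a minimizer if its quotient equals $\mathcal S$. For $\epsilon>0$ let $$w_\epsilon(r)=\mathcal P^{\frac{\alpha-2m+1}{4m}}\Big(\frac{\epsilon}{\epsilon^2+r^2}\Big)^{\frac{\alpha-2m+1}{2}},\qquad \mathcal P=\prod_{h=-m}^{m-1}(\alpha+1+2h).$$ Let $\mathcal M$ be the set of minimizers $z\in C^{2m}(0,\infty)$ that are $(2m-1)$-th nonsingular at $0$, i.e. for which the finite limits $z^{(i)}(0):=\lim_{r\to0^+}z^{(i)}(r)$ exist for $0\le i\le 2m-1$, and that satisfy $z^{(i)}(0)=0$ for $i=1,3,\dots,2m-1$. Assume that $\mathcal M$ is nonempty. Then for every $z\in\mathcal D^{m,2}_\infty(\alpha)$: (i) $z\in\mathcal M$ if and only if $z=c\,w_\epsilon$ for some real $c\neq0$ and some $\epsilon>0$; (ii) $z\in\mathcal M$ and $z$ is normalized so as to be a weak solution of $(-\Delta_\alpha)^m z=|z|^{2^*-2}z$ in $(0,\infty)$, that is, $\int_0^\infty\nabla^m_\alpha z\,\nabla^m_\alpha v\,r^\alpha dr=\int_0^\infty|z|^{2^*-2}z\,v\,r^\alpha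 dr$ for all $v\in\mathcal D^{m,2}_\infty(\alpha)$, if and only if $z=w_\epsilon$ or $z=-w_\epsilon$ for some $\epsilon>0$. -/

import Mathlib

open Set Filter Topology MeasureTheory

/-! Functions on `(0, ∞)` are represented by functions `ℝ → ℝ`; only their values on `Ioi 0`
matter, and since `Ioi 0` is open, so do only those for `deriv` and `iteratedDeriv` there. -/

namespace RadialSobolev

/-- Local absolute continuity on `(0, ∞)`. -/
def ACLoc (f : ℝ → ℝ) : Prop :=
  ∀ a b : ℝ, 0 < a → 0 < b → AbsolutelyContinuousOnInterval f a b

/-- The space `𝓓^{m,2}_∞(α)` for `m ≥ 1`: functions `u ∈ AC^{m-1}_loc(0, ∞)` with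
`u^{(j)}(r) → 0` as `r → ∞` for `j < m` and `u^{(m)} ∈ L²((0, ∞), r^α dr)`.

The space is defined as the completion of this set of functions under the norm
`‖u^{(m)}‖_{L²_α}`. For `α - 2m + 1 > 0` the set is already complete, so that it is its own
completion: by `exists_mem_dirichletSpace` and `eq_zero_of_mem_dirichletSpace` below, the linear
isometry `u ↦ u^{(m)}` into `L²_α` is onto and has trivial kernel. -/
def dirichletSpace (m : ℕ) (α : ℝ) : Set (ℝ → ℝ) :=
  {u | ContDiffOn ℝ ((m - 1 : ℕ) : WithTop ℕ∞) u (Ioi 0) ∧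
    ACLoc (iteratedDeriv (m - 1) u) ∧
    (∀ j < m, Tendsto (iteratedDeriv j u) atTop (𝓝 0)) ∧
    IntegrableOn (fun r => iteratedDeriv m u r ^ 2 * r ^ α) (Ioi 0)}

/-- `u = 0` as a function on `(0, ∞)`. -/
def IsZero (u : ℝ → ℝ) : Prop := EqOn u 0 (Ioi 0)

/-- The `α`-generalized radial Laplacian `Δ_α u = u'' + (α / r) u'`. -/
noncomputable def laplacian (α : ℝ) (u : ℝ → ℝ) : ℝ → ℝ :=
  fun r => deriv (deriv u) r + α / r * deriv u r

/-- The `m`-th order gradient: `Δ_α^k u` if `m = 2k` and `(Δ_α^k u)'` if `m = 2k + 1`. -/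
noncomputable def gradient (m : ℕ) (α : ℝ) (u : ℝ → ℝ) : ℝ → ℝ :=
  if Even m then (laplacian α)^[m / 2] u else deriv ((laplacian α)^[m / 2] u)

/-- The weighted Lebesgue norm `‖f‖_{L^q_α} = (∫₀^∞ |f|^q r^α dr)^{1/q}`. -/
noncomputable def weightedNorm (q α : ℝ) (f : ℝ → ℝ) : ℝ :=
  (∫ r in Ioi (0 : ℝ), |f r| ^ q * r ^ α) ^ (1 / q)

/-- The critical exponent `2^* = 2(α + 1) / (α - 2m + 1)`. -/
noncomputable def critExp (m : ℕ) (α : ℝ) : ℝ := 2 * (α + 1) / (α - 2 * m + 1)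

/-- The quotient `‖∇_α^m u‖²_{L²_α} / ‖u‖²_{L^{2^*}_α}`. -/
noncomputable def sobolevQuotient (m : ℕ) (α : ℝ) (u : ℝ → ℝ) : ℝ :=
  weightedNorm 2 α (gradient m α u) ^ 2 / weightedNorm (critExp m α) α u ^ 2

/-- `𝓢(m, 2, α, α, ∞)`, the infimum of the quotient over `𝓓^{m,2}_∞(α) \ {0}`. -/
noncomputable def sobolevInf (m : ℕ) (α : ℝ) : ℝ :=
  sInf (sobolevQuotient m α '' {u | u ∈ dirichletSpace m α ∧ ¬ IsZero u})

/-- Minimizers for `𝓢(m, 2, α, α, ∞)`. -/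
def IsMinimizer (m : ℕ) (α : ℝ) (z : ℝ → ℝ) : Prop :=
  z ∈ dirichletSpace m α ∧ ¬ IsZero z ∧ sobolevQuotient m α z = sobolevInf m α

/-- `u ∈ C^{2m}(0, ∞)` is `ℓ`-th nonsingular at `r = 0`: the (finite) limits
`u^{(i)}(0) := lim_{r → 0⁺} u^{(i)}(r)` exist for `0 ≤ i ≤ ℓ`. -/
def IsNonsingular (m ℓ : ℕ) (u : ℝ → ℝ) : Prop :=
  ContDiffOn ℝ ((2 * m : ℕ) : WithTop ℕ∞) u (Ioi 0) ∧
    ∀ i ≤ ℓ, ∃ c : ℝ, Tendsto (iteratedDeriv i u) (𝓝[>] 0) (𝓝 c)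

/-- A minimizer which is `(2m-1)`-th nonsingular at `r = 0` and has
`u^{(i)}(0) = 0` for `i = 1, 3, …, 2m - 1`. -/
def IsNonsingularMinimizer (m : ℕ) (α : ℝ) (z : ℝ → ℝ) : Prop :=
  IsMinimizer m α z ∧ IsNonsingular m (2 * m - 1) z ∧
    ∀ i ≤ 2 * m - 1, Odd i → Tendsto (iteratedDeriv i z) (𝓝[>] 0) (𝓝 0)

/-- Weak solutions `u ∈ 𝓓^{m,2}_∞(α)` of `(-Δ_α)^m u = |u|^{2^*-2} u` in `(0, ∞)`. -/
def IsWeakSolution (m : ℕ) (α : ℝ) (u : ℝ → ℝ) : Prop :=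
  u ∈ dirichletSpace m α ∧ ∀ v ∈ dirichletSpace m α,
    ∫ r in Ioi (0 : ℝ), gradient m α u r * gradient m α v r * r ^ α =
      ∫ r in Ioi (0 : ℝ), |u r| ^ (critExp m α - 2) * u r * v r * r ^ α

/-- `𝓟 = ∏_{h = -m}^{m-1} (α + 1 + 2h)`. -/
noncomputable def prodConst (m : ℕ) (α : ℝ) : ℝ :=
  ∏ h ∈ Finset.Ico (-(m : ℤ)) m, (α + 1 + 2 * (h : ℝ))

/-- The functions
`w_ε(r) = 𝓟^{(α-2m+1)/(4m)} (ε / (ε² + r²))^{(α-2m+1)/2}`. -/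
noncomputable def bubble (m : ℕ) (α ε : ℝ) : ℝ → ℝ :=
  fun r => prodConst m α ^ ((α - 2 * m + 1) / (4 * m)) *
    (ε / (ε ^ 2 + r ^ 2)) ^ ((α - 2 * m + 1) / 2)

end RadialSobolev

namespace RadialSobolev

theorem ACLoc.congr {f g : ℝ → ℝ} (hf : ACLoc f) (h : EqOn g f (Ioi 0)) : ACLoc g := by
  intro a b ha hb
  have hs : uIcc a b ⊆ Ioi 0 := fun x hx => lt_of_lt_of_le (lt_min ha hb) hx.1
  have := hf a b ha hb
  rw [absolutelyContinuousOnInterval_iff] at this ⊢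
  intro ε hε
  obtain ⟨δ, hδ, H⟩ := this ε hε
  refine ⟨δ, hδ, fun E hE hE' => ?_⟩
  have := H E hE hE'
  rwa [Finset.sum_congr rfl (fun i hi => by
    rw [h (hs (hE.1 i hi).1), h (hs (hE.1 i hi).2)])]

theorem neg_integral_Ioi_eq {g : ℝ → ℝ} (hg : ∀ r > 0, IntegrableOn g (Ioi r)) {a r : ℝ}
    (ha : 0 < a) (hr : 0 < r) :
    -∫ t in Ioi r, g t = (∫ t in a..r, g t) - ∫ t in Ioi a, g t := by
  have := intervalIntegral.integral_Ioi_sub_Ioi' (hg a ha) (hg r hr)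
  linarith

theorem intervalIntegrable_of_Ioi {g : ℝ → ℝ} (hg : ∀ r > 0, IntegrableOn g (Ioi r)) {a b : ℝ}
    (ha : 0 < a) (hb : 0 < b) : IntervalIntegrable g volume a b := by
  have hmin : 0 < min a b := lt_min ha hb
  exact intervalIntegrable_iff.2 ((hg _ hmin).mono_set fun x hx => hx.1)

/-- Differentiability of the primitive vanishing at infinity. -/
theorem hasDerivAt_neg_integral_Ioi {g : ℝ → ℝ} (hg : ∀ r > 0, IntegrableOn g (Ioi r))
    (hc : ContinuousOn g (Ioi 0)) {r : ℝ} (hr : 0 < r) :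
    HasDerivAt (fun s => -∫ t in Ioi s, g t) (g r) r := by
  have h1 : HasDerivAt (fun s => (∫ t in r..s, g t) - ∫ t in Ioi r, g t) (g r) r := by
    refine HasDerivAt.sub_const _ ?_
    exact intervalIntegral.integral_hasDerivAt_right
      (intervalIntegrable_of_Ioi hg hr hr)
      (hc.stronglyMeasurableAtFilter isOpen_Ioi r hr)
      (hc.continuousAt (Ioi_mem_nhds hr))
  refine h1.congr_of_eventuallyEq ?_
  filter_upwards [Ioi_mem_nhds hr] with s hs
  exact neg_integral_Ioi_eq hg hr hs

theorem acLoc_neg_integral_Ioi {g : ℝ → ℝ} (hg : ∀ r > 0, IntegrableOn g (Ioi r)) :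
    ACLoc (fun s => -∫ t in Ioi s, g t) := by
  refine ACLoc.congr (f := fun s => (∫ t in (1 : ℝ)..s, g t) - ∫ t in Ioi (1 : ℝ), g t) ?_
    (fun s hs => neg_integral_Ioi_eq hg one_pos hs)
  intro a b ha hb
  have h0 : 0 < min 1 (min a b) := lt_min one_pos (lt_min ha hb)
  have h1 : 0 < max 1 (max a b) := lt_of_lt_of_le one_pos (le_max_left _ _)
  have hle : min 1 (min a b) ≤ max 1 (max a b) := (min_le_left _ _).trans (le_max_left _ _)
  have h2 := (intervalIntegrable_of_Ioi hg h0 h1).absolutelyContinuousOnInterval_intervalIntegral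
    (c := 1) (by rw [uIcc_of_le hle]; exact ⟨min_le_left _ _, le_max_left _ _⟩)
  have h3 : AbsolutelyContinuousOnInterval (fun _ : ℝ => ∫ t in Ioi (1 : ℝ), g t)
      (min 1 (min a b)) (max 1 (max a b)) :=
    (contDiff_const.contDiffOn).absolutelyContinuousOnInterval
  refine (h2.sub h3).mono ?_
  rw [uIcc_of_le hle]
  exact Icc_subset_Icc (min_le_right _ _) (le_max_right _ _)

theorem ae_deriv_neg_integral_Ioi {g : ℝ → ℝ} (hg : ∀ r > 0, IntegrableOn g (Ioi r)) :
    ∀ᵐ r ∂volume.restrict (Ioi (0 : ℝ)), deriv (fun s => -∫ t in Ioi s, g t) r = g r := by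
  rw [ae_restrict_iff' measurableSet_Ioi]
  have key : ∀ n : ℕ, ∀ᵐ r : ℝ, r ∈ uIcc (1 / ((n : ℝ) + 1)) ((n : ℝ) + 1) →
      HasDerivAt (fun s => ∫ t in (1 / ((n : ℝ) + 1))..s, g t) (g r) r := by
    intro n
    have h := (intervalIntegrable_of_Ioi hg (a := 1 / ((n : ℝ) + 1)) (b := (n : ℝ) + 1)
      (by positivity) (by positivity)).ae_hasDerivAt_integral
    filter_upwards [h] with r hr hr'
    exact hr hr' _ left_mem_uIcc
  filter_upwards [ae_all_iff.2 key] with r hr h0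
  obtain ⟨n, hn⟩ := exists_nat_gt (max r (1 / r))
  have h0' : (0 : ℝ) < r := h0
  have hn1 : r < n := lt_of_le_of_lt (le_max_left _ _) hn
  have hn2 : 1 / r < n := lt_of_le_of_lt (le_max_right _ _) hn
  have hpos : (0 : ℝ) < 1 / ((n : ℝ) + 1) := by positivity
  have hmem : r ∈ uIcc (1 / ((n : ℝ) + 1)) ((n : ℝ) + 1) := by
    refine mem_uIcc_of_le ?_ (by linarith)
    rw [div_le_iff₀ (by positivity)]
    rw [div_lt_iff₀ h0'] at hn2
    nlinarith
  have h1 := (hr n hmem).sub_const (∫ t in Ioi (1 / ((n : ℝ) + 1)), g t)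
  refine (h1.congr_of_eventuallyEq ?_).deriv
  filter_upwards [Ioi_mem_nhds h0'] with s hs
  exact neg_integral_Ioi_eq hg hpos hs

theorem integrableOn_Ioi_of_weighted {α : ℝ} (hα : 1 < α) {f : ℝ → ℝ} (hf : Measurable f)
    (h : IntegrableOn (fun r => f r ^ 2 * r ^ α) (Ioi 0)) {l r : ℝ} (hl : 0 < l) (hr : 0 < r) :
    IntegrableOn f (Ioi r) ∧ |∫ t in Ioi r, f t| ≤
      l * (∫ t in Ioi (0 : ℝ), f t ^ 2 * t ^ α) + l⁻¹ * (∫ t in Ioi r, t ^ (-α)) := by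
  have h1 : IntegrableOn (fun t : ℝ => f t ^ 2 * t ^ α) (Ioi r) :=
    h.mono_set (Ioi_subset_Ioi hr.le)
  have h2 : IntegrableOn (fun t : ℝ => t ^ (-α)) (Ioi r) :=
    integrableOn_Ioi_rpow_of_lt (by linarith) hr
  have h3 : IntegrableOn (fun t : ℝ => l * (f t ^ 2 * t ^ α) + l⁻¹ * t ^ (-α)) (Ioi r) :=
    (h1.const_mul l).add (h2.const_mul _)
  have hb : ∀ t ∈ Ioi r, ‖f t‖ ≤ l * (f t ^ 2 * t ^ α) + l⁻¹ * t ^ (-α) := by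
    intro t ht
    have ht0 : 0 < t := hr.trans ht
    have hp : 0 < t ^ α := Real.rpow_pos_of_pos ht0 α
    rw [Real.rpow_neg ht0.le, Real.norm_eq_abs]
    have hx : 0 < l * t ^ α := mul_pos hl hp
    have : l * (f t ^ 2 * t ^ α) + l⁻¹ * (t ^ α)⁻¹ - |f t| =
        (l * t ^ α) * ((|f t| - (l * t ^ α)⁻¹ / 2) ^ 2 + 3 / 4 * (l * t ^ α)⁻¹ ^ 2) := by
      rw [← sq_abs (f t)]
      field_simp
      ring
    have h5 : 0 ≤ (l * t ^ α) *
        ((|f t| - (l * t ^ α)⁻¹ / 2) ^ 2 + 3 / 4 * (l * t ^ α)⁻¹ ^ 2) := by positivity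
    linarith
  have hbae : ∀ᵐ t ∂volume.restrict (Ioi r),
      ‖f t‖ ≤ l * (f t ^ 2 * t ^ α) + l⁻¹ * t ^ (-α) :=
    (ae_restrict_iff' measurableSet_Ioi).2 (ae_of_all _ hb)
  refine ⟨h3.mono' hf.aestronglyMeasurable hbae, ?_⟩
  have h4 := norm_integral_le_of_norm_le h3 hbae
  rw [integral_add (h1.const_mul l) (h2.const_mul _), integral_const_mul, integral_const_mul,
    Real.norm_eq_abs] at h4
  refine h4.trans ?_
  gcongr
  filter_upwards [ae_restrict_mem measurableSet_Ioi] with t ht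
  have : 0 ≤ t ^ α := Real.rpow_nonneg (le_of_lt ht) α
  simp only [Pi.zero_apply]
  positivity

/-- Every `f ∈ L²_α` is the `k`-th derivative of a function all of whose derivatives of order
less than `k` decay at infinity. -/
theorem exists_primitive {α : ℝ} {f : ℝ → ℝ} (hf : Measurable f)
    (h : IntegrableOn (fun r => f r ^ 2 * r ^ α) (Ioi 0)) (n : ℕ)
    (hα : 0 < α - 2 * ((n + 1 : ℕ) : ℝ) + 1) :
    ∃ u : ℝ → ℝ, ContDiffOn ℝ (n : WithTop ℕ∞) u (Ioi 0) ∧ ACLoc (iteratedDeriv n u) ∧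
      (∀ j ≤ n, ∃ C : ℝ, ∀ r > 0,
        |iteratedDeriv j u r| ≤ C * r ^ (-((α - 2 * ((n : ℝ) + 1 - j) + 1) / 2))) ∧
      ∀ᵐ r ∂volume.restrict (Ioi (0 : ℝ)), iteratedDeriv (n + 1) u r = f r := by
  induction n with
  | zero =>
    have hα1 : 1 < α := by push_cast at hα; linarith
    have hint : ∀ r > 0, IntegrableOn f (Ioi r) := fun r hr =>
      (integrableOn_Ioi_of_weighted hα1 hf h one_pos hr).1
    have hac := acLoc_neg_integral_Ioi hint
    refine ⟨fun s => -∫ t in Ioi s, f t, ?_, by simpa using hac, ?_, ?_⟩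
    · rw [Nat.cast_zero, contDiffOn_zero]
      intro r hr
      have hr' : (0 : ℝ) < r := hr
      have hc := (hac (r / 2) (r + 1) (by linarith) (by linarith)).continuousOn
      rw [uIcc_of_le (by linarith)] at hc
      exact (hc.continuousAt (Icc_mem_nhds (by linarith) (by linarith))).continuousWithinAt
    · intro j hj
      obtain rfl : j = 0 := by omega
      refine ⟨(∫ t in Ioi (0 : ℝ), f t ^ 2 * t ^ α) + 1 / (α - 1), fun r hr => ?_⟩
      have hl : 0 < r ^ (-((α - 1) / 2)) := Real.rpow_pos_of_pos hr _
      have h1 := (integrableOn_Ioi_of_weighted hα1 hf h hl hr).2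
      rw [integral_Ioi_rpow_of_lt (by linarith) hr, ← Real.rpow_neg hr.le] at h1
      have h2 : r ^ (- -((α - 1) / 2)) * (-r ^ (-α + 1) / (-α + 1)) =
          1 / (α - 1) * r ^ (-((α - 1) / 2)) := by
        have : r ^ (-((α - 1) / 2)) = r ^ (- -((α - 1) / 2)) * r ^ (-α + 1) := by
          rw [← Real.rpow_add hr]; congr 1; ring
        rw [this]
        have h3 : -α + 1 ≠ 0 := by linarith
        have h4 : α - 1 ≠ 0 := by linarith
        field_simp
        ring
      rw [h2] at h1
      have he : -((α - 2 * (((0 : ℕ) : ℝ) + 1 - ((0 : ℕ) : ℝ)) + 1) / 2) = -((α - 1) / 2) := by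
        push_cast; ring
      rw [he, iteratedDeriv_zero, abs_neg]
      linarith
    · simpa [iteratedDeriv_one] using ae_deriv_neg_integral_Ioi hint
  | succ n ih =>
    obtain ⟨u, hu1, hu2, hu3, hu4⟩ := ih (by push_cast at hα ⊢; linarith)
    push_cast at hα
    set β : ℝ := (α - 2 * ((n : ℝ) + 1) + 1) / 2 with hβ
    have hβ1 : 1 < β := by rw [hβ]; linarith
    obtain ⟨C, hC⟩ := hu3 0 (Nat.zero_le _)
    have hC' : ∀ r > 0, |u r| ≤ C * r ^ (-β) := fun r hr => by
      have := hC r hr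
      rwa [iteratedDeriv_zero, Nat.cast_zero, sub_zero] at this
    have hcont : ContinuousOn u (Ioi 0) := hu1.continuousOn
    have hb : ∀ r > 0, ∀ᵐ t ∂volume.restrict (Ioi r), ‖u t‖ ≤ C * t ^ (-β) := fun r hr =>
      (ae_restrict_iff' measurableSet_Ioi).2
        (ae_of_all _ fun t (ht : r < t) => hC' t (lt_trans hr ht))
    have hpow : ∀ r > 0, IntegrableOn (fun t : ℝ => C * t ^ (-β)) (Ioi r) := fun r hr =>
      (integrableOn_Ioi_rpow_of_lt (by linarith) hr).const_mul C
    have hint : ∀ r > 0, IntegrableOn u (Ioi r) := fun r hr =>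
      (hpow r hr).mono' ((hcont.mono (Ioi_subset_Ioi (le_of_lt hr))).aestronglyMeasurable
        measurableSet_Ioi) (hb r hr)
    have hd : ∀ r > 0, HasDerivAt (fun s => -∫ t in Ioi s, u t) (u r) r := fun r hr =>
      hasDerivAt_neg_integral_Ioi hint hcont hr
    have hde : ∀ j : ℕ, EqOn (iteratedDeriv (j + 1) (fun s => -∫ t in Ioi s, u t))
        (iteratedDeriv j u) (Ioi 0) := by
      intro j r hr
      rw [iteratedDeriv_succ']
      apply Filter.EventuallyEq.iteratedDeriv_eq
      filter_upwards [Ioi_mem_nhds hr] with s hs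
      exact (hd s hs).deriv
    refine ⟨fun s => -∫ t in Ioi s, u t, ?_, hu2.congr (hde n), ?_, ?_⟩
    · rw [Nat.cast_succ, contDiffOn_succ_iff_deriv_of_isOpen isOpen_Ioi]
      refine ⟨fun r hr => (hd r hr).differentiableAt.differentiableWithinAt, by simp,
        hu1.congr fun r hr => (hd r hr).deriv⟩
    · intro j hj
      rcases j with _ | j
      · refine ⟨C / (β - 1), fun r hr => ?_⟩
        have h1 := norm_integral_le_of_norm_le (hpow r hr) (hb r hr)
        rw [integral_const_mul, integral_Ioi_rpow_of_lt (by linarith) hr, Real.norm_eq_abs] at h1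
        rw [iteratedDeriv_zero, abs_neg]
        refine h1.trans (le_of_eq ?_)
        have he : -((α - 2 * (((n + 1 : ℕ) : ℝ) + 1 - ((0 : ℕ) : ℝ)) + 1) / 2) = -β + 1 := by
          rw [hβ]; push_cast; ring
        rw [he]
        have h3 : -β + 1 ≠ 0 := by linarith
        have h4 : β - 1 ≠ 0 := by linarith
        field_simp
        ring
      · obtain ⟨D, hD⟩ := hu3 j (by omega)
        refine ⟨D, fun r hr => ?_⟩
        rw [hde j hr]
        refine (hD r hr).trans (le_of_eq ?_)
        congr 3
        push_cast
        ring
    · filter_upwards [hu4, ae_restrict_mem measurableSet_Ioi] with r hr hr0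
      rw [hde (n + 1) hr0, hr]

/-- Under the Sobolev condition `u ↦ u^{(m)}` maps `𝓓^{m,2}_∞(α)` onto `L²_α`. -/
theorem exists_mem_dirichletSpace {m : ℕ} (hm : 1 ≤ m) {α : ℝ} (hα : 0 < α - 2 * (m : ℝ) + 1)
    {f : ℝ → ℝ} (hf : Measurable f) (h : IntegrableOn (fun r => f r ^ 2 * r ^ α) (Ioi 0)) :
    ∃ u ∈ dirichletSpace m α,
      ∀ᵐ r ∂volume.restrict (Ioi (0 : ℝ)), iteratedDeriv m u r = f r := by
  obtain ⟨n, rfl⟩ : ∃ n, m = n + 1 := ⟨m - 1, by omega⟩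
  obtain ⟨u, hu1, hu2, hu3, hu4⟩ := exists_primitive hf h n hα
  refine ⟨u, ⟨by simpa using hu1, by simpa using hu2, fun j hj => ?_, ?_⟩, hu4⟩
  · obtain ⟨C, hC⟩ := hu3 j (by omega)
    have hpos : 0 < (α - 2 * ((n : ℝ) + 1 - j) + 1) / 2 := by
      push_cast at hα
      have : (0 : ℝ) ≤ j := Nat.cast_nonneg j
      linarith
    have ht := (tendsto_rpow_neg_atTop hpos).const_mul C
    rw [mul_zero] at ht
    refine squeeze_zero_norm' ?_ ht
    filter_upwards [eventually_gt_atTop 0] with r hr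
    exact hC r hr
  · refine Integrable.congr h ?_
    filter_upwards [hu4] with r hr
    rw [hr]

/-- `‖u^{(m)}‖_{L²_α}` is definite on `𝓓^{m,2}_∞(α)`. -/
theorem eq_zero_of_mem_dirichletSpace {m : ℕ} (hm : 1 ≤ m) {α : ℝ} {u : ℝ → ℝ}
    (hu : u ∈ dirichletSpace m α)
    (h : ∀ᵐ r ∂volume.restrict (Ioi (0 : ℝ)), iteratedDeriv m u r = 0) : IsZero u := by
  obtain ⟨n, rfl⟩ : ∃ n, m = n + 1 := ⟨m - 1, by omega⟩
  obtain ⟨hu1, hu2, hu3, -⟩ := hu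
  rw [Nat.add_sub_cancel] at hu1 hu2
  have hae := (ae_restrict_iff' measurableSet_Ioi).1 h
  -- a function on the half-line that is locally constant and tends to zero vanishes
  have hlim : ∀ g : ℝ → ℝ, Tendsto g atTop (𝓝 0) → (∀ a b, 0 < a → a ≤ b → g b = g a) →
      EqOn g 0 (Ioi 0) := by
    intro g hg hc a ha
    refine tendsto_nhds_unique (tendsto_const_nhds.congr' ?_) hg
    filter_upwards [eventually_ge_atTop a] with b hb
    exact (hc a b ha hb).symm
  have htop : EqOn (iteratedDeriv n u) 0 (Ioi 0) := by
    refine hlim _ (hu3 n (by omega)) fun a b ha hab => ?_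
    have h1 := (hu2 a b ha (ha.trans_le hab)).integral_deriv_eq_sub
    rw [intervalIntegral.integral_congr_ae (g := fun _ => (0 : ℝ))] at h1
    · rw [intervalIntegral.integral_zero] at h1
      linarith
    · filter_upwards [hae] with x hx hx'
      rw [uIoc_of_le hab] at hx'
      have := hx (ha.trans hx'.1)
      rwa [iteratedDeriv_succ] at this
  have hdown : ∀ k ≤ n, EqOn (iteratedDeriv (n - k) u) 0 (Ioi 0) := by
    intro k
    induction k with
    | zero => intro _; simpa using htop
    | succ k ih =>
      intro hk
      have hk' := ih (by omega)
      have hs : n - k = (n - (k + 1)) + 1 := by omega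
      refine hlim _ (hu3 _ (by omega)) fun a b ha hab => ?_
      have hdiff : DifferentiableOn ℝ (iteratedDeriv (n - (k + 1)) u) (Icc a b) := by
        have h1 : DifferentiableOn ℝ (iteratedDerivWithin (n - (k + 1)) u (Ioi 0)) (Ioi 0) :=
          hu1.differentiableOn_iteratedDerivWithin (by exact_mod_cast (by omega))
            isOpen_Ioi.uniqueDiffOn
        have h2 : DifferentiableOn ℝ (iteratedDeriv (n - (k + 1)) u) (Ioi 0) :=
          h1.congr fun x hx => (iteratedDerivWithin_of_isOpen isOpen_Ioi hx).symm
        exact h2.mono fun x hx => ha.trans_le hx.1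
      refine constant_of_derivWithin_zero hdiff (fun x hx => ?_) b ⟨hab, le_rfl⟩
      have hx0 : x ∈ Ioi (0 : ℝ) := ha.trans_le hx.1
      have hux : UniqueDiffWithinAt ℝ (Icc a b) x :=
        uniqueDiffOn_Icc (hx.1.trans_lt hx.2) x ⟨hx.1, hx.2.le⟩
      have hd : deriv (iteratedDeriv (n - (k + 1)) u) x = 0 := by
        rw [← iteratedDeriv_succ, ← hs]
        exact hk' hx0
      have hat : DifferentiableAt ℝ (iteratedDeriv (n - (k + 1)) u) x := by
        have h1 : DifferentiableOn ℝ (iteratedDerivWithin (n - (k + 1)) u (Ioi 0)) (Ioi 0) :=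
          hu1.differentiableOn_iteratedDerivWithin (by exact_mod_cast (by omega))
            isOpen_Ioi.uniqueDiffOn
        have h2 : DifferentiableOn ℝ (iteratedDeriv (n - (k + 1)) u) (Ioi 0) :=
          h1.congr fun x hx => (iteratedDerivWithin_of_isOpen isOpen_Ioi hx).symm
        exact h2.differentiableAt (isOpen_Ioi.mem_nhds hx0)
      rw [hat.derivWithin hux, hd]
  have := hdown n le_rfl
  simpa [IsZero] using this

end RadialSobolev

open RadialSobolev

/-!
The problem is transferred to the line by the Emden–Fowler change of variables
`φ(t) = e^{γt} z(e^t)` with `γ = (α - 2m + 1) / 2`. It turns both norms of the quotient into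
translation invariant integrals over `ℝ` (`sobolevQuotient_eq`) and `(-Δ_α)^m` into the
constant-coefficient operator `A(d/dt)` with `A = ∏_{i < m} ((γ + 2i)² - X²)`
(`gradPoly_mul_comp_neg`). A regular minimizer satisfies `A(d/dt) φ = μ |φ|^{p-2} φ` pointwise, with
`p = 2^*` and some `μ ≥ 0` (`IsMinimizer.euler_lagrange`, `diffOp_polyLap_eq`); the profile of the
bubble `w_ε` is a multiple of `(2 cosh (t - log ε))^{-γ}` and solves this equation with `μ = 1`
(`diffOp_polyLap_bubble`).

The core is the uniqueness statement `profile_unique`: two solutions with `μ = 1` that vanish at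
`+∞` and have the same value `z(0) = lim_{t → -∞} e^{-γt} φ(t)` coincide. Their difference `f`
solves the linear equation `A(d/dt) f = W f`, where `W ≥ 0` is the difference quotient of the
nonlinearity and vanishes at `±∞`. If `f` were not zero, then near each end a single exponential
mode would dominate (`exists_forall_abs_le`), so that `f` has finitely many zeros, and `f` together
with all its images under partial products of `A(d/dt)` vanishes at `±∞`. By Rolle's theorem each
first-order factor `d/dt - λ` with `λ ≠ 0` preserves the number of sign changes, and the factor
`d/dt - γ`, applied first, creates one more because `e^{-γt} f` vanishes at both ends. The right
side `W f`, on the other hand, has no more sign changes than `f`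
(`eq_zero_of_rootProd_eq_mul`). This argument needs neither the positivity of minimizers nor any
rearrangement.

Given a regular minimizer `z`, the multiplier `μ` is positive, as otherwise `φ` would be a decaying
solution of a homogeneous linear equation, so it can be scaled to one; then `z(0) ≠ 0` by
uniqueness, and `z` is compared with the bubble `±w_ε` of the same value at the origin
(`exists_eqOn_bubble`). Conversely, the quotient takes one and the same value at all multiples of
all bubbles, by homogeneity and translation invariance (`sobolevQuotient_of_eqOn_bubble`). The
minimizer that is assumed to exist is itself such a multiple, so this value is `𝓢`.
-/

namespace RadialSobolev

open Polynomial

/-! ### Constant-coefficient differential operators -/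

/-- The constant-coefficient operator `P(d/dt)` applied to `φ`, evaluated at `t`. Derivatives that
do not exist are read as zero, as usual for `iteratedDeriv`. -/
noncomputable def diffOp (P : ℝ[X]) (φ : ℝ → ℝ) (t : ℝ) : ℝ :=
  P.sum fun k a => a * iteratedDeriv k φ t

theorem diffOp_add (P Q : ℝ[X]) (φ : ℝ → ℝ) (t : ℝ) :
    diffOp (P + Q) φ t = diffOp P φ t + diffOp Q φ t := by
  unfold diffOp
  exact Polynomial.sum_add_index P Q _ (by simp) (by intros; ring)

theorem diffOp_C_mul_X_pow (a : ℝ) (k : ℕ) (φ : ℝ → ℝ) (t : ℝ) :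
    diffOp (C a * X ^ k) φ t = a * iteratedDeriv k φ t := by
  unfold diffOp
  rw [C_mul_X_pow_eq_monomial, Polynomial.sum_monomial_index _ _ (by simp)]

theorem diffOp_C_mul (a : ℝ) (P : ℝ[X]) (φ : ℝ → ℝ) (t : ℝ) :
    diffOp (C a * P) φ t = a * diffOp P φ t := by
  induction P using Polynomial.induction_on' with
  | add P Q hP hQ => rw [mul_add, diffOp_add, diffOp_add, hP, hQ]; ring
  | monomial n b =>
    rw [← C_mul_X_pow_eq_monomial, ← mul_assoc, ← C_mul, diffOp_C_mul_X_pow, diffOp_C_mul_X_pow]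
    ring

theorem diffOp_one (φ : ℝ → ℝ) (t : ℝ) : diffOp 1 φ t = φ t := by
  simpa using diffOp_C_mul_X_pow 1 0 φ t

theorem diffOp_zero (φ : ℝ → ℝ) (t : ℝ) : diffOp 0 φ t = 0 := by
  simp [diffOp]

theorem diffOp_sum {ι : Type*} (s : Finset ι) (P : ι → ℝ[X]) (φ : ℝ → ℝ) (t : ℝ) :
    diffOp (∑ i ∈ s, P i) φ t = ∑ i ∈ s, diffOp (P i) φ t := by
  classical
  induction s using Finset.induction_on with
  | empty => simp [diffOp_zero]
  | insert i s hi ih => rw [Finset.sum_insert hi, Finset.sum_insert hi, diffOp_add, ih]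

theorem diffOp_X_sub_C_mul (b : ℝ) (P : ℝ[X]) (φ : ℝ → ℝ) (t : ℝ) :
    diffOp ((X - C b) * P) φ t = diffOp (X * P) φ t - b * diffOp P φ t := by
  have : (X - C b) * P = X * P + C (-b) * P := by rw [C_neg]; ring
  rw [this, diffOp_add, diffOp_C_mul]; ring

theorem hasDerivAt_diffOp {P : ℝ[X]} {φ : ℝ → ℝ} {t : ℝ}
    (h : ∀ k ≤ P.natDegree, DifferentiableAt ℝ (iteratedDeriv k φ) t) :
    HasDerivAt (diffOp P φ) (diffOp (X * P) φ t) t := by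
  have h1 : diffOp (X * P) φ t = ∑ k ∈ P.support, P.coeff k * iteratedDeriv (k + 1) φ t := by
    have : X * P = ∑ k ∈ P.support, C (P.coeff k) * X ^ (k + 1) := by
      conv_lhs => rw [P.as_sum_support_C_mul_X_pow, Finset.mul_sum]
      exact Finset.sum_congr rfl fun k _ => by ring
    rw [this, diffOp_sum]
    exact Finset.sum_congr rfl fun k _ => diffOp_C_mul_X_pow _ _ _ _
  rw [h1]
  refine HasDerivAt.fun_sum fun k hk => ?_
  rw [iteratedDeriv_succ]
  exact ((h k (le_natDegree_of_mem_supp k hk)).hasDerivAt).const_mul _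

theorem differentiableAt_iteratedDeriv {φ : ℝ → ℝ} {n k : ℕ} (h : ContDiff ℝ n φ) (hk : k < n)
    (t : ℝ) : DifferentiableAt ℝ (iteratedDeriv k φ) t :=
  (h.differentiable_iteratedDeriv k (by exact_mod_cast hk)) t

theorem hasDerivAt_diffOp' {P : ℝ[X]} {φ : ℝ → ℝ} {n : ℕ} (h : ContDiff ℝ n φ)
    (hP : P.natDegree < n) (t : ℝ) : HasDerivAt (diffOp P φ) (diffOp (X * P) φ t) t :=
  hasDerivAt_diffOp fun _ hk => differentiableAt_iteratedDeriv h (hk.trans_lt hP) t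

/-- `(X - λ) P` acts as the first-order operator `d/dt - λ` after `P`. -/
theorem hasDerivAt_diffOp_X_sub_C {P : ℝ[X]} {φ : ℝ → ℝ} {n : ℕ} (h : ContDiff ℝ n φ)
    (hP : P.natDegree < n) (b t : ℝ) :
    HasDerivAt (diffOp P φ) (diffOp ((X - C b) * P) φ t + b * diffOp P φ t) t := by
  rw [diffOp_X_sub_C_mul]
  simpa using hasDerivAt_diffOp' h hP t

theorem continuous_diffOp {P : ℝ[X]} {φ : ℝ → ℝ} {n : ℕ} (h : ContDiff ℝ n φ)
    (hP : P.natDegree ≤ n) : Continuous (diffOp P φ) := by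
  refine continuous_finsetSum _ fun k hk => continuous_const.mul ?_
  exact h.continuous_iteratedDeriv k (by exact_mod_cast (le_natDegree_of_mem_supp k hk).trans hP)

theorem diffOp_add_fun {P : ℝ[X]} {φ ψ : ℝ → ℝ} {t : ℝ} (c : ℝ)
    (h : ∀ k ≤ P.natDegree, iteratedDeriv k (fun s => φ s + c * ψ s) t =
      iteratedDeriv k φ t + c * iteratedDeriv k ψ t) :
    diffOp P (fun s => φ s + c * ψ s) t = diffOp P φ t + c * diffOp P ψ t := by
  unfold diffOp
  simp only [Polynomial.sum_def]
  rw [Finset.mul_sum, ← Finset.sum_add_distrib]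
  refine Finset.sum_congr rfl fun k hk => ?_
  rw [h k (le_natDegree_of_mem_supp k hk)]
  ring

theorem iteratedDeriv_add_mul {φ ψ : ℝ → ℝ} {n : ℕ} (hφ : ContDiff ℝ n φ) (hψ : ContDiff ℝ n ψ)
    (c : ℝ) {k : ℕ} (hk : k ≤ n) :
    iteratedDeriv k (fun s => φ s + c * ψ s) =
      fun t => iteratedDeriv k φ t + c * iteratedDeriv k ψ t := by
  induction k with
  | zero => simp
  | succ k ih =>
    funext t
    rw [iteratedDeriv_succ, ih (by omega), iteratedDeriv_succ, iteratedDeriv_succ]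
    exact ((differentiableAt_iteratedDeriv hφ hk t).hasDerivAt.add
      ((differentiableAt_iteratedDeriv hψ hk t).hasDerivAt.const_mul c)).deriv

/-- Linearity of iterated derivatives up to the order `n + 1`, where the top derivatives are only
assumed to exist at the point in question. -/
theorem iteratedDeriv_add_mul_succ {φ ψ : ℝ → ℝ} {n : ℕ} (hφ : ContDiff ℝ n φ)
    (hψ : ContDiff ℝ n ψ) (c : ℝ) {t : ℝ} (h1 : DifferentiableAt ℝ (iteratedDeriv n φ) t)
    (h2 : DifferentiableAt ℝ (iteratedDeriv n ψ) t) {k : ℕ} (hk : k ≤ n + 1) :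
    iteratedDeriv k (fun s => φ s + c * ψ s) t =
      iteratedDeriv k φ t + c * iteratedDeriv k ψ t := by
  rcases Nat.lt_or_ge k (n + 1) with hk' | hk'
  · rw [iteratedDeriv_add_mul hφ hψ c (by omega : k ≤ n)]
  · obtain rfl : k = n + 1 := by omega
    rw [iteratedDeriv_succ, iteratedDeriv_add_mul hφ hψ c le_rfl, iteratedDeriv_succ,
      iteratedDeriv_succ]
    exact (h1.hasDerivAt.add (h2.hasDerivAt.const_mul c)).deriv

theorem diffOp_const_mul (P : ℝ[X]) (c : ℝ) (φ : ℝ → ℝ) (t : ℝ) :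
    diffOp P (fun t => c * φ t) t = c * diffOp P φ t := by
  simp only [diffOp, Polynomial.sum_def, Finset.mul_sum]
  refine Finset.sum_congr rfl fun k _ => ?_
  rw [iteratedDeriv_const_mul_field]
  ring

theorem diffOp_comp_sub_const (P : ℝ[X]) (φ : ℝ → ℝ) (s t : ℝ) :
    diffOp P (fun t => φ (t - s)) t = diffOp P φ (t - s) := by
  simp only [diffOp, Polynomial.sum_def, iteratedDeriv_comp_sub_const]

/-! ### Sign changes and Rolle's theorem -/

/-- `f` changes sign at least `n` times: it takes nonzero values of alternating signs at some
`n + 1` increasing points. For `n = 0` this says that `f` is not identically zero. -/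
def HasSignChanges (n : ℕ) (f : ℝ → ℝ) : Prop :=
  ∃ (σ : ℝ) (t : ℕ → ℝ), (∀ i < n, t i < t (i + 1)) ∧ ∀ i ≤ n, 0 < σ * (-1) ^ i * f (t i)

theorem HasSignChanges.of_sign {n : ℕ} {f g : ℝ → ℝ} (h : HasSignChanges n f)
    (hfg : ∀ t σ, 0 < σ * f t → 0 < σ * g t) : HasSignChanges n g := by
  obtain ⟨σ, t, h1, h2⟩ := h
  exact ⟨σ, t, h1, fun i hi => hfg _ _ (h2 i hi)⟩

/-- Rolle's theorem in signed form, by the mean value theorem. -/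
theorem exists_deriv_pos {g g' : ℝ → ℝ} (hg : ∀ t, HasDerivAt g (g' t) t) {a b σ : ℝ}
    (hab : a < b) (h : 0 < σ * (g b - g a)) : ∃ s, a < s ∧ s < b ∧ 0 < σ * g' s := by
  obtain ⟨s, hs, hs'⟩ := exists_hasDerivAt_eq_slope g g' hab
    (fun x _ => (hg x).continuousAt.continuousWithinAt) (fun x _ => hg x)
  refine ⟨s, hs.1, hs.2, ?_⟩
  rw [hs', mul_div_assoc']
  exact div_pos h (sub_pos.2 hab)

/-- `exists_deriv_pos` with the left endpoint moved to `-∞`. -/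
theorem exists_deriv_pos_left {g g' : ℝ → ℝ} (hg : ∀ t, HasDerivAt g (g' t) t) {b σ : ℝ}
    (hlim : Tendsto g atBot (𝓝 0)) (h : 0 < σ * g b) : ∃ s < b, 0 < σ * g' s := by
  have h1 : Tendsto (fun a => σ * (g b - g a)) atBot (𝓝 (σ * (g b - 0))) :=
    (hlim.const_sub _).const_mul _
  rw [sub_zero] at h1
  obtain ⟨a, ha, ha'⟩ := ((h1.eventually (lt_mem_nhds h)).and (eventually_lt_atBot b)).exists
  obtain ⟨s, _, h3, h4⟩ := exists_deriv_pos hg ha' ha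
  exact ⟨s, h3, h4⟩

/-- `exists_deriv_pos` with the right endpoint moved to `+∞`. -/
theorem exists_deriv_pos_right {g g' : ℝ → ℝ} (hg : ∀ t, HasDerivAt g (g' t) t) {b σ : ℝ}
    (hlim : Tendsto g atTop (𝓝 0)) (h : 0 < σ * g b) : ∃ s > b, 0 < -σ * g' s := by
  have h1 : Tendsto (fun a => -σ * (g a - g b)) atTop (𝓝 (-σ * (0 - g b))) :=
    (hlim.sub_const _).const_mul _
  have h2 : -σ * (0 - g b) = σ * g b := by ring
  rw [h2] at h1
  obtain ⟨a, ha, ha'⟩ := ((h1.eventually (lt_mem_nhds h)).and (eventually_gt_atTop b)).exists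
  obtain ⟨s, h2, _, h4⟩ := exists_deriv_pos hg ha' ha
  exact ⟨s, h2, h4⟩

/-- Rolle's theorem on a half-line, counted in sign changes. -/
theorem HasSignChanges.deriv_of_atBot {n : ℕ} {g g' : ℝ → ℝ} (h : HasSignChanges n g)
    (hg : ∀ t, HasDerivAt g (g' t) t) (hlim : Tendsto g atBot (𝓝 0)) : HasSignChanges n g' := by
  obtain ⟨σ, t, h1, h2⟩ := h
  have key : ∀ i, ∃ s, i ≤ n → s < t i ∧ (∀ j, i = j + 1 → t j < s) ∧
      0 < σ * (-1) ^ i * g' s := by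
    intro i
    by_cases hi : i ≤ n
    · rcases i with _ | i
      · obtain ⟨s, hs, hs'⟩ := exists_deriv_pos_left hg hlim (h2 0 hi)
        exact ⟨s, fun _ => ⟨hs, by simp, hs'⟩⟩
      · have ha := h2 i (by omega)
        have hb := h2 (i + 1) hi
        obtain ⟨s, hs, hs', h3⟩ := exists_deriv_pos (σ := σ * (-1) ^ (i + 1)) hg
          (h1 i (by omega)) (by rw [mul_sub]; rw [pow_succ] at hb ⊢; linarith)
        exact ⟨s, fun _ => ⟨hs', fun j hj => by obtain rfl : i = j := by omega
                                                exact hs, h3⟩⟩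
    · exact ⟨0, fun h => absurd h hi⟩
  choose s hs using key
  exact ⟨σ, s, fun i hi => (hs i hi.le).1.trans ((hs (i + 1) hi).2.1 i rfl),
    fun i hi => (hs i hi).2.2⟩

/-- As `HasSignChanges.deriv_of_atBot`; a zero at the other end as well yields one more
sign change. -/
theorem HasSignChanges.deriv_of_atBot_of_atTop {n : ℕ} {g g' : ℝ → ℝ} (h : HasSignChanges n g)
    (hg : ∀ t, HasDerivAt g (g' t) t) (hlim : Tendsto g atBot (𝓝 0))
    (hlim' : Tendsto g atTop (𝓝 0)) : HasSignChanges (n + 1) g' := by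
  obtain ⟨σ, t, h1, h2⟩ := h
  have key : ∀ i, ∃ s, i ≤ n + 1 → (i ≤ n → s < t i) ∧ (∀ j, i = j + 1 → t j < s) ∧
      0 < σ * (-1) ^ i * g' s := by
    intro i
    rcases i with _ | i
    · obtain ⟨s, hs, hs'⟩ := exists_deriv_pos_left hg hlim (h2 0 (Nat.zero_le _))
      exact ⟨s, fun _ => ⟨fun _ => hs, by simp, hs'⟩⟩
    rcases lt_trichotomy i n with hi | hi | hi
    · have ha := h2 i (by omega)
      have hb := h2 (i + 1) hi
      obtain ⟨s, hs, hs', h3⟩ := exists_deriv_pos (σ := σ * (-1) ^ (i + 1)) hg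
        (h1 i (by omega)) (by rw [mul_sub]; rw [pow_succ] at hb ⊢; linarith)
      exact ⟨s, fun _ => ⟨fun _ => hs', fun j hj => by obtain rfl : i = j := by omega
                                                       exact hs, h3⟩⟩
    · obtain ⟨s, hs, hs'⟩ := exists_deriv_pos_right hg hlim' (h2 i hi.le)
      exact ⟨s, fun _ => ⟨fun h => by omega, fun j hj => by obtain rfl : i = j := by omega
                                                            exact hs,
        by rw [pow_succ]; linarith⟩⟩
    · exact ⟨0, fun h => by omega⟩
  choose s hs using key
  exact ⟨σ, s, fun i hi => ((hs i hi.le).1 (by omega)).trans ((hs (i + 1) hi).2.1 i rfl),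
    fun i hi => (hs i hi).2.2⟩

theorem HasSignChanges.deriv_of_atTop {n : ℕ} {g g' : ℝ → ℝ} (h : HasSignChanges n g)
    (hg : ∀ t, HasDerivAt g (g' t) t) (hlim : Tendsto g atTop (𝓝 0)) : HasSignChanges n g' := by
  obtain ⟨σ, t, h1, h2⟩ := h
  have key : ∀ i, ∃ s, i ≤ n → t i < s ∧ (i < n → s < t (i + 1)) ∧
      0 < -σ * (-1) ^ i * g' s := by
    intro i
    rcases lt_trichotomy i n with hi | hi | hi
    · have ha := h2 i hi.le
      have hb := h2 (i + 1) hi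
      obtain ⟨s, hs, hs', h3⟩ := exists_deriv_pos (σ := -σ * (-1) ^ i) hg
        (h1 i hi) (by rw [mul_sub]; rw [pow_succ] at hb; linarith)
      exact ⟨s, fun _ => ⟨hs, fun _ => hs', h3⟩⟩
    · obtain ⟨s, hs, hs'⟩ := exists_deriv_pos_right hg hlim (h2 i hi.le)
      exact ⟨s, fun _ => ⟨hs, fun h => by omega, by linarith⟩⟩
    · exact ⟨0, fun h => by omega⟩
  choose s hs using key
  exact ⟨-σ, s, fun i hi => ((hs i hi.le).2.1 hi).trans (hs (i + 1) hi).1,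
    fun i hi => (hs i hi).2.2⟩

theorem HasSignChanges.exp_mul {n : ℕ} {f : ℝ → ℝ} (h : HasSignChanges n f) (b : ℝ) :
    HasSignChanges n fun t => Real.exp (b * t) * f t :=
  h.of_sign fun t σ hσ => by
    have := mul_pos (Real.exp_pos (b * t)) hσ
    linarith

/-- Multiplication by an exponential does not affect sign changes. -/
theorem HasSignChanges.of_exp_mul {n : ℕ} {f : ℝ → ℝ} {b : ℝ}
    (h : HasSignChanges n fun t => Real.exp (b * t) * f t) : HasSignChanges n f :=
  h.of_sign fun t σ hσ => by
    have h1 : σ * (Real.exp (b * t) * f t) = Real.exp (b * t) * (σ * f t) := by ring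
    rw [h1] at hσ
    exact pos_of_mul_pos_right hσ (Real.exp_pos _).le

/-- The operator `d/dt - b` is `d/dt` conjugated by `e^{bt}`. -/
theorem hasDerivAt_exp_neg_mul {f f' : ℝ → ℝ} {b t : ℝ}
    (hf : HasDerivAt f (f' t + b * f t) t) :
    HasDerivAt (fun t => Real.exp (-b * t) * f t) (Real.exp (-b * t) * f' t) t := by
  have h1 : HasDerivAt (fun t : ℝ => Real.exp (-b * t)) (Real.exp (-b * t) * (-b)) t := by
    simpa using ((hasDerivAt_id t).const_mul (-b)).exp
  exact (h1.mul hf).congr_deriv (by ring)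

/-- For `b ≠ 0` the operator `d/dt - b` does not decrease the number of sign changes of a function
that vanishes at `±∞`: the weight `e^{-bt}` is bounded at one of the two ends. -/
theorem HasSignChanges.sub_mul {n : ℕ} {f f' : ℝ → ℝ} {b : ℝ} (h : HasSignChanges n f)
    (hf : ∀ t, HasDerivAt f (f' t + b * f t) t) (hb : b ≠ 0) (h0 : Tendsto f atBot (𝓝 0))
    (h1 : Tendsto f atTop (𝓝 0)) : HasSignChanges n f' := by
  refine HasSignChanges.of_exp_mul (b := -b) ?_
  rcases hb.lt_or_gt with hb | hb
  · refine (h.exp_mul (-b)).deriv_of_atBot (fun t => hasDerivAt_exp_neg_mul (hf t)) ?_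
    have h2 : Tendsto (fun t => Real.exp (-b * t)) atBot (𝓝 0) :=
      Real.tendsto_exp_atBot.comp (tendsto_id.const_mul_atBot (by linarith))
    simpa using h2.mul h0
  · refine (h.exp_mul (-b)).deriv_of_atTop (fun t => hasDerivAt_exp_neg_mul (hf t)) ?_
    have h2 : Tendsto (fun t => Real.exp (-b * t)) atTop (𝓝 0) :=
      Real.tendsto_exp_atBot.comp (tendsto_id.const_mul_atTop_of_neg (by linarith))
    simpa using h2.mul h1

/-- If moreover `e^{-bt} f` vanishes at `-∞` for some `b > 0`, then `d/dt - b` adds a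
sign change. -/
theorem HasSignChanges.sub_mul_succ {n : ℕ} {f f' : ℝ → ℝ} {b : ℝ} (h : HasSignChanges n f)
    (hf : ∀ t, HasDerivAt f (f' t + b * f t) t) (hb : 0 < b)
    (h0 : Tendsto (fun t => Real.exp (-b * t) * f t) atBot (𝓝 0))
    (h1 : Tendsto f atTop (𝓝 0)) : HasSignChanges (n + 1) f' := by
  refine HasSignChanges.of_exp_mul (b := -b) ?_
  refine (h.exp_mul (-b)).deriv_of_atBot_of_atTop (fun t => hasDerivAt_exp_neg_mul (hf t)) h0 ?_
  have h2 : Tendsto (fun t => Real.exp (-b * t)) atTop (𝓝 0) :=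
    Real.tendsto_exp_atBot.comp (tendsto_id.const_mul_atTop_of_neg (by linarith))
  simpa using h2.mul h1

/-- A continuous function changes sign at most as often as it has zeros. -/
theorem HasSignChanges.le_ncard {n : ℕ} {f : ℝ → ℝ} (h : HasSignChanges n f) (hf : Continuous f)
    (hfin : {t | f t = 0}.Finite) : n ≤ {t | f t = 0}.ncard := by
  obtain ⟨σ, t, h1, h2⟩ := h
  have key : ∀ i, ∃ s, i < n → t i < s ∧ s < t (i + 1) ∧ f s = 0 := by
    intro i
    by_cases hi : i < n
    · have ha := h2 i hi.le
      have hb := h2 (i + 1) hi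
      have hc : ContinuousOn (fun s => σ * (-1) ^ i * f s) (Icc (t i) (t (i + 1))) :=
        (continuous_const.mul hf).continuousOn
      obtain ⟨s, hs, hs'⟩ := intermediate_value_Ioo' (h1 i hi).le hc
        (show (0 : ℝ) ∈ _ from ⟨by rw [pow_succ] at hb; linarith, ha⟩)
      refine ⟨s, fun _ => ⟨hs.1, hs.2, ?_⟩⟩
      have h3 : σ * (-1) ^ i ≠ 0 := fun h => by rw [h] at ha; simp at ha
      exact (mul_eq_zero.1 hs').resolve_left h3
    · exact ⟨0, fun h => absurd h hi⟩
  choose s hs using key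
  have hlt : ∀ i j, i < j → j < n → s i < s j := by
    intro i j hij
    induction j with
    | zero => omega
    | succ j ih =>
      intro hj
      have h3 : s j < s (j + 1) := (hs j (by omega)).2.1.trans (hs (j + 1) hj).1
      rcases Nat.lt_or_ge i j with h | h
      · exact (ih h (by omega)).trans h3
      · obtain rfl : i = j := by omega
        exact h3
  calc n = (Finset.range n).card := (Finset.card_range n).symm
    _ ≤ hfin.toFinset.card := by
      refine Finset.card_le_card_of_injOn s (fun i hi => ?_) fun i hi j hj hij => ?_
      · simpa using (hs i (by simpa using hi)).2.2
      · simp only [Finset.coe_range, mem_Iio] at hi hj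
        rcases lt_trichotomy i j with h | h | h
        · exact absurd hij (hlt i j h hj).ne
        · exact h
        · exact absurd hij (hlt j i h hi).ne'
    _ = _ := (Set.ncard_eq_toFinset_card _ hfin).symm

/-! ### Dominant modes of weakly coupled systems -/

section Dichotomy

variable {S s S' s' e : ℝ → ℝ} {a b : ℝ}

/-- The cone `{η s ≤ S}` is forward invariant as long as `η`, which may grow exponentially at a rate
`δ ≤ b - a`, stays below `H` and the error `e` is small in terms of `H`. -/
theorem cone_invariant (hS : ∀ t, HasDerivAt S (S' t) t) (hs : ∀ t, HasDerivAt s (s' t) t)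
    (hs0 : ∀ t, 0 ≤ s t) (hpos : ∀ t, 0 < S t + s t) (hab : a < b)
    (hS' : ∀ t, 2 * b * S t - e t * (S t + s t) ≤ S' t)
    (hs' : ∀ t, s' t ≤ 2 * a * s t + e t * (S t + s t)) (he0 : ∀ t, 0 ≤ e t)
    {η₀ H T T₁ δ : ℝ} (hη : 0 < η₀) (hδ0 : 0 ≤ δ) (hδ : δ ≤ b - a)
    (he : ∀ t ≥ T, e t * (1 + H) ^ 2 < (b - a) * η₀)
    (hH : ∀ t ∈ Icc T T₁, η₀ * Real.exp (δ * (t - T)) ≤ H) (h0 : η₀ * s T ≤ S T) :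
    ∀ t ∈ Icc T T₁, η₀ * Real.exp (δ * (t - T)) * s t ≤ S t := by
  have hη' : ∀ t, HasDerivAt (fun t => η₀ * Real.exp (δ * (t - T)))
      (η₀ * (Real.exp (δ * (t - T)) * δ)) t := fun t => by
    simpa using (((hasDerivAt_id t).sub_const T).const_mul δ).exp.const_mul η₀
  have hd := fun t => (hη' t).mul (hs t)
  refine fun t ht => image_le_of_deriv_right_lt_deriv_boundary' (a := T) (b := T₁)
    (f := fun t => η₀ * Real.exp (δ * (t - T)) * s t)
    (fun t _ => (hd t).continuousAt.continuousWithinAt) (fun t _ => (hd t).hasDerivWithinAt)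
    (by simpa using h0) (fun t _ => (hS t).continuousAt.continuousWithinAt)
    (fun t _ => (hS t).hasDerivWithinAt) (fun t ht heq => ?_) ht
  set η := η₀ * Real.exp (δ * (t - T)) with hηdef
  have h1 : η₀ ≤ η := le_mul_of_one_le_right hη.le
    (Real.one_le_exp (mul_nonneg hδ0 (sub_nonneg.2 ht.1)))
  have h2 : η ≤ H := hH t ⟨ht.1, ht.2.le⟩
  have h3 : 0 < s t := by
    have h4 := hpos t
    rw [← heq] at h4
    rcases (hs0 t).lt_or_eq with h | h
    · exact h
    · rw [← h] at h4; simp at h4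
  have h5 : e t * (1 + η) ^ 2 ≤ e t * (1 + H) ^ 2 :=
    mul_le_mul_of_nonneg_left (pow_le_pow_left₀ (by linarith) (by linarith) 2) (he0 t)
  have h6 := he t ht.1
  have h7 : (b - a) * η₀ ≤ (b - a) * η := mul_le_mul_of_nonneg_left h1 (by linarith)
  have h8 : δ * η ≤ (b - a) * η := mul_le_mul_of_nonneg_right hδ (by linarith)
  have h9 := hS' t
  have h10 := mul_le_mul_of_nonneg_left (hs' t) (hη.le.trans h1)
  rw [← heq] at h9 h10
  have h11 : 0 < s t * ((2 * (b - a)) * η - e t * (1 + η) ^ 2 - δ * η) :=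
    mul_pos h3 (by linarith)
  have h12 : η₀ * (Real.exp (δ * (t - T)) * δ) = δ * η := by rw [hηdef]; ring
  rw [h12]
  nlinarith

/-- If `S` grows at a rate at least `2b` and `s` at a rate at most `2a < 2b`, up to errors that
are small relative to `S + s`, then one of the two is eventually negligible. -/
theorem growth_dichotomy (hS : ∀ t, HasDerivAt S (S' t) t) (hs : ∀ t, HasDerivAt s (s' t) t)
    (hs0 : ∀ t, 0 ≤ s t) (hpos : ∀ t, 0 < S t + s t) (hab : a < b)
    (hS' : ∀ t, 2 * b * S t - e t * (S t + s t) ≤ S' t)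
    (hs' : ∀ t, s' t ≤ 2 * a * s t + e t * (S t + s t)) (he0 : ∀ t, 0 ≤ e t)
    (he : Tendsto e atTop (𝓝 0)) :
    (∀ θ > 0, ∀ᶠ t in atTop, s t ≤ θ * S t) ∨ (∀ θ > 0, ∀ᶠ t in atTop, S t ≤ θ * s t) := by
  by_contra! hcon
  obtain ⟨⟨θ, hθ, h1⟩, η, hη, h2⟩ := hcon
  refine h1 ?_
  set H := max (1 / θ) η with hHdef
  have hH1 : η ≤ H := le_max_right _ _
  have hH2 : 1 / θ ≤ H := le_max_left _ _
  have hH0 : 0 < H := hη.trans_le hH1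
  have hba : 0 < b - a := sub_pos.2 hab
  have he1 : ∀ᶠ t in atTop, ∀ r ≥ t, e r * (1 + H) ^ 2 < (b - a) * η := by
    have h3 : Tendsto (fun t => e t * (1 + H) ^ 2) atTop (𝓝 (0 * (1 + H) ^ 2)) :=
      he.mul_const _
    rw [zero_mul] at h3
    obtain ⟨T, hT⟩ := eventually_atTop.1 (h3.eventually (gt_mem_nhds (mul_pos hba hη)))
    filter_upwards [eventually_ge_atTop T] with t ht r hr
    exact hT r (ht.trans hr)
  obtain ⟨T, hT, hT'⟩ := (h2.and_eventually he1).exists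
  have hlog : 0 ≤ Real.log (H / η) := Real.log_nonneg ((one_le_div hη).2 hH1)
  set T₁ := T + Real.log (H / η) / (b - a) with hT₁
  have hTT : T ≤ T₁ := le_add_of_nonneg_right (div_nonneg hlog hba.le)
  have hexp : η * Real.exp ((b - a) * (T₁ - T)) = H := by
    have : (b - a) * (T₁ - T) = Real.log (H / η) := by rw [hT₁]; field_simp; ring
    rw [this, Real.exp_log (div_pos hH0 hη)]; field_simp
  -- first the ratio `S / s` climbs from `η` to `H`, afterwards it stays above `H`
  have h4 := cone_invariant hS hs hs0 hpos hab hS' hs' he0 (T := T) (T₁ := T₁) (H := H)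
    hη hba.le le_rfl hT' (fun t ht => by
      rw [← hexp]
      have : (b - a) * (t - T) ≤ (b - a) * (T₁ - T) :=
        mul_le_mul_of_nonneg_left (by linarith [ht.2]) hba.le
      exact mul_le_mul_of_nonneg_left (Real.exp_le_exp.2 this) hη.le)
    hT.le T₁ ⟨hTT, le_rfl⟩
  rw [hexp] at h4
  filter_upwards [eventually_ge_atTop T₁] with t ht
  have h5 := cone_invariant hS hs hs0 hpos hab hS' hs' he0 (T := T₁) (T₁ := t) (H := H)
    hH0 le_rfl hba.le
    (fun r hr => (hT' r (hTT.trans hr)).trans_le (mul_le_mul_of_nonneg_left hH1 hba.le))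
    (fun r _ => by simp) h4 t ⟨ht, le_rfl⟩
  simp only [zero_mul, Real.exp_zero, mul_one] at h5
  have h6 : 1 / θ * s t ≤ S t := (mul_le_mul_of_nonneg_right hH2 (hs0 t)).trans h5
  rw [one_div, inv_mul_le_iff₀ hθ] at h6
  exact not_lt.2 h6

end Dichotomy

section System

variable {ι : Type*} [Fintype ι] {y : ι → ℝ → ℝ} {lam c : ι → ℝ} {V : ℝ → ℝ}

/-- The contribution of the coupling to the derivative of `y_i²` is small compared to the total
energy `∑ y_j²` when `V` is small. -/
theorem abs_coupling_le (i : ι) (t : ℝ) :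
    |2 * y i t * (V t * ∑ j, c j * y j t)| ≤
      2 * |V t| * (∑ j, |c j|) * ∑ j, y j t ^ 2 := by
  have h1 : ∀ j, |y i t| * |y j t| ≤ ∑ k, y k t ^ 2 := by
    classical
    intro j
    have hi : y i t ^ 2 ≤ ∑ k, y k t ^ 2 :=
      Finset.single_le_sum (f := fun k => y k t ^ 2) (fun k _ => sq_nonneg _) (Finset.mem_univ i)
    have hj : y j t ^ 2 ≤ ∑ k, y k t ^ 2 :=
      Finset.single_le_sum (f := fun k => y k t ^ 2) (fun k _ => sq_nonneg _) (Finset.mem_univ j)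
    rw [← sq_abs] at hi hj
    nlinarith [sq_nonneg (|y i t| - |y j t|)]
  have h2 : |y i t| * |∑ j, c j * y j t| ≤ (∑ j, |c j|) * ∑ k, y k t ^ 2 := by
    rw [Finset.sum_mul]
    calc |y i t| * |∑ j, c j * y j t| ≤ |y i t| * ∑ j, |c j * y j t| :=
          mul_le_mul_of_nonneg_left (Finset.abs_sum_le_sum_abs _ _) (abs_nonneg _)
      _ = ∑ j, |c j| * (|y i t| * |y j t|) := by
          rw [Finset.mul_sum]
          exact Finset.sum_congr rfl fun j _ => by rw [abs_mul]; ring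
      _ ≤ _ := Finset.sum_le_sum fun j _ => mul_le_mul_of_nonneg_left (h1 j) (abs_nonneg _)
  rw [abs_mul, abs_mul, abs_mul, abs_two]
  calc 2 * |y i t| * (|V t| * |∑ j, c j * y j t|)
      = 2 * |V t| * (|y i t| * |∑ j, c j * y j t|) := by ring
    _ ≤ 2 * |V t| * ((∑ j, |c j|) * ∑ k, y k t ^ 2) :=
        mul_le_mul_of_nonneg_left h2 (by positivity)
    _ = _ := by ring

theorem hasDerivAt_sum_sq
    (hy : ∀ i t, HasDerivAt (y i) (lam i * y i t + V t * ∑ j, c j * y j t) t)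
    (I : Finset ι) (t : ℝ) :
    HasDerivAt (fun t => ∑ i ∈ I, y i t ^ 2)
      (∑ i ∈ I, (2 * lam i * y i t ^ 2 + 2 * y i t * (V t * ∑ j, c j * y j t))) t := by
  refine HasDerivAt.fun_sum fun i _ => ?_
  refine ((hy i t).pow 2).congr_deriv ?_
  simp
  ring

/-- The error term common to all the partial energies of the system. -/
theorem sum_coupling_le (I : Finset ι) (t : ℝ) :
    |∑ i ∈ I, 2 * y i t * (V t * ∑ j, c j * y j t)| ≤
      (Fintype.card ι * (2 * |V t| * ∑ j, |c j|)) * ∑ j, y j t ^ 2 := by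
  refine (Finset.abs_sum_le_sum_abs _ _).trans ?_
  refine (Finset.sum_le_sum fun i _ => abs_coupling_le i t).trans ?_
  rw [Finset.sum_const, nsmul_eq_mul, mul_assoc (Fintype.card ι : ℝ)]
  refine mul_le_mul_of_nonneg_right ?_ ?_
  · exact_mod_cast Finset.card_le_univ I
  · have : 0 ≤ ∑ j, y j t ^ 2 := Finset.sum_nonneg fun j _ => sq_nonneg _
    have : 0 ≤ ∑ j, |c j| := Finset.sum_nonneg fun j _ => abs_nonneg _
    positivity

/-- A solution of a linear system with bounded coupling that vanishes at one point vanishes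
identically. -/
theorem eq_zero_of_eq_zero
    (hy : ∀ i t, HasDerivAt (y i) (lam i * y i t + V t * ∑ j, c j * y j t) t)
    {M : ℝ} (hV : ∀ t, |V t| ≤ M) {t₀ : ℝ} (h0 : ∀ i, y i t₀ = 0) (t : ℝ) (i : ι) :
    y i t = 0 := by
  set N := fun t => ∑ i, y i t ^ 2 with hN
  set N' := fun t => ∑ i, (2 * lam i * y i t ^ 2 + 2 * y i t * (V t * ∑ j, c j * y j t)) with hN'
  have hd : ∀ t, HasDerivAt N (N' t) t := hasDerivAt_sum_sq hy Finset.univ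
  set K := 2 * (∑ i, |lam i|) + Fintype.card ι * (2 * M * ∑ j, |c j|) with hK
  have hN0 : ∀ t, 0 ≤ N t := fun t => Finset.sum_nonneg fun j _ => sq_nonneg _
  have hb : ∀ t, |N' t| ≤ K * N t := by
    intro t
    have h1 : |∑ i, 2 * lam i * y i t ^ 2| ≤ 2 * (∑ i, |lam i|) * N t := by
      refine (Finset.abs_sum_le_sum_abs _ _).trans ?_
      rw [hN, Finset.mul_sum]
      refine Finset.sum_le_sum fun i _ => ?_
      rw [abs_mul, abs_mul, abs_two, abs_of_nonneg (sq_nonneg (y i t))]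
      refine mul_le_mul_of_nonneg_right (mul_le_mul_of_nonneg_left ?_ two_pos.le) (sq_nonneg _)
      exact Finset.single_le_sum (f := fun k => |lam k|) (fun k _ => abs_nonneg _)
        (Finset.mem_univ i)
    have h2 := sum_coupling_le (y := y) (c := c) (V := V) Finset.univ t
    have h3 : (Fintype.card ι * (2 * |V t| * ∑ j, |c j|)) * N t ≤
        (Fintype.card ι * (2 * M * ∑ j, |c j|)) * N t := by
      have : 0 ≤ ∑ j, |c j| := Finset.sum_nonneg fun j _ => abs_nonneg _
      have := hV t
      have := hN0 t
      gcongr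
    calc |N' t| = |(∑ i, 2 * lam i * y i t ^ 2) +
          ∑ i, 2 * y i t * (V t * ∑ j, c j * y j t)| := by
            rw [hN', ← Finset.sum_add_distrib]
      _ ≤ _ := abs_add_le _ _
      _ ≤ _ := add_le_add h1 (h2.trans h3)
      _ = K * N t := by rw [hK]; ring
  have hNt0 : N t₀ = 0 := by simp [hN, h0]
  have hexp : ∀ (κ t : ℝ), HasDerivAt (fun t => Real.exp (κ * t) * N t)
      (Real.exp (κ * t) * (κ * N t + N' t)) t := by
    intro κ t
    have h1 : HasDerivAt (fun t : ℝ => Real.exp (κ * t)) (Real.exp (κ * t) * κ) t := by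
      simpa using ((hasDerivAt_id t).const_mul κ).exp
    exact (h1.mul (hd t)).congr_deriv (by ring)
  have hNt : N t ≤ 0 := by
    rcases le_total t t₀ with h | h
    · have hm : Monotone (fun t => Real.exp (K * t) * N t) := by
        refine monotone_of_deriv_nonneg (fun t => (hexp K t).differentiableAt) fun t => ?_
        rw [(hexp K t).deriv]
        have := neg_abs_le (N' t)
        exact mul_nonneg (Real.exp_pos _).le (by linarith [hb t])
      have := hm h
      simp only [hNt0, mul_zero] at this
      exact nonpos_of_mul_nonpos_right this (Real.exp_pos _)
    · have hm : Antitone (fun t => Real.exp (-K * t) * N t) := by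
        refine antitone_of_deriv_nonpos (fun t => (hexp (-K) t).differentiableAt) fun t => ?_
        rw [(hexp (-K) t).deriv]
        have := le_abs_self (N' t)
        exact mul_nonpos_of_nonneg_of_nonpos (Real.exp_pos _).le (by linarith [hb t])
      have := hm h
      simp only [hNt0, mul_zero] at this
      exact nonpos_of_mul_nonpos_right this (Real.exp_pos _)
  have h1 : y i t ^ 2 ≤ N t :=
    Finset.single_le_sum (f := fun k => y k t ^ 2) (fun k _ => sq_nonneg _) (Finset.mem_univ i)
  exact pow_eq_zero_iff two_ne_zero |>.1 (le_antisymm (h1.trans hNt) (sq_nonneg _))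

/-- The dichotomy between the modes with exponents above and below a spectral gap. -/
theorem mode_dichotomy [DecidableEq ι]
    (hy : ∀ i t, HasDerivAt (y i) (lam i * y i t + V t * ∑ j, c j * y j t) t)
    (hV : Tendsto V atTop (𝓝 0)) (hne : ∀ t, 0 < ∑ i, y i t ^ 2) (I : Finset ι) {a b : ℝ}
    (hab : a < b) (hb : ∀ i ∈ I, b ≤ lam i) (ha : ∀ i ∉ I, lam i ≤ a) :
    (∀ θ > 0, ∀ᶠ t in atTop, ∑ i ∈ Iᶜ, y i t ^ 2 ≤ θ * ∑ i ∈ I, y i t ^ 2) ∨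
      (∀ θ > 0, ∀ᶠ t in atTop, ∑ i ∈ I, y i t ^ 2 ≤ θ * ∑ i ∈ Iᶜ, y i t ^ 2) := by
  have hsum : ∀ t, ∑ i ∈ I, y i t ^ 2 + ∑ i ∈ Iᶜ, y i t ^ 2 = ∑ i, y i t ^ 2 := fun t =>
    Finset.sum_add_sum_compl I _
  refine growth_dichotomy (a := a) (b := b)
    (e := fun t => Fintype.card ι * (2 * |V t| * ∑ j, |c j|))
    (hasDerivAt_sum_sq hy I) (hasDerivAt_sum_sq hy Iᶜ)
    (fun t => Finset.sum_nonneg fun j _ => sq_nonneg _)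
    (fun t => by rw [hsum]; exact hne t) hab (fun t => ?_) (fun t => ?_) (fun t => ?_) ?_
  · rw [hsum, Finset.sum_add_distrib]
    have h1 := neg_le_of_abs_le (sum_coupling_le (y := y) (c := c) (V := V) I t)
    have h2 : 2 * b * ∑ i ∈ I, y i t ^ 2 ≤ ∑ i ∈ I, 2 * lam i * y i t ^ 2 := by
      rw [Finset.mul_sum]
      exact Finset.sum_le_sum fun i hi =>
        mul_le_mul_of_nonneg_right (by linarith [hb i hi]) (sq_nonneg _)
    linarith
  · rw [hsum, Finset.sum_add_distrib]
    have h1 := le_of_abs_le (sum_coupling_le (y := y) (c := c) (V := V) Iᶜ t)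
    have h2 : ∑ i ∈ Iᶜ, 2 * lam i * y i t ^ 2 ≤ 2 * a * ∑ i ∈ Iᶜ, y i t ^ 2 := by
      rw [Finset.mul_sum]
      exact Finset.sum_le_sum fun i hi =>
        mul_le_mul_of_nonneg_right (by linarith [ha i (Finset.mem_compl.1 hi)]) (sq_nonneg _)
    linarith
  · have : 0 ≤ ∑ j, |c j| := Finset.sum_nonneg fun j _ => abs_nonneg _
    positivity
  · have h1 : Tendsto (fun t => Fintype.card ι * (2 * |V t| * ∑ j, |c j|)) atTop
        (𝓝 (Fintype.card ι * (2 * |0| * ∑ j, |c j|))) :=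
      (((hV.abs).const_mul 2).mul_const _).const_mul _
    simpa using h1

/-- One mode eventually dominates all the others. -/
theorem exists_dominant_mode [DecidableEq ι] [Nonempty ι] (hlam : Function.Injective lam)
    (hy : ∀ i t, HasDerivAt (y i) (lam i * y i t + V t * ∑ j, c j * y j t) t)
    (hV : Tendsto V atTop (𝓝 0)) (hne : ∀ t, 0 < ∑ i, y i t ^ 2) :
    ∃ k, ∀ θ > 0, ∀ᶠ t in atTop, ∑ i ∈ Finset.univ.erase k, y i t ^ 2 ≤ θ * y k t ^ 2 := by
  classical
  -- `B k`: the modes faster than `k` are negligible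
  let up : ι → Finset ι := fun k => Finset.univ.filter fun i => lam k < lam i
  let B : ι → Prop := fun k => ∀ θ > 0, ∀ᶠ t in atTop,
    ∑ i ∈ up k, y i t ^ 2 ≤ θ * ∑ i ∈ (up k)ᶜ, y i t ^ 2
  obtain ⟨kmax, -, hkmax⟩ := Finset.exists_max_image Finset.univ lam Finset.univ_nonempty
  have hBmax : B kmax := fun θ hθ => Eventually.of_forall fun t => by
    have : up kmax = ∅ := Finset.filter_eq_empty_iff.2 fun i hi => (hkmax i hi).not_gt
    rw [this, Finset.sum_empty]
    exact mul_nonneg hθ.le (Finset.sum_nonneg fun j _ => sq_nonneg _)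
  obtain ⟨k, hk, hkmin⟩ := Finset.exists_min_image (Finset.univ.filter B) lam
    ⟨kmax, by simpa using hBmax⟩
  have hBk : B k := (Finset.mem_filter.1 hk).2
  -- the modes slower than `k` are negligible as well, by minimality of `k`
  have hlow : ∀ θ > 0, ∀ᶠ t in atTop, ∑ i ∈ (insert k (up k))ᶜ, y i t ^ 2 ≤
      θ * ∑ i ∈ insert k (up k), y i t ^ 2 := by
    by_cases hemp : (insert k (up k))ᶜ = ∅
    · intro θ hθ
      refine Eventually.of_forall fun t => ?_
      rw [hemp, Finset.sum_empty]
      exact mul_nonneg hθ.le (Finset.sum_nonneg fun j _ => sq_nonneg _)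
    · obtain ⟨j, hj, hjmax⟩ := Finset.exists_max_image _ lam (Finset.nonempty_iff_ne_empty.2 hemp)
      have hmem : ∀ i, i ∈ (insert k (up k))ᶜ ↔ lam i < lam k := by
        intro i
        simp only [Finset.mem_compl, Finset.mem_insert, up, Finset.mem_filter, Finset.mem_univ,
          true_and, not_or, not_lt]
        exact ⟨fun h => lt_of_le_of_ne h.2 fun h' => h.1 (hlam h'),
          fun h => ⟨fun h' => h.ne (by rw [h']), h.le⟩⟩
      have hjk : lam j < lam k := (hmem j).1 hj
      have hup : up j = insert k (up k) := by
        ext i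
        have h1 : i ∈ insert k (up k) ↔ ¬ lam i < lam k := by
          rw [← hmem, Finset.mem_compl, not_not]
        rw [h1]
        simp only [up, Finset.mem_filter, Finset.mem_univ, true_and]
        refine ⟨fun h h' => ?_, fun h => hjk.trans_le (not_lt.1 h)⟩
        exact (hjmax i ((hmem i).2 h')).not_gt h
      have hnB : ¬ B j := fun hB => (hkmin j (by simpa using hB)).not_gt hjk
      rcases mode_dichotomy hy hV hne (insert k (up k)) (a := lam j) (b := lam k) hjk
        (fun i hi => not_lt.1 fun h => Finset.mem_compl.1 ((hmem i).2 h) hi)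
        (fun i hi => hjmax i (Finset.mem_compl.2 hi)) with h | h
      · exact h
      · rw [← hup] at h
        exact absurd h hnB
  refine ⟨k, fun θ hθ => ?_⟩
  set η := min (1 / 2) (θ / 4) with hη
  have hη0 : 0 < η := lt_min (by norm_num) (by linarith)
  have hη1 : η ≤ 1 / 2 := min_le_left _ _
  have hη2 : η ≤ θ / 4 := min_le_right _ _
  filter_upwards [hBk η hη0, hlow η hη0] with t h1 h2
  have hkup : k ∉ up k := by simp [up]
  have e1 : ∑ i ∈ (up k)ᶜ, y i t ^ 2 = y k t ^ 2 + ∑ i ∈ (insert k (up k))ᶜ, y i t ^ 2 := by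
    rw [Finset.compl_insert]
    exact (Finset.add_sum_erase _ _ (Finset.mem_compl.2 hkup)).symm
  have e2 : ∑ i ∈ insert k (up k), y i t ^ 2 = y k t ^ 2 + ∑ i ∈ up k, y i t ^ 2 :=
    Finset.sum_insert hkup
  have e3 : ∑ i ∈ Finset.univ.erase k, y i t ^ 2 =
      ∑ i ∈ up k, y i t ^ 2 + ∑ i ∈ (insert k (up k))ᶜ, y i t ^ 2 := by
    have h3 := Finset.sum_add_sum_compl (insert k (up k)) fun i => y i t ^ 2
    have h4 := Finset.add_sum_erase Finset.univ (fun i => y i t ^ 2) (Finset.mem_univ k)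
    rw [e2] at h3
    linarith
  rw [e1] at h1
  rw [e2] at h2
  rw [e3]
  have hA : 0 ≤ ∑ i ∈ up k, y i t ^ 2 := Finset.sum_nonneg fun j _ => sq_nonneg _
  have hD : 0 ≤ ∑ i ∈ (insert k (up k))ᶜ, y i t ^ 2 := Finset.sum_nonneg fun j _ => sq_nonneg _
  set A := ∑ i ∈ up k, y i t ^ 2
  set D := ∑ i ∈ (insert k (up k))ᶜ, y i t ^ 2
  have h5 : η * A ≤ 1 / 2 * A := mul_le_mul_of_nonneg_right hη1 hA
  have h6 : η * D ≤ 1 / 2 * D := mul_le_mul_of_nonneg_right hη1 hD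
  have h7 : η * y k t ^ 2 ≤ θ / 4 * y k t ^ 2 := mul_le_mul_of_nonneg_right hη2 (sq_nonneg _)
  linarith

/-- Near `+∞` every mode is controlled by any linear combination with nonzero coefficients, such
as the one that drives the system. -/
theorem exists_forall_abs_le [Nonempty ι] (hlam : Function.Injective lam) (hc : ∀ i, c i ≠ 0)
    (hy : ∀ i t, HasDerivAt (y i) (lam i * y i t + V t * ∑ j, c j * y j t) t)
    (hV : Tendsto V atTop (𝓝 0)) (hne : ∀ t, 0 < ∑ i, y i t ^ 2) :
    ∃ C, ∀ᶠ t in atTop, ∀ i, |y i t| ≤ C * |∑ j, c j * y j t| := by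
  classical
  obtain ⟨k, hk⟩ := exists_dominant_mode hlam hy hV hne
  set K := ∑ j, |c j| with hK
  have hck : 0 < |c k| := abs_pos.2 (hc k)
  have hKk : |c k| ≤ K :=
    Finset.single_le_sum (f := fun j => |c j|) (fun j _ => abs_nonneg _) (Finset.mem_univ k)
  have hK0 : 0 < K := hck.trans_le hKk
  set δ := |c k| / (2 * K) with hδ
  have hδ0 : 0 < δ := by positivity
  have hδ1 : δ ≤ 1 := by rw [hδ, div_le_one (by positivity)]; linarith
  refine ⟨2 / |c k|, ?_⟩
  filter_upwards [hk (δ ^ 2) (by positivity)] with t ht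
  have h1 : ∀ i ≠ k, |y i t| ≤ δ * |y k t| := by
    intro i hi
    have h2 : y i t ^ 2 ≤ ∑ i ∈ Finset.univ.erase k, y i t ^ 2 :=
      Finset.single_le_sum (f := fun k => y k t ^ 2) (fun k _ => sq_nonneg _)
        (Finset.mem_erase.2 ⟨hi, Finset.mem_univ i⟩)
    refine abs_le_of_sq_le_sq ?_ (by positivity)
    rw [mul_pow, sq_abs]
    exact h2.trans ht
  have h2 : ∀ i, |y i t| ≤ |y k t| := by
    intro i
    by_cases hi : i = k
    · rw [hi]
    · exact (h1 i hi).trans (mul_le_of_le_one_left (abs_nonneg _) hδ1)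
  have h3 : |∑ j ∈ Finset.univ.erase k, c j * y j t| ≤ |c k| / 2 * |y k t| := by
    calc |∑ j ∈ Finset.univ.erase k, c j * y j t|
        ≤ ∑ j ∈ Finset.univ.erase k, |c j * y j t| := Finset.abs_sum_le_sum_abs _ _
      _ ≤ ∑ j ∈ Finset.univ.erase k, |c j| * (δ * |y k t|) :=
          Finset.sum_le_sum fun j hj => by
            rw [abs_mul]
            exact mul_le_mul_of_nonneg_left (h1 j (Finset.ne_of_mem_erase hj)) (abs_nonneg _)
      _ = (∑ j ∈ Finset.univ.erase k, |c j|) * (δ * |y k t|) := by rw [Finset.sum_mul]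
      _ ≤ K * (δ * |y k t|) := by
          refine mul_le_mul_of_nonneg_right ?_ (by positivity)
          exact Finset.sum_le_sum_of_subset_of_nonneg (Finset.erase_subset _ _)
            fun j _ _ => abs_nonneg _
      _ = |c k| / 2 * |y k t| := by rw [hδ]; field_simp
  have h4 : |c k| / 2 * |y k t| ≤ |∑ j, c j * y j t| := by
    rw [← Finset.add_sum_erase Finset.univ (fun j => c j * y j t) (Finset.mem_univ k)]
    have h5 := abs_sub_abs_le_abs_add (c k * y k t) (∑ j ∈ Finset.univ.erase k, c j * y j t)
    rw [abs_mul] at h5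
    linarith
  intro i
  refine (h2 i).trans ?_
  calc |y k t| = 2 / |c k| * (|c k| / 2 * |y k t|) := by field_simp
    _ ≤ _ := mul_le_mul_of_nonneg_left h4 (by positivity)

end System

/-! ### Factored operators with a nonnegative potential -/

/-- If the derivative is nonzero on a punctured neighbourhood, so is the function. -/
theorem eventually_ne_zero_of_deriv {g g' : ℝ → ℝ} (hg : ∀ t, HasDerivAt g (g' t) t) {τ : ℝ}
    (h : ∀ᶠ t in 𝓝[≠] τ, g' t ≠ 0) : ∀ᶠ t in 𝓝[≠] τ, g t ≠ 0 := by
  have hrolle : ∀ a b, a < b → g a = 0 → g b = 0 → ∃ s ∈ Ioo a b, g' s = 0 := fun a b hab ha hb =>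
    exists_hasDerivAt_eq_zero hab (fun x _ => (hg x).continuousAt.continuousWithinAt)
      (by rw [ha, hb]) fun x _ => hg x
  rw [← Iio_union_Ioi, nhdsWithin_union, eventually_sup] at h ⊢
  constructor
  · obtain ⟨l, hl, hl'⟩ := (mem_nhdsLT_iff_exists_Ioo_subset).1 h.1
    by_contra hcon
    have hfr : ∃ᶠ t in 𝓝[<] τ, g t = 0 := (not_eventually.1 hcon).mono fun _ h => not_not.1 h
    obtain ⟨a, ha, ha'⟩ := (hfr.and_eventually (Ioo_mem_nhdsLT hl)).exists
    obtain ⟨b, hb, hb'⟩ := (hfr.and_eventually (Ioo_mem_nhdsLT ha'.2)).exists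
    obtain ⟨s, hs, hs'⟩ := hrolle a b hb'.1 ha hb
    exact hl' ⟨ha'.1.trans hs.1, hs.2.trans hb'.2⟩ hs'
  · obtain ⟨u, hu, hu'⟩ := (mem_nhdsGT_iff_exists_Ioo_subset).1 h.2
    by_contra hcon
    have hfr : ∃ᶠ t in 𝓝[>] τ, g t = 0 := (not_eventually.1 hcon).mono fun _ h => not_not.1 h
    obtain ⟨a, ha, ha'⟩ := (hfr.and_eventually (Ioo_mem_nhdsGT hu)).exists
    obtain ⟨b, hb, hb'⟩ := (hfr.and_eventually (Ioo_mem_nhdsGT ha'.1)).exists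
    obtain ⟨s, hs, hs'⟩ := hrolle b a hb'.2 hb ha
    exact hu' ⟨hb'.1.trans hs.1, hs.2.trans ha'.2⟩ hs'

theorem finite_zeros {f : ℝ → ℝ} (hbot : ∀ᶠ t in atBot, f t ≠ 0) (htop : ∀ᶠ t in atTop, f t ≠ 0)
    (hloc : ∀ τ, ∀ᶠ t in 𝓝[≠] τ, f t ≠ 0) : {t | f t = 0}.Finite := by
  obtain ⟨a, ha⟩ := eventually_atBot.1 hbot
  obtain ⟨b, hb⟩ := eventually_atTop.1 htop
  by_contra hinf
  obtain ⟨τ, -, hτ⟩ := Set.Infinite.exists_accPt_of_subset_isCompact hinf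
    (isCompact_Icc (a := a) (b := b)) fun t ht =>
      ⟨(not_le.1 fun h => ha t h ht).le, (not_le.1 fun h => hb t h ht).le⟩
  rw [accPt_iff_frequently_nhdsNE] at hτ
  exact hτ ((hloc τ).mono fun t ht h => ht h)

section Factored

variable {ι : Type*} [Fintype ι] [DecidableEq ι] {lam : ι → ℝ} {f V : ℝ → ℝ}

/-- The polynomial `∏_{i ∈ s} (X - λ_i)`. -/
noncomputable def rootProd (lam : ι → ℝ) (s : Finset ι) : ℝ[X] := ∏ i ∈ s, (X - C (lam i))

theorem natDegree_rootProd {ι : Type*} {lam : ι → ℝ} (s : Finset ι) :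
    (rootProd lam s).natDegree = s.card := by
  unfold rootProd
  exact natDegree_finsetProd_X_sub_C_eq_card s lam

theorem natDegree_rootProd_lt {ι : Type*} [Fintype ι] {lam : ι → ℝ} {s : Finset ι} {i : ι}
    (hi : i ∉ s) :
    (rootProd lam s).natDegree < Fintype.card ι := by
  rw [natDegree_rootProd]
  exact Finset.card_lt_univ_of_notMem hi

/-- The component of `f` along the mode `e^{λ_i t}`, up to a factor: the operator with all the roots
except `λ_i`, applied to `f`. -/
noncomputable def mode (lam : ι → ℝ) (f : ℝ → ℝ) (i : ι) : ℝ → ℝ :=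
  diffOp (rootProd lam (Finset.univ.erase i)) f

/-- The weights of Lagrange interpolation at the roots, which recover `f` from its modes. -/
noncomputable def modeCoeff (lam : ι → ℝ) (i : ι) : ℝ :=
  ∏ j ∈ Finset.univ.erase i, (lam i - lam j)⁻¹

theorem modeCoeff_ne_zero (hlam : Function.Injective lam) (i : ι) : modeCoeff lam i ≠ 0 :=
  Finset.prod_ne_zero_iff.2 fun _ hj =>
    inv_ne_zero (sub_ne_zero.2 fun h => (Finset.ne_of_mem_erase hj) (hlam h).symm)

theorem lagrange_basis_eq (i : ι) :
    Lagrange.basis Finset.univ lam i =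
      C (modeCoeff lam i) * rootProd lam (Finset.univ.erase i) := by
  simp only [Lagrange.basis, Lagrange.basisDivisor, Finset.prod_mul_distrib, modeCoeff, rootProd,
    map_prod]

/-- Lagrange interpolation: operators of order less than the number of modes are combinations
of the modes. -/
theorem diffOp_eq_sum_mode (hlam : Function.Injective lam) {Q : ℝ[X]}
    (hQ : Q.degree < Fintype.card ι) (t : ℝ) :
    diffOp Q f t = ∑ i, Q.eval (lam i) * modeCoeff lam i * mode lam f i t := by
  have h := Lagrange.eq_interpolate (s := Finset.univ) (v := lam) hlam.injOn (f := Q)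
    (by simpa using hQ)
  rw [Lagrange.interpolate_apply] at h
  conv_lhs => rw [h]
  rw [diffOp_sum]
  refine Finset.sum_congr rfl fun i _ => ?_
  rw [lagrange_basis_eq, diffOp_C_mul, diffOp_C_mul, mode, mul_assoc]

theorem eq_sum_mode [Nonempty ι] (hlam : Function.Injective lam) (t : ℝ) :
    f t = ∑ i, modeCoeff lam i * mode lam f i t := by
  rw [← diffOp_one f t, diffOp_eq_sum_mode hlam]
  · simp
  · rw [degree_one]
    exact_mod_cast Fintype.card_pos

theorem hasDerivAt_rootProd (hf : ContDiff ℝ (Fintype.card ι) f) {s : Finset ι} {i : ι}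
    (hi : i ∉ s) (t : ℝ) :
    HasDerivAt (diffOp (rootProd lam s) f)
      (diffOp (rootProd lam (insert i s)) f t + lam i * diffOp (rootProd lam s) f t) t := by
  have h := hasDerivAt_diffOp_X_sub_C hf (natDegree_rootProd_lt (lam := lam) hi) (lam i) t
  rwa [show (X - C (lam i)) * rootProd lam s = rootProd lam (insert i s) from
    (Finset.prod_insert hi).symm] at h

/-- The modes of a solution of `∏ (d/dt - λ_i) f = V f` satisfy a first-order system that is
diagonal up to a coupling through `f` itself. -/
theorem hasDerivAt_mode [Nonempty ι] (hlam : Function.Injective lam)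
    (hf : ContDiff ℝ (Fintype.card ι) f)
    (heq : ∀ t, diffOp (rootProd lam Finset.univ) f t = V t * f t) (i : ι) (t : ℝ) :
    HasDerivAt (mode lam f i)
      (lam i * mode lam f i t + V t * ∑ j, modeCoeff lam j * mode lam f j t) t := by
  have h := hasDerivAt_rootProd (lam := lam) hf (Finset.notMem_erase i Finset.univ) t
  rw [Finset.insert_erase (Finset.mem_univ i), heq] at h
  rw [← eq_sum_mode hlam, add_comm]
  exact h

/-- Where `f` controls its modes, it controls all its derivatives of order less than the number of
roots. -/
theorem exists_abs_diffOp_le {l : Filter ℝ} (hlam : Function.Injective lam)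
    (h : ∃ C, ∀ᶠ t in l, ∀ i, |mode lam f i t| ≤ C * |f t|) {Q : ℝ[X]}
    (hQ : Q.degree < Fintype.card ι) : ∃ C, ∀ᶠ t in l, |diffOp Q f t| ≤ C * |f t| := by
  obtain ⟨C, hC⟩ := h
  refine ⟨∑ i, |Q.eval (lam i) * modeCoeff lam i| * C, hC.mono fun t ht => ?_⟩
  rw [diffOp_eq_sum_mode hlam hQ, Finset.sum_mul]
  refine (Finset.abs_sum_le_sum_abs _ _).trans (Finset.sum_le_sum fun i _ => ?_)
  rw [abs_mul, mul_assoc]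
  exact mul_le_mul_of_nonneg_left (ht i) (abs_nonneg _)

theorem tendsto_rootProd {l : Filter ℝ} (hlam : Function.Injective lam)
    (h : ∃ C, ∀ᶠ t in l, ∀ i, |mode lam f i t| ≤ C * |f t|) (hf0 : Tendsto f l (𝓝 0))
    {s : Finset ι} {i : ι} (hi : i ∉ s) : Tendsto (diffOp (rootProd lam s) f) l (𝓝 0) := by
  obtain ⟨C, hC⟩ := exists_abs_diffOp_le hlam h (Q := rootProd lam s)
    (degree_le_natDegree.trans_lt (by exact_mod_cast natDegree_rootProd_lt hi))
  refine squeeze_zero_norm' hC ?_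
  simpa using (hf0.abs).const_mul C

theorem eventually_ne_zero {l : Filter ℝ}
    (h : ∃ C, ∀ᶠ t in l, ∀ i, |mode lam f i t| ≤ C * |f t|)
    (hne : ∀ t, 0 < ∑ i, mode lam f i t ^ 2) : ∀ᶠ t in l, f t ≠ 0 := by
  obtain ⟨C, hC⟩ := h
  filter_upwards [hC] with t ht h0
  refine (hne t).ne' (Finset.sum_eq_zero fun i _ => ?_)
  have := ht i
  rw [h0, abs_zero, mul_zero] at this
  rw [abs_nonpos_iff.1 this, sq, mul_zero]

/-- The zeros of a solution with a nonvanishing mode at each point are isolated. -/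
theorem eventually_ne_zero_punctured (hf : ContDiff ℝ (Fintype.card ι) f)
    (hne : ∀ t, 0 < ∑ i, mode lam f i t ^ 2) (τ : ℝ) : ∀ᶠ t in 𝓝[≠] τ, f t ≠ 0 := by
  have hstep : ∀ s : Finset ι, (∀ᶠ t in 𝓝[≠] τ, diffOp (rootProd lam s) f t ≠ 0) →
      ∀ᶠ t in 𝓝[≠] τ, f t ≠ 0 := by
    intro s
    induction s using Finset.induction_on with
    | empty =>
      intro h
      simpa [rootProd, diffOp_one] using h
    | insert i s hi ih =>
      intro h
      refine ih ?_
      have h1 := eventually_ne_zero_of_deriv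
        (fun t => hasDerivAt_exp_neg_mul (hasDerivAt_rootProd (lam := lam) hf hi t))
        (h.mono fun t ht => mul_ne_zero (Real.exp_pos (-lam i * t)).ne' ht)
      exact h1.mono fun t ht => right_ne_zero_of_mul ht
  obtain ⟨i, -, hi⟩ : ∃ i ∈ Finset.univ, mode lam f i τ ^ 2 ≠ 0 :=
    Finset.exists_ne_zero_of_sum_ne_zero (hne τ).ne'
  refine hstep (Finset.univ.erase i) ?_
  have hc : Continuous (mode lam f i) :=
    continuous_diffOp hf (natDegree_rootProd_lt (Finset.notMem_erase i _)).le
  exact (hc.continuousAt.eventually_ne (fun h => hi (by rw [h, sq, mul_zero]))).filter_mono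
    nhdsWithin_le_nhds

/-- Partial products of the operator do not decrease the number of sign changes. -/
theorem hasSignChanges_rootProd {n : ℕ} (h : HasSignChanges n f)
    (hlam : Function.Injective lam) (hf : ContDiff ℝ (Fintype.card ι) f)
    (h0 : ∀ i, lam i ≠ 0)
    (hbot : ∃ C, ∀ᶠ t in atBot, ∀ i, |mode lam f i t| ≤ C * |f t|)
    (htop : ∃ C, ∀ᶠ t in atTop, ∀ i, |mode lam f i t| ≤ C * |f t|)
    (hf0 : Tendsto f atBot (𝓝 0)) (hf1 : Tendsto f atTop (𝓝 0)) (s : Finset ι) :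
    HasSignChanges n (diffOp (rootProd lam s) f) := by
  induction s using Finset.induction_on with
  | empty => exact h.of_sign fun t σ => by simp [rootProd, diffOp_one]
  | insert i s hi ih =>
    exact ih.sub_mul (hasDerivAt_rootProd hf hi) (h0 i) (tendsto_rootProd hlam hbot hf0 hi)
      (tendsto_rootProd hlam htop hf1 hi)

/-- If `f = o(e^{λ t})` at `-∞` for a positive root `λ`, then applying `d/dt - λ` first gains a sign
change, which the other factors preserve. -/
theorem hasSignChanges_rootProd_succ {n : ℕ} (h : HasSignChanges n f)
    (hlam : Function.Injective lam) (hf : ContDiff ℝ (Fintype.card ι) f)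
    (h0 : ∀ i, lam i ≠ 0)
    (hbot : ∃ C, ∀ᶠ t in atBot, ∀ i, |mode lam f i t| ≤ C * |f t|)
    (htop : ∃ C, ∀ᶠ t in atTop, ∀ i, |mode lam f i t| ≤ C * |f t|)
    (hf0 : Tendsto f atBot (𝓝 0)) (hf1 : Tendsto f atTop (𝓝 0)) {i₀ : ι} (hi₀ : 0 < lam i₀)
    (hdec : Tendsto (fun t => Real.exp (-lam i₀ * t) * f t) atBot (𝓝 0)) (s : Finset ι)
    (hs : i₀ ∉ s) : HasSignChanges (n + 1) (diffOp (rootProd lam (insert i₀ s)) f) := by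
  induction s using Finset.induction_on with
  | empty =>
    refine h.sub_mul_succ (b := lam i₀) (fun t => ?_) hi₀ hdec hf1
    have h1 := hasDerivAt_rootProd (lam := lam) hf (Finset.notMem_empty i₀) t
    have h2 : diffOp (rootProd lam ∅) f = f := by
      funext t; simp [rootProd, diffOp_one]
    rwa [h2] at h1
  | insert i s hi ih =>
    rw [Finset.mem_insert, not_or] at hs
    have hi' : i ∉ insert i₀ s := by
      rw [Finset.mem_insert, not_or]
      exact ⟨Ne.symm hs.1, hi⟩
    rw [Finset.insert_comm]
    exact (ih hs.2).sub_mul (hasDerivAt_rootProd hf hi') (h0 i)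
      (tendsto_rootProd hlam hbot hf0 hi') (tendsto_rootProd hlam htop hf1 hi')

variable [Nonempty ι]

theorem exists_abs_mode_le_atTop (hlam : Function.Injective lam)
    (hf : ContDiff ℝ (Fintype.card ι) f)
    (heq : ∀ t, diffOp (rootProd lam Finset.univ) f t = V t * f t)
    (hV : Tendsto V atTop (𝓝 0)) (hne : ∀ t, 0 < ∑ i, mode lam f i t ^ 2) :
    ∃ C, ∀ᶠ t in atTop, ∀ i, |mode lam f i t| ≤ C * |f t| := by
  obtain ⟨C, hC⟩ := exists_forall_abs_le hlam (modeCoeff_ne_zero hlam)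
    (hasDerivAt_mode hlam hf heq) hV hne
  refine ⟨C, hC.mono fun t ht i => ?_⟩
  rw [eq_sum_mode (f := f) hlam t]
  exact ht i

/-- Time reversal of `exists_abs_mode_le_atTop`. -/
theorem exists_abs_mode_le_atBot (hlam : Function.Injective lam)
    (hf : ContDiff ℝ (Fintype.card ι) f)
    (heq : ∀ t, diffOp (rootProd lam Finset.univ) f t = V t * f t)
    (hV : Tendsto V atBot (𝓝 0)) (hne : ∀ t, 0 < ∑ i, mode lam f i t ^ 2) :
    ∃ C, ∀ᶠ t in atBot, ∀ i, |mode lam f i t| ≤ C * |f t| := by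
  obtain ⟨C, hC⟩ := exists_forall_abs_le (ι := ι) (y := fun i t => mode lam f i (-t))
    (lam := fun i => -lam i) (V := fun t => -V (-t)) (c := modeCoeff lam)
    (fun i j h => hlam (neg_injective h)) (modeCoeff_ne_zero hlam)
    (fun i t => by
      have h := (hasDerivAt_mode hlam hf heq i (-t)).scomp t (hasDerivAt_neg t)
      refine h.congr_deriv ?_
      simp only [smul_eq_mul]
      ring)
    (by simpa using (hV.comp tendsto_neg_atTop_atBot).neg) (fun t => hne (-t))
  refine ⟨C, ?_⟩
  filter_upwards [tendsto_neg_atBot_atTop.eventually hC] with t ht i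
  rw [eq_sum_mode (f := f) hlam t]
  simpa using ht i

/-- By uniqueness for the initial value problem, the modes of a nonzero solution have no common
zero. -/
theorem sum_sq_mode_pos (hlam : Function.Injective lam) (hf : ContDiff ℝ (Fintype.card ι) f)
    (heq : ∀ t, diffOp (rootProd lam Finset.univ) f t = V t * f t) {M : ℝ}
    (hV : ∀ t, |V t| ≤ M) {t : ℝ} (hft : f t ≠ 0) (s : ℝ) : 0 < ∑ i, mode lam f i s ^ 2 := by
  refine (Finset.sum_nonneg fun i _ => sq_nonneg _).lt_of_ne fun h => hft ?_
  have hz : ∀ i, mode lam f i s = 0 := fun i =>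
    pow_eq_zero_iff two_ne_zero |>.1
      ((Finset.sum_eq_zero_iff_of_nonneg fun i _ => sq_nonneg _).1 h.symm i (Finset.mem_univ i))
  rw [eq_sum_mode (f := f) hlam t]
  refine Finset.sum_eq_zero fun i _ => ?_
  rw [eq_zero_of_eq_zero (hasDerivAt_mode hlam hf heq) hV hz t i, mul_zero]

/-- A solution of `∏ (d/dt - λ_i) f = 0` vanishing at `±∞` is zero. -/
theorem eq_zero_of_rootProd_eq_zero (hlam : Function.Injective lam)
    (hf : ContDiff ℝ (Fintype.card ι) f) (h0 : ∀ i, lam i ≠ 0)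
    (heq : ∀ t, diffOp (rootProd lam Finset.univ) f t = 0)
    (hf0 : Tendsto f atBot (𝓝 0)) (hf1 : Tendsto f atTop (𝓝 0)) (t : ℝ) : f t = 0 := by
  by_contra hft
  have heq' : ∀ t, diffOp (rootProd lam Finset.univ) f t = (fun _ => (0 : ℝ)) t * f t :=
    fun t => by rw [heq t, zero_mul]
  have hne := sum_sq_mode_pos hlam hf heq' (M := 0) (by simp) hft
  have hsc : HasSignChanges 0 f := ⟨f t, fun _ => t, by simp, fun i hi => by
    obtain rfl : i = 0 := by omega
    simpa using mul_self_pos.2 hft⟩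
  obtain ⟨σ, r, -, hr⟩ := hasSignChanges_rootProd hsc hlam hf h0
    (exists_abs_mode_le_atBot hlam hf heq' tendsto_const_nhds hne)
    (exists_abs_mode_le_atTop hlam hf heq' tendsto_const_nhds hne) hf0 hf1 Finset.univ
  have := hr 0 le_rfl
  rw [heq, mul_zero] at this
  exact this.false

/-- The uniqueness principle: if `∏ (d/dt - λ_i) f = κ W f` with `W ≥ 0` vanishing at `±∞`, if `f`
vanishes at `+∞` and `f = o(e^{λ t})` at `-∞` for a positive root `λ`, then `f = 0`. Otherwise `f`
would have finitely many sign changes and the left side one more, while the right side has at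
most as many as `f`. -/
theorem eq_zero_of_rootProd_eq_mul {W : ℝ → ℝ} {κ M : ℝ} (hlam : Function.Injective lam)
    (hf : ContDiff ℝ (Fintype.card ι) f) (h0 : ∀ i, lam i ≠ 0)
    (heq : ∀ t, diffOp (rootProd lam Finset.univ) f t = κ * W t * f t)
    (hW : ∀ t, 0 ≤ W t) (hM : ∀ t, W t ≤ M)
    (hWb : Tendsto W atBot (𝓝 0)) (hWt : Tendsto W atTop (𝓝 0))
    (hf1 : Tendsto f atTop (𝓝 0)) {i₀ : ι} (hi₀ : 0 < lam i₀)
    (hdec : Tendsto (fun t => Real.exp (-lam i₀ * t) * f t) atBot (𝓝 0)) (t : ℝ) : f t = 0 := by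
  by_contra hft
  have hf0 : Tendsto f atBot (𝓝 0) := by
    have h1 : Tendsto (fun t => Real.exp (lam i₀ * t)) atBot (𝓝 0) :=
      Real.tendsto_exp_atBot.comp (tendsto_id.const_mul_atBot hi₀)
    have h2 := h1.mul hdec
    rw [zero_mul] at h2
    refine h2.congr fun t => ?_
    rw [← mul_assoc, ← Real.exp_add]
    simp
  have hVb : Tendsto (fun t => κ * W t) atBot (𝓝 0) := by simpa using hWb.const_mul κ
  have hVt : Tendsto (fun t => κ * W t) atTop (𝓝 0) := by simpa using hWt.const_mul κ
  have hne := sum_sq_mode_pos hlam hf heq (M := |κ| * M) (fun t => by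
    rw [abs_mul, abs_of_nonneg (hW t)]
    exact mul_le_mul_of_nonneg_left (hM t) (abs_nonneg _)) hft
  have hbot := exists_abs_mode_le_atBot hlam hf heq hVb hne
  have htop := exists_abs_mode_le_atTop hlam hf heq hVt hne
  have hfin := finite_zeros (eventually_ne_zero hbot hne) (eventually_ne_zero htop hne)
    (eventually_ne_zero_punctured hf hne)
  -- the sign changes of `f` pass to the operator with one more, and back to `f` by the equation
  have hsc : ∀ n, HasSignChanges n f := by
    intro n
    induction n with
    | zero => exact ⟨f t, fun _ => t, by simp, fun i hi => by
        obtain rfl : i = 0 := by omega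
        simpa using mul_self_pos.2 hft⟩
    | succ n ih =>
      obtain ⟨σ, r, hr, hr'⟩ := hasSignChanges_rootProd_succ ih hlam hf h0 hbot htop hf0 hf1 hi₀
        hdec (Finset.univ.erase i₀) (Finset.notMem_erase _ _)
      refine ⟨σ * κ, r, hr, fun i hi => ?_⟩
      have h1 := hr' i hi
      rw [Finset.insert_erase (Finset.mem_univ _), heq] at h1
      have h2 : σ * (-1) ^ i * (κ * W (r i) * f (r i)) =
          W (r i) * (σ * κ * (-1) ^ i * f (r i)) := by ring
      rw [h2] at h1
      exact pos_of_mul_pos_right h1 (hW _)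
  have := (hsc ({t | f t = 0}.ncard + 1)).le_ncard hf.continuous hfin
  omega

end Factored

/-! ### Hardy's inequality -/

section Hardy

variable {β : ℝ} {g : ℝ → ℝ}

/-- The pointwise decay that accompanies Hardy's inequality, by Young's inequality. -/
theorem exists_abs_le_rpow (hβ : 1 < β) (hg : ACLoc g) (hlim : Tendsto g atTop (𝓝 0))
    (hint : IntegrableOn (fun r => deriv g r ^ 2 * r ^ β) (Ioi 0)) :
    ∃ C, ∀ r > 0, |g r| ≤ C * r ^ (-((β - 1) / 2)) := by
  refine ⟨(∫ t in Ioi (0 : ℝ), deriv g t ^ 2 * t ^ β) + 1 / (β - 1), fun r hr => ?_⟩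
  have hl : 0 < r ^ (-((β - 1) / 2)) := Real.rpow_pos_of_pos hr _
  obtain ⟨h0, h1⟩ := integrableOn_Ioi_of_weighted hβ (measurable_deriv g) hint hl hr
  have hval : ∫ t in Ioi r, deriv g t = -g r := by
    have h2 := intervalIntegral_tendsto_integral_Ioi r h0 tendsto_id
    have h3 : Tendsto (fun b => g b - g r) atTop (𝓝 (0 - g r)) := hlim.sub_const _
    rw [zero_sub] at h3
    refine tendsto_nhds_unique (h2.congr' ?_) h3
    filter_upwards [eventually_ge_atTop r] with b hb
    exact (hg r b hr (hr.trans_le hb)).integral_deriv_eq_sub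
  rw [hval, abs_neg, integral_Ioi_rpow_of_lt (by linarith) hr, ← Real.rpow_neg hr.le] at h1
  have h2 : r ^ (- -((β - 1) / 2)) * (-r ^ (-β + 1) / (-β + 1)) =
      1 / (β - 1) * r ^ (-((β - 1) / 2)) := by
    have : r ^ (-((β - 1) / 2)) = r ^ (- -((β - 1) / 2)) * r ^ (-β + 1) := by
      rw [← Real.rpow_add hr]; congr 1; ring
    rw [this]
    have h3 : -β + 1 ≠ 0 := by linarith
    have h4 : β - 1 ≠ 0 := by linarith
    field_simp
    ring
  rw [h2] at h1
  linarith

/-- Hardy's inequality on an interval, with the boundary term at the right end. -/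
theorem hardy_interval (hβ : 1 < β) (hg : ACLoc g)
    (hint : IntegrableOn (fun r => deriv g r ^ 2 * r ^ β) (Ioi 0)) {a b : ℝ} (ha : 0 < a)
    (hab : a ≤ b) :
    (β - 1) / 2 * ∫ r in a..b, g r ^ 2 * r ^ (β - 2) ≤
      g b ^ 2 * b ^ (β - 1) + 2 / (β - 1) * ∫ r in Ioi (0 : ℝ), deriv g r ^ 2 * r ^ β := by
  have hb : 0 < b := ha.trans_le hab
  have hsub : uIcc a b ⊆ Ioi 0 := fun x hx => by
    rw [uIcc_of_le hab] at hx; exact ha.trans_le hx.1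
  have hac := hg a b ha hb
  have hpow : ∀ κ : ℝ, ContDiffOn ℝ 1 (fun r : ℝ => r ^ κ) (uIcc a b) := fun κ r hr =>
    (Real.contDiffAt_rpow_const_of_ne (hsub hr).ne').contDiffWithinAt
  have hG := (hac.fun_mul hac).fun_mul (hpow (β - 1)).absolutelyContinuousOnInterval
  have hGint := hG.intervalIntegrable_deriv
  have hGval := hG.integral_deriv_eq_sub
  have hY : IntervalIntegrable (fun r => deriv g r ^ 2 * r ^ β) volume a b :=
    intervalIntegrable_iff.2 (hint.mono_set (uIoc_subset_uIcc.trans hsub))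
  have hX : IntervalIntegrable (fun r => g r ^ 2 * r ^ (β - 2)) volume a b :=
    ((hac.continuousOn.pow 2).mul (hpow (β - 2)).continuousOn).intervalIntegrable
  have hmono : ∫ r in a..b, (β - 1) / 2 * (g r ^ 2 * r ^ (β - 2)) ≤
      ∫ r in a..b, (deriv (fun r => g r * g r * r ^ (β - 1)) r +
        2 / (β - 1) * (deriv g r ^ 2 * r ^ β)) := by
    refine intervalIntegral.integral_mono_ae_restrict hab (hX.const_mul _)
      (hGint.add (hY.const_mul _)) ?_
    rw [EventuallyLE, ae_restrict_iff' measurableSet_Icc]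
    filter_upwards [hac.ae_differentiableAt] with r hr hr'
    have hr0 : 0 < r := ha.trans_le hr'.1
    have hd := (hr (by rwa [uIcc_of_le hab])).hasDerivAt
    have hd' := ((hd.mul hd).mul (Real.hasDerivAt_rpow_const (p := β - 1) (Or.inl hr0.ne'))).deriv
    have hd'' : deriv (fun r => g r * g r * r ^ (β - 1)) r =
        (deriv g r * g r + g r * deriv g r) * r ^ (β - 1) +
          g r * g r * ((β - 1) * r ^ (β - 1 - 1)) := hd'
    rw [hd'']
    have e1 : r ^ (β - 1) = r ^ (β - 2) * r := by
      rw [← Real.rpow_add_one hr0.ne']; congr 1; ring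
    have e2 : r ^ β = r ^ (β - 2) * r ^ 2 := by
      rw [← Real.rpow_natCast, ← Real.rpow_add hr0]; congr 1; push_cast; ring
    have e3 : β - 1 - 1 = β - 2 := by ring
    rw [e1, e2, e3]
    have hβ' : β - 1 ≠ 0 := by linarith
    have hsq : 0 ≤ r ^ (β - 2) * (2 / (β - 1) * ((β - 1) / 2 * g r + deriv g r * r) ^ 2) :=
      mul_nonneg (Real.rpow_nonneg hr0.le _)
        (mul_nonneg (div_nonneg two_pos.le (by linarith)) (sq_nonneg _))
    -- complete the square
    have hid : (deriv g r * g r + g r * deriv g r) * (r ^ (β - 2) * r) +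
        g r * g r * ((β - 1) * r ^ (β - 2)) + 2 / (β - 1) *
        (deriv g r ^ 2 * (r ^ (β - 2) * r ^ 2)) - (β - 1) / 2 * (g r ^ 2 * r ^ (β - 2)) =
        r ^ (β - 2) * (2 / (β - 1) * ((β - 1) / 2 * g r + deriv g r * r) ^ 2) := by
      field_simp
      ring
    linarith
  rw [intervalIntegral.integral_const_mul,
    intervalIntegral.integral_add hGint (hY.const_mul _), intervalIntegral.integral_const_mul,
    hGval] at hmono
  have hYle : ∫ r in a..b, deriv g r ^ 2 * r ^ β ≤
      ∫ r in Ioi (0 : ℝ), deriv g r ^ 2 * r ^ β := by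
    rw [intervalIntegral.integral_of_le hab]
    refine setIntegral_mono_set hint ?_ (Eventually.of_forall fun r hr => ha.trans hr.1)
    filter_upwards [ae_restrict_mem measurableSet_Ioi] with r hr
    exact mul_nonneg (sq_nonneg _) (Real.rpow_nonneg (le_of_lt hr) _)
  have h1 : 0 ≤ g a * g a * a ^ (β - 1) :=
    mul_nonneg (mul_self_nonneg _) (Real.rpow_nonneg ha.le _)
  have h2 : 2 / (β - 1) * (∫ r in a..b, deriv g r ^ 2 * r ^ β) ≤
      2 / (β - 1) * ∫ r in Ioi (0 : ℝ), deriv g r ^ 2 * r ^ β :=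
    mul_le_mul_of_nonneg_left hYle (div_nonneg two_pos.le (by linarith))
  rw [sq (g b)]
  linarith

/-- Hardy's inequality on `(0, ∞)`. The boundary term at the right end stays bounded by the
pointwise decay, and the one at the origin has the favourable sign. -/
theorem integrableOn_hardy (hβ : 1 < β) (hg : ACLoc g) (hlim : Tendsto g atTop (𝓝 0))
    (hint : IntegrableOn (fun r => deriv g r ^ 2 * r ^ β) (Ioi 0)) :
    IntegrableOn (fun r => g r ^ 2 * r ^ (β - 2)) (Ioi 0) := by
  obtain ⟨C, hC⟩ := exists_abs_le_rpow hβ hg hlim hint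
  set Y := ∫ r in Ioi (0 : ℝ), deriv g r ^ 2 * r ^ β
  set I := (C ^ 2 + 2 / (β - 1) * Y) / ((β - 1) / 2) with hI
  have hbd : ∀ a b, 0 < a → a ≤ b → ∫ r in a..b, ‖g r ^ 2 * r ^ (β - 2)‖ ≤ I := by
    intro a b ha hab
    have hb : 0 < b := ha.trans_le hab
    have h1 := hardy_interval hβ hg hint ha hab
    have h2 : g b ^ 2 * b ^ (β - 1) ≤ C ^ 2 := by
      have h3 := hC b hb
      have h4 : g b ^ 2 ≤ (C * b ^ (-((β - 1) / 2))) ^ 2 := by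
        rw [← sq_abs]; exact pow_le_pow_left₀ (abs_nonneg _) h3 2
      refine (mul_le_mul_of_nonneg_right h4 (Real.rpow_nonneg hb.le _)).trans (le_of_eq ?_)
      rw [mul_pow, mul_assoc, ← Real.rpow_natCast (b ^ _), ← Real.rpow_mul hb.le,
        ← Real.rpow_add hb]
      have : -((β - 1) / 2) * ((2 : ℕ) : ℝ) + (β - 1) = 0 := by push_cast; ring
      rw [this, Real.rpow_zero, mul_one]
    have h5 : ∫ r in a..b, ‖g r ^ 2 * r ^ (β - 2)‖ = ∫ r in a..b, g r ^ 2 * r ^ (β - 2) := by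
      refine intervalIntegral.integral_congr fun r hr => ?_
      rw [uIcc_of_le hab] at hr
      exact Real.norm_of_nonneg
        (mul_nonneg (sq_nonneg _) (Real.rpow_nonneg (ha.le.trans hr.1) _))
    rw [h5, hI, le_div_iff₀ (by linarith)]
    linarith
  have hloc : ∀ a b, 0 < a → a ≤ b → IntegrableOn (fun r => g r ^ 2 * r ^ (β - 2)) (Ioc a b) := by
    intro a b ha hab
    rw [← intervalIntegrable_iff_integrableOn_Ioc_of_le hab]
    refine ContinuousOn.intervalIntegrable ?_
    refine ((hg a b ha (ha.trans_le hab)).continuousOn.pow 2).mul fun r hr => ?_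
    rw [uIcc_of_le hab] at hr
    exact (Real.continuousAt_rpow_const _ _ (Or.inl (ha.trans_le hr.1).ne')).continuousWithinAt
  have h1 : IntegrableOn (fun r => g r ^ 2 * r ^ (β - 2)) (Ioi 1) := by
    refine integrableOn_Ioi_of_intervalIntegral_norm_bounded (b := fun n : ℕ => (n : ℝ) + 1)
      (l := atTop) I 1 (fun n => hloc _ _ one_pos (by simp))
      (tendsto_natCast_atTop_atTop.atTop_add tendsto_const_nhds)
      (Eventually.of_forall fun n => hbd _ _ one_pos (by simp))
  have h2 : IntegrableOn (fun r => g r ^ 2 * r ^ (β - 2)) (Ioc 0 1) := by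
    have hle : ∀ n : ℕ, 1 / ((n : ℝ) + 1) ≤ 1 := fun n => by
      rw [div_le_one (by positivity)]; simp
    refine integrableOn_Ioc_of_intervalIntegral_norm_bounded_left
      (a := fun n : ℕ => 1 / ((n : ℝ) + 1)) (l := atTop) (I := I)
      (fun n => hloc _ _ (by positivity) (hle n)) tendsto_one_div_add_atTop_nhds_zero_nat
      (Eventually.of_forall fun n => ?_)
    have := hbd (1 / ((n : ℝ) + 1)) 1 (by positivity) (hle n)
    rwa [intervalIntegral.integral_of_le (hle n)] at this
  rw [← Ioc_union_Ioi_eq_Ioi zero_le_one]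
  exact h2.union h1

end Hardy

/-! ### The change of variables `r = e^t` -/

theorem integral_Ioi_eq_integral_exp (F : ℝ → ℝ) :
    ∫ r in Ioi (0 : ℝ), F r = ∫ t, Real.exp t * F (Real.exp t) := by
  have h := integral_image_eq_integral_abs_deriv_smul (s := univ) (f := Real.exp)
    (f' := Real.exp) MeasurableSet.univ (fun x _ => (Real.hasDerivAt_exp x).hasDerivWithinAt)
    Real.exp_injective.injOn F
  rw [image_univ, Real.range_exp, Measure.restrict_univ] at h
  simpa [abs_of_pos (Real.exp_pos _)] using h

theorem integrableOn_Ioi_iff_integrable_exp (F : ℝ → ℝ) :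
    IntegrableOn F (Ioi 0) ↔ Integrable fun t => Real.exp t * F (Real.exp t) := by
  have h := integrableOn_image_iff_integrableOn_abs_deriv_smul (s := univ) (f := Real.exp)
    (f' := Real.exp) MeasurableSet.univ (fun x _ => (Real.hasDerivAt_exp x).hasDerivWithinAt)
    Real.exp_injective.injOn F
  rw [image_univ, Real.range_exp, integrableOn_univ] at h
  simpa [abs_of_pos (Real.exp_pos _)] using h

/-- The logarithm maps null sets to null sets. -/
theorem ae_exp_of_ae_Ioi {p : ℝ → Prop} (h : ∀ᵐ r ∂volume.restrict (Ioi (0 : ℝ)), p r) :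
    ∀ᵐ t : ℝ, p (Real.exp t) := by
  rw [ae_restrict_iff' measurableSet_Ioi, ae_iff] at h
  have hd : DifferentiableOn ℝ Real.log {r | ¬(r ∈ Ioi (0 : ℝ) → p r)} := fun r hr => by
    have : 0 < r := (Classical.not_imp.1 hr).1
    exact (Real.differentiableAt_log this.ne').differentiableWithinAt
  rw [ae_iff]
  refine measure_mono_null ?_ (addHaar_image_eq_zero_of_differentiableOn_of_addHaar_eq_zero
    volume hd h)
  intro t ht
  exact ⟨Real.exp t, fun h => ht (h (Real.exp_pos t)), Real.log_exp t⟩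

theorem ACLoc.ae_differentiableAt {g : ℝ → ℝ} (hg : ACLoc g) :
    ∀ᵐ r ∂volume.restrict (Ioi (0 : ℝ)), DifferentiableAt ℝ g r := by
  rw [ae_restrict_iff' measurableSet_Ioi]
  have key : ∀ n : ℕ, ∀ᵐ r : ℝ, r ∈ uIcc (1 / ((n : ℝ) + 1)) ((n : ℝ) + 1) →
      DifferentiableAt ℝ g r := fun n =>
    (hg (1 / ((n : ℝ) + 1)) ((n : ℝ) + 1) (by positivity) (by positivity)).ae_differentiableAt
  filter_upwards [ae_all_iff.2 key] with r hr (h0 : 0 < r)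
  obtain ⟨n, hn⟩ := exists_nat_gt (max r (1 / r))
  have hn1 : r < n := lt_of_le_of_lt (le_max_left _ _) hn
  have hn2 : 1 / r < n := lt_of_le_of_lt (le_max_right _ _) hn
  refine hr n (mem_uIcc_of_le ?_ (by linarith))
  rw [div_le_iff₀ (by positivity)]
  rw [div_lt_iff₀ h0] at hn2
  nlinarith

/-! ### The Emden–Fowler profile -/

section Profile

theorem differentiableAt_iteratedDeriv_of_contDiffOn {u : ℝ → ℝ} {n i : ℕ}
    (hu : ContDiffOn ℝ n u (Ioi 0)) (hi : i < n) {r : ℝ} (hr : 0 < r) :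
    DifferentiableAt ℝ (iteratedDeriv i u) r := by
  have h1 : DifferentiableOn ℝ (iteratedDerivWithin i u (Ioi 0)) (Ioi 0) :=
    hu.differentiableOn_iteratedDerivWithin (by exact_mod_cast hi) isOpen_Ioi.uniqueDiffOn
  have h2 : DifferentiableOn ℝ (iteratedDeriv i u) (Ioi 0) :=
    h1.congr fun x hx => (iteratedDerivWithin_of_isOpen isOpen_Ioi hx).symm
  exact h2.differentiableAt (isOpen_Ioi.mem_nhds hr)

theorem contDiffOn_iteratedDeriv {u : ℝ → ℝ} {n i k : ℕ}
    (hu : ContDiffOn ℝ n u (Ioi 0)) (hi : i + k ≤ n) :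
    ContDiffOn ℝ k (iteratedDeriv i u) (Ioi 0) := by
  induction i generalizing k with
  | zero => simpa using hu.of_le (by exact_mod_cast (by omega : k ≤ n))
  | succ i ih =>
    have h := ih (k := k + 1) (by omega)
    rw [Nat.cast_succ, contDiffOn_succ_iff_deriv_of_isOpen isOpen_Ioi] at h
    rw [iteratedDeriv_succ]
    exact h.2.2

theorem acLoc_of_contDiffOn {g : ℝ → ℝ} (hg : ContDiffOn ℝ 1 g (Ioi 0)) : ACLoc g :=
  fun _ _ ha hb => (hg.mono fun _ hx => lt_of_lt_of_le (lt_min ha hb)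
    hx.1).absolutelyContinuousOnInterval

variable {m : ℕ} {α : ℝ} {u : ℝ → ℝ}

theorem acLoc_iteratedDeriv (hu : u ∈ dirichletSpace m α) {j : ℕ} (hj : j < m) :
    ACLoc (iteratedDeriv j u) := by
  by_cases h : j = m - 1
  · rw [h]; exact hu.2.1
  · exact acLoc_of_contDiffOn (by
      simpa using contDiffOn_iteratedDeriv (k := 1) hu.1 (by omega : j + 1 ≤ m - 1))

/-- The Hardy inequalities in `𝓓^{m,2}_∞(α)`. -/
theorem integrableOn_iteratedDeriv (hα : 0 < α - 2 * (m : ℝ) + 1)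
    (hu : u ∈ dirichletSpace m α) {k : ℕ} (hk : k ≤ m) :
    IntegrableOn (fun r => iteratedDeriv (m - k) u r ^ 2 * r ^ (α - 2 * k)) (Ioi 0) := by
  induction k with
  | zero => simpa using hu.2.2.2
  | succ k ih =>
    have hkm : (k : ℝ) + 1 ≤ m := by exact_mod_cast hk
    have h := ih (by omega)
    rw [show m - k = (m - (k + 1)) + 1 by omega, iteratedDeriv_succ] at h
    have h1 := integrableOn_hardy (by linarith) (acLoc_iteratedDeriv hu (by omega))
      (hu.2.2.1 _ (by omega)) h
    refine h1.congr_fun (fun r _ => ?_) measurableSet_Ioi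
    simp only
    congr 2
    push_cast
    ring

/-- The exponent `(α - 2m + 1) / 2` at which `r^{-γ}` has the scaling of `𝓓^{m,2}_∞(α)`. -/
noncomputable def rate (m : ℕ) (α : ℝ) : ℝ := (α - 2 * m + 1) / 2

/-- The Emden–Fowler profile `φ(t) = e^{γt} u(e^t)` of a function `u` on `(0, ∞)`. -/
noncomputable def profile (m : ℕ) (α : ℝ) (u : ℝ → ℝ) (t : ℝ) : ℝ :=
  Real.exp (rate m α * t) * u (Real.exp t)

theorem rate_pos (hα : 0 < α - 2 * (m : ℝ) + 1) : 0 < rate m α := by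
  unfold rate; linarith

/-- Functions in `𝓓^{m,2}_∞(α)` are `O(r^{-γ})`. -/
theorem exists_abs_profile_le (hm : 1 ≤ m) (hα : 0 < α - 2 * (m : ℝ) + 1)
    (hu : u ∈ dirichletSpace m α) : ∃ C, ∀ t, |profile m α u t| ≤ C := by
  have h := integrableOn_iteratedDeriv hα hu (k := m - 1) (by omega)
  rw [show m - (m - 1) = 0 + 1 by omega, iteratedDeriv_succ] at h
  have hcast : ((m - 1 : ℕ) : ℝ) = m - 1 := by push_cast [Nat.cast_sub hm]; ring
  obtain ⟨C, hC⟩ := exists_abs_le_rpow (by rw [hcast]; linarith)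
    (acLoc_iteratedDeriv hu (by omega)) (hu.2.2.1 _ (by omega)) h
  refine ⟨C, fun t => ?_⟩
  have h1 := hC _ (Real.exp_pos t)
  rw [iteratedDeriv_zero, hcast, ← Real.exp_mul] at h1
  rw [profile, abs_mul, abs_of_pos (Real.exp_pos _)]
  refine (mul_le_mul_of_nonneg_left h1 (Real.exp_pos _).le).trans (le_of_eq ?_)
  rw [mul_left_comm, ← Real.exp_add]
  have : rate m α * t + t * -((α - 2 * ((m : ℝ) - 1) - 1) / 2) = 0 := by unfold rate; ring
  rw [this, Real.exp_zero, mul_one]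

theorem contDiff_profile {n : ℕ} (hu : ContDiffOn ℝ n u (Ioi 0)) :
    ContDiff ℝ n (profile m α u) := by
  have h1 : ContDiff ℝ n fun t => u (Real.exp t) :=
    hu.comp_contDiff Real.contDiff_exp fun t => Real.exp_pos t
  exact (Real.contDiff_exp.comp (contDiff_const.mul contDiff_id)).mul h1

theorem hasDerivAt_exp_mul_iteratedDeriv {b t : ℝ} {i : ℕ}
    (h : DifferentiableAt ℝ (iteratedDeriv i u) (Real.exp t)) :
    HasDerivAt (fun t => Real.exp ((b + i) * t) * iteratedDeriv i u (Real.exp t))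
      ((b + i) * (Real.exp ((b + i) * t) * iteratedDeriv i u (Real.exp t)) +
        Real.exp ((b + (i + 1 : ℕ)) * t) * iteratedDeriv (i + 1) u (Real.exp t)) t := by
  have h1 : HasDerivAt (fun t : ℝ => Real.exp ((b + i) * t))
      (Real.exp ((b + i) * t) * (b + i)) t := by
    simpa using ((hasDerivAt_id t).const_mul (b + i)).exp
  have h2 := h.hasDerivAt.comp t (Real.hasDerivAt_exp t)
  refine (h1.mul h2).congr_deriv ?_
  have h3 : Real.exp ((b + (i + 1 : ℕ)) * t) = Real.exp ((b + i) * t) * Real.exp t := by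
    rw [← Real.exp_add]; congr 1; push_cast; ring
  rw [h3, iteratedDeriv_succ, Function.comp_apply]
  ring

/-- The derivatives of the profile are combinations of the functions `e^{(γ+i)t} u^{(i)}(e^t)`. The
derivative of order `n + 1` of `u` need only exist at the point in question. -/
theorem exists_iteratedDeriv_profile {n : ℕ} (hu : ContDiffOn ℝ n u (Ioi 0)) {k : ℕ}
    (hk : k ≤ n + 1) : ∃ a : ℕ → ℝ, ∀ t,
      (k = n + 1 → DifferentiableAt ℝ (iteratedDeriv n u) (Real.exp t)) →
      iteratedDeriv k (profile m α u) t = ∑ i ∈ Finset.range (k + 1),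
        a i * (Real.exp ((rate m α + i) * t) * iteratedDeriv i u (Real.exp t)) := by
  induction k with
  | zero => exact ⟨fun _ => 1, fun t _ => by simp [profile]⟩
  | succ k ih =>
    obtain ⟨a, ha⟩ := ih (by omega)
    refine ⟨fun i => (if i < k + 1 then a i * (rate m α + i) else 0) +
      (if i = 0 then 0 else a (i - 1)), fun t ht => ?_⟩
    have hfun : iteratedDeriv k (profile m α u) = fun t => ∑ i ∈ Finset.range (k + 1),
        a i * (Real.exp ((rate m α + i) * t) * iteratedDeriv i u (Real.exp t)) :=
      funext fun t => ha t fun h => by omega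
    have hd : ∀ i ∈ Finset.range (k + 1),
        DifferentiableAt ℝ (iteratedDeriv i u) (Real.exp t) := by
      intro i hi
      rw [Finset.mem_range] at hi
      rcases Nat.lt_or_ge i n with h | h
      · exact differentiableAt_iteratedDeriv_of_contDiffOn hu h (Real.exp_pos t)
      · obtain rfl : i = n := by omega
        exact ht (by omega)
    rw [iteratedDeriv_succ, hfun]
    have h1 := HasDerivAt.fun_sum (u := Finset.range (k + 1)) fun i hi =>
      (hasDerivAt_exp_mul_iteratedDeriv (b := rate m α) (hd i hi)).const_mul (a i)
    rw [h1.deriv]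
    simp only [mul_add, add_mul, Finset.sum_add_distrib]
    congr 1
    · rw [Finset.sum_range_succ _ (k + 1)]
      simp only [lt_irrefl, if_false, zero_mul, add_zero]
      rw [← Finset.sum_add_distrib]
      refine Finset.sum_congr rfl fun i hi => ?_
      rw [if_pos (Finset.mem_range.1 hi)]
      ring
    · rw [Finset.sum_range_succ' _ (k + 1)]
      simp

theorem ae_differentiableAt_exp (hu : u ∈ dirichletSpace m α) :
    ∀ᵐ t : ℝ, DifferentiableAt ℝ (iteratedDeriv (m - 1) u) (Real.exp t) :=
  ae_exp_of_ae_Ioi hu.2.1.ae_differentiableAt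

/-- At almost every point the profile has one derivative more than `m - 1`. -/
theorem ae_differentiableAt_profile (hu : u ∈ dirichletSpace m α) :
    ∀ᵐ t : ℝ, DifferentiableAt ℝ (iteratedDeriv (m - 1) (profile m α u)) t := by
  filter_upwards [ae_differentiableAt_exp hu] with t ht
  obtain ⟨a, ha⟩ := exists_iteratedDeriv_profile (m := m) (α := α) hu.1 (k := m - 1) (by omega)
  rw [show iteratedDeriv (m - 1) (profile m α u) = _ from funext fun t => ha t fun h => by omega]
  refine DifferentiableAt.fun_sum fun i hi => DifferentiableAt.const_mul ?_ _
  refine (hasDerivAt_exp_mul_iteratedDeriv ?_).differentiableAt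
  rw [Finset.mem_range] at hi
  rcases Nat.lt_or_ge i (m - 1) with h | h
  · exact differentiableAt_iteratedDeriv_of_contDiffOn hu.1 h (Real.exp_pos t)
  · rwa [show i = m - 1 by omega]

theorem measurable_exp_mul_iteratedDeriv (hu : ContinuousOn u (Ioi 0)) (b : ℝ) (i : ℕ) :
    Measurable fun t => Real.exp (b * t) * iteratedDeriv i u (Real.exp t) := by
  refine Measurable.mul (by fun_prop) ?_
  rcases i with _ | i
  · simp only [iteratedDeriv_zero]
    exact (hu.comp_continuous Real.continuous_exp fun t => Real.exp_pos t).measurable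
  · rw [iteratedDeriv_succ]
    exact (measurable_deriv _).comp Real.measurable_exp

/-- The profile of a function in `𝓓^{m,2}_∞(α)` belongs to `H^m(ℝ)`. -/
theorem memLp_iteratedDeriv_profile (hm : 1 ≤ m) (hα : 0 < α - 2 * (m : ℝ) + 1)
    (hu : u ∈ dirichletSpace m α) {k : ℕ} (hk : k ≤ m) :
    MemLp (iteratedDeriv k (profile m α u)) 2 := by
  obtain ⟨a, ha⟩ := exists_iteratedDeriv_profile (m := m) (α := α) hu.1 (k := k) (by omega)
  have h1 : ∀ i ∈ Finset.range (k + 1), MemLp (fun t => a i *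
      (Real.exp ((rate m α + i) * t) * iteratedDeriv i u (Real.exp t))) 2 := by
    intro i hi
    have him : i ≤ m := by rw [Finset.mem_range] at hi; omega
    refine MemLp.const_mul ?_ _
    rw [memLp_two_iff_integrable_sq
      (measurable_exp_mul_iteratedDeriv hu.1.continuousOn _ _).aestronglyMeasurable]
    have h2 := (integrableOn_Ioi_iff_integrable_exp _).1
      (integrableOn_iteratedDeriv hα hu (k := m - i) (by omega))
    rw [show m - (m - i) = i by omega, Nat.cast_sub him] at h2
    refine h2.congr (Eventually.of_forall fun t => ?_)
    simp only
    rw [← Real.exp_mul, mul_left_comm, ← Real.exp_add, mul_pow, ← Real.exp_nat_mul, mul_comm]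
    congr 2
    unfold rate
    push_cast
    ring
  refine (memLp_finsetSum _ h1).ae_eq ?_
  filter_upwards [ae_differentiableAt_exp hu] with t ht
  rw [ha t fun _ => ht]

end Profile

/-! ### The symbols of `∇_α^m` and `(-Δ_α)^m` -/

section Symbols

/-- In the variable `t = log r` with weight `e^{-βt}`, the operator `d/dr` becomes `d/dt - β`, and
`β` increases by one. -/
theorem deriv_of_exp_mul_diffOp {W φ : ℝ → ℝ} {Q : ℝ[X]} {β t : ℝ}
    (hW : ∀ s, W (Real.exp s) = Real.exp (-β * s) * diffOp Q φ s)
    (hd : ∀ k ≤ Q.natDegree, DifferentiableAt ℝ (iteratedDeriv k φ) t) :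
    deriv W (Real.exp t) = Real.exp (-(β + 1) * t) * diffOp ((X - C β) * Q) φ t := by
  have h1 : HasDerivAt (fun s : ℝ => Real.exp (-β * s)) (Real.exp (-β * t) * (-β)) t := by
    simpa using ((hasDerivAt_id t).const_mul (-β)).exp
  have h2 := h1.mul (hasDerivAt_diffOp hd)
  rw [← Real.log_exp t] at h2
  have h3 := h2.comp (Real.exp t) (Real.hasDerivAt_log (Real.exp_pos t).ne')
  rw [Real.log_exp] at h3
  have h4 : W =ᶠ[𝓝 (Real.exp t)]
      ((fun s : ℝ => Real.exp (-β * s)) * diffOp Q φ) ∘ Real.log := by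
    filter_upwards [Ioi_mem_nhds (Real.exp_pos t)] with r hr
    have := hW (Real.log r)
    rwa [Real.exp_log hr] at this
  rw [h4.deriv_eq, h3.deriv, diffOp_X_sub_C_mul, ← Real.exp_neg]
  have h5 : Real.exp (-(β + 1) * t) = Real.exp (-β * t) * Real.exp (-t) := by
    rw [← Real.exp_add]; congr 1; ring
  rw [h5]
  ring

/-- The analogue of `deriv_of_exp_mul_diffOp` for `Δ_α`. -/
theorem laplacian_of_exp_mul_diffOp {α : ℝ} {W φ : ℝ → ℝ} {Q : ℝ[X]} {β t : ℝ}
    (hW : ∀ s, W (Real.exp s) = Real.exp (-β * s) * diffOp Q φ s)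
    (hd : ∀ s, ∀ k ≤ Q.natDegree, DifferentiableAt ℝ (iteratedDeriv k φ) s)
    (hd' : ∀ k ≤ Q.natDegree + 1, DifferentiableAt ℝ (iteratedDeriv k φ) t) :
    laplacian α W (Real.exp t) =
      Real.exp (-(β + 2) * t) * diffOp ((X - C (β + 1 - α)) * ((X - C β) * Q)) φ t := by
  have h1 : ∀ s, deriv W (Real.exp s) =
      Real.exp (-(β + 1) * s) * diffOp ((X - C β) * Q) φ s := fun s =>
    deriv_of_exp_mul_diffOp hW (hd s)
  have hdeg : ((X - C β) * Q).natDegree ≤ Q.natDegree + 1 := by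
    refine natDegree_mul_le.trans ?_
    rw [natDegree_X_sub_C, add_comm]
  have h2 := deriv_of_exp_mul_diffOp h1 fun k hk => hd' k (hk.trans hdeg)
  rw [laplacian, h2, h1, diffOp_X_sub_C_mul, diffOp_X_sub_C_mul (β + 1 - α), div_eq_mul_inv,
    ← Real.exp_neg]
  have e1 : Real.exp (-(β + 1 + 1) * t) = Real.exp (-(β + 2) * t) := by congr 1; ring
  have e2 : Real.exp (-(β + 1) * t) = Real.exp (-(β + 2) * t) * Real.exp t := by
    rw [← Real.exp_add]; congr 1; ring
  have e3 : Real.exp (-t) * Real.exp t = 1 := by rw [← Real.exp_add]; simp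
  rw [e1, e2]
  linear_combination (α * Real.exp (-(β + 2) * t) * diffOp ((X - C β) * Q) φ t) * e3

/-- The symbol of `Δ_α^k` in the variable `t = log r`, for the weight `γ`. -/
noncomputable def lapPoly (m : ℕ) (α : ℝ) : ℕ → ℝ[X]
  | 0 => 1
  | k + 1 => (X - C (rate m α + 2 * k + 1 - α)) * ((X - C (rate m α + 2 * k)) * lapPoly m α k)

/-- The symbol of `∇_α^m` in the variable `t = log r`, for the weight `γ`. -/
noncomputable def gradPoly (m : ℕ) (α : ℝ) : ℝ[X] :=
  if Even m then lapPoly m α (m / 2)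
  else (X - C (rate m α + 2 * (m / 2 : ℕ))) * lapPoly m α (m / 2)

/-- The symbol of `(-Δ_α)^m` in the variable `t = log r`, for the weight `γ`. -/
noncomputable def polyLap (m : ℕ) (α : ℝ) : ℝ[X] :=
  ∏ i ∈ Finset.range m, (C ((rate m α + 2 * i) ^ 2) - X ^ 2)

variable {m : ℕ} {α : ℝ} {u v : ℝ → ℝ}

theorem natDegree_lapPoly_le (k : ℕ) : (lapPoly m α k).natDegree ≤ 2 * k := by
  induction k with
  | zero => simp [lapPoly]
  | succ k ih =>
    rw [lapPoly]
    refine natDegree_mul_le.trans ?_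
    have h := natDegree_mul_le (p := X - C (rate m α + 2 * k)) (q := lapPoly m α k)
    rw [natDegree_X_sub_C] at h ⊢
    omega

theorem natDegree_gradPoly_le : (gradPoly m α).natDegree ≤ m := by
  unfold gradPoly
  have h := natDegree_lapPoly_le (m := m) (α := α) (m / 2)
  split_ifs with he
  · omega
  · refine natDegree_mul_le.trans ?_
    rw [natDegree_X_sub_C]
    rw [Nat.not_even_iff] at he
    omega

/-- The iterated Laplacian in Emden–Fowler coordinates. The top derivative is needed only at the
point in question. -/
theorem iterate_laplacian_exp {n : ℕ} (hu : ContDiffOn ℝ n u (Ioi 0)) {k : ℕ}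
    (hk : 2 * k ≤ n + 1) {t : ℝ}
    (ht : 2 * k = n + 1 → DifferentiableAt ℝ (iteratedDeriv n (profile m α u)) t) :
    (laplacian α)^[k] u (Real.exp t) =
      Real.exp (-(rate m α + 2 * k) * t) * diffOp (lapPoly m α k) (profile m α u) t := by
  induction k generalizing t with
  | zero =>
    have h : Real.exp (-rate m α * t) * Real.exp (rate m α * t) = 1 := by
      rw [← Real.exp_add]; simp
    simp only [Function.iterate_zero, id_eq, lapPoly, diffOp_one, profile, CharP.cast_eq_zero,
      mul_zero, add_zero]
    rw [← mul_assoc, h, one_mul]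
  | succ k ih =>
    have hφ := contDiff_profile (m := m) (α := α) hu
    have hdeg := natDegree_lapPoly_le (m := m) (α := α) k
    rw [Function.iterate_succ_apply']
    rw [laplacian_of_exp_mul_diffOp (fun s => ih (by omega) (t := s) fun h => by omega)
      (fun s j hj => differentiableAt_iteratedDeriv hφ (by omega) s) fun j hj => ?_]
    · rw [lapPoly]
      congr 2
      push_cast
      ring
    · rcases Nat.lt_or_ge j n with h | h
      · exact differentiableAt_iteratedDeriv hφ h t
      · obtain rfl : j = n := by omega
        exact ht (by omega)

/-- The gradient in Emden–Fowler coordinates. -/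
theorem gradient_exp (hm : 1 ≤ m) (hu : u ∈ dirichletSpace m α) {t : ℝ}
    (ht : DifferentiableAt ℝ (iteratedDeriv (m - 1) (profile m α u)) t) :
    gradient m α u (Real.exp t) =
      Real.exp (-(rate m α + m) * t) * diffOp (gradPoly m α) (profile m α u) t := by
  unfold gradient gradPoly
  split_ifs with he
  · rw [iterate_laplacian_exp hu.1 (by omega) fun _ => ht]
    have : 2 * ((m / 2 : ℕ) : ℝ) = m := by
      exact_mod_cast Nat.mul_div_cancel' he.two_dvd
    rw [this]
  · rw [Nat.not_even_iff] at he
    have hm2 : 2 * (m / 2) = m - 1 := by omega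
    have hdeg := natDegree_lapPoly_le (m := m) (α := α) (m / 2)
    rw [deriv_of_exp_mul_diffOp
      (fun s => iterate_laplacian_exp hu.1 (by omega) (t := s) fun h => by omega) fun j hj => ?_]
    · have : rate m α + 2 * ((m / 2 : ℕ) : ℝ) + 1 = rate m α + m := by
        have : 2 * ((m / 2 : ℕ) : ℝ) + 1 = m := by
          exact_mod_cast (by omega : 2 * (m / 2) + 1 = m)
        linarith
      rw [this]
    · rcases Nat.lt_or_ge j (m - 1) with h | h
      · exact differentiableAt_iteratedDeriv (contDiff_profile hu.1) h t
      · rwa [show j = m - 1 by omega]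

/-- The symbol of `Δ_α^k` times that of its formal adjoint is the product of `(γ + 2j)² - X²` over
the first `k` and the last `k` indices `j < m`. -/
theorem lapPoly_mul_comp_neg (k : ℕ) :
    lapPoly m α k * (lapPoly m α k).comp (-X) = ∏ j ∈ Finset.range k,
      ((C ((rate m α + 2 * j) ^ 2) - X ^ 2) *
        (C ((rate m α + 2 * ((m : ℝ) - 1 - j)) ^ 2) - X ^ 2)) := by
  induction k with
  | zero => simp [lapPoly]
  | succ k ih =>
    rw [Finset.prod_range_succ, ← ih, lapPoly]
    have h : rate m α + 2 * k + 1 - α = -(rate m α + 2 * ((m : ℝ) - 1 - k)) := by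
      unfold rate; ring
    rw [h]
    simp only [mul_comp, sub_comp, neg_comp, X_comp, C_comp, C_neg, C_pow]
    ring

/-- The formal adjoint of `∇_α^m` composed with `∇_α^m` is `(-Δ_α)^m`. -/
theorem gradPoly_mul_comp_neg :
    gradPoly m α * (gradPoly m α).comp (-X) = polyLap m α := by
  unfold gradPoly polyLap
  split_ifs with he
  · obtain ⟨k, hk⟩ := he
    have hk2 : m / 2 = k := by omega
    rw [lapPoly_mul_comp_neg, hk2, Finset.prod_mul_distrib]
    rw [show Finset.range m = Finset.range (k + k) by rw [hk], Finset.prod_range_add]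
    congr 1
    rw [← Finset.prod_range_reflect]
    refine Finset.prod_congr rfl fun j hj => ?_
    rw [Finset.mem_range] at hj
    have : (m : ℝ) - 1 - ((k - 1 - j : ℕ) : ℝ) = ((k + j : ℕ) : ℝ) := by
      rw [hk, Nat.sub_sub, Nat.cast_sub (by omega)]; push_cast; ring
    rw [this]
  · obtain ⟨k, hk⟩ := Nat.not_even_iff_odd.1 he
    have hk2 : m / 2 = k := by omega
    have h1 := lapPoly_mul_comp_neg (m := m) (α := α) k
    rw [hk2]
    have h2 : ∏ i ∈ Finset.range m, (C ((rate m α + 2 * i) ^ 2) - X ^ 2) =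
        (C ((rate m α + 2 * (k : ℝ)) ^ 2) - X ^ 2) *
          (lapPoly m α k * (lapPoly m α k).comp (-X)) := by
      rw [h1, Finset.prod_mul_distrib, show Finset.range m = Finset.range (k + 1 + k) by
        rw [hk]; congr 1; ring, Finset.prod_range_add, Finset.prod_range_succ]
      rw [← Finset.prod_range_reflect (fun j : ℕ =>
        C ((rate m α + 2 * ((m : ℝ) - 1 - j)) ^ 2) - X ^ 2)]
      have h3 : ∏ j ∈ Finset.range k,
          (C ((rate m α + 2 * ((m : ℝ) - 1 - ((k - 1 - j : ℕ) : ℝ))) ^ 2) - X ^ 2) =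
          ∏ j ∈ Finset.range k, (C ((rate m α + 2 * ((k + 1 + j : ℕ) : ℝ)) ^ 2) - X ^ 2) := by
        refine Finset.prod_congr rfl fun j hj => ?_
        rw [Finset.mem_range] at hj
        have : (m : ℝ) - 1 - ((k - 1 - j : ℕ) : ℝ) = ((k + 1 + j : ℕ) : ℝ) := by
          rw [hk, Nat.sub_sub, Nat.cast_sub (by omega)]; push_cast; ring
        rw [this]
      rw [h3]
      ring
    rw [h2]
    simp only [mul_comp, sub_comp, X_comp, C_comp, C_pow]
    ring

theorem memLp_diffOp_gradPoly (hm : 1 ≤ m) (hα : 0 < α - 2 * (m : ℝ) + 1)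
    (hu : u ∈ dirichletSpace m α) : MemLp (diffOp (gradPoly m α) (profile m α u)) 2 :=
  memLp_finsetSum _ fun _ hk => (memLp_iteratedDeriv_profile hm hα hu
    ((le_natDegree_of_mem_supp _ hk).trans natDegree_gradPoly_le)).const_mul _

/-- The Dirichlet form in Emden–Fowler coordinates. -/
theorem integral_gradient_mul (hm : 1 ≤ m) (hu : u ∈ dirichletSpace m α)
    (hv : v ∈ dirichletSpace m α) :
    ∫ r in Ioi (0 : ℝ), gradient m α u r * gradient m α v r * r ^ α =
      ∫ t, diffOp (gradPoly m α) (profile m α u) t * diffOp (gradPoly m α) (profile m α v) t := by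
  rw [integral_Ioi_eq_integral_exp]
  refine integral_congr_ae ?_
  filter_upwards [ae_differentiableAt_profile hu, ae_differentiableAt_profile hv] with t h1 h2
  rw [gradient_exp hm hu h1, gradient_exp hm hv h2, ← Real.exp_mul]
  have : Real.exp t * (Real.exp (-(rate m α + m) * t) * Real.exp (-(rate m α + m) * t) *
      Real.exp (t * α)) = 1 := by
    rw [← Real.exp_add, ← Real.exp_add, ← Real.exp_add, Real.exp_eq_one_iff]
    unfold rate; ring
  linear_combination (diffOp (gradPoly m α) (profile m α u) t *
    diffOp (gradPoly m α) (profile m α v) t) * this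

theorem rate_mul_critExp (hα : 0 < α - 2 * (m : ℝ) + 1) : rate m α * critExp m α = α + 1 := by
  unfold rate critExp; field_simp

theorem two_lt_critExp (hm : 1 ≤ m) (hα : 0 < α - 2 * (m : ℝ) + 1) : 2 < critExp m α := by
  have : (1 : ℝ) ≤ m := by exact_mod_cast hm
  unfold critExp
  rw [lt_div_iff₀ hα]
  linarith

theorem integral_abs_rpow (hα : 0 < α - 2 * (m : ℝ) + 1) (u : ℝ → ℝ) :
    ∫ r in Ioi (0 : ℝ), |u r| ^ critExp m α * r ^ α =
      ∫ t, |profile m α u t| ^ critExp m α := by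
  rw [integral_Ioi_eq_integral_exp]
  refine integral_congr_ae (Eventually.of_forall fun t => ?_)
  simp only [profile]
  rw [abs_mul, abs_of_pos (Real.exp_pos _), Real.mul_rpow (Real.exp_pos _).le (abs_nonneg _),
    ← Real.exp_mul, ← Real.exp_mul, mul_right_comm (rate m α), rate_mul_critExp hα, mul_left_comm,
    ← Real.exp_add, mul_comm]
  congr 2
  ring

theorem integral_abs_rpow_mul (hα : 0 < α - 2 * (m : ℝ) + 1) (u v : ℝ → ℝ) :
    ∫ r in Ioi (0 : ℝ), |u r| ^ (critExp m α - 2) * u r * v r * r ^ α =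
      ∫ t, |profile m α u t| ^ (critExp m α - 2) * profile m α u t * profile m α v t := by
  rw [integral_Ioi_eq_integral_exp]
  refine integral_congr_ae (Eventually.of_forall fun t => ?_)
  simp only [profile]
  rw [abs_mul, abs_of_pos (Real.exp_pos _), Real.mul_rpow (Real.exp_pos _).le (abs_nonneg _),
    ← Real.exp_mul, ← Real.exp_mul]
  have : Real.exp t * Real.exp (t * α) = Real.exp (rate m α * t * (critExp m α - 2)) *
      Real.exp (rate m α * t) * Real.exp (rate m α * t) := by
    rw [← Real.exp_add, ← Real.exp_add, ← Real.exp_add]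
    congr 1
    linear_combination -t * rate_mul_critExp hα
  linear_combination (|u (Real.exp t)| ^ (critExp m α - 2) * u (Real.exp t) * v (Real.exp t)) * this

theorem weightedNorm_gradient_sq (hm : 1 ≤ m) (hu : u ∈ dirichletSpace m α) :
    weightedNorm 2 α (gradient m α u) ^ 2 =
      ∫ t, diffOp (gradPoly m α) (profile m α u) t ^ 2 := by
  have h1 : ∫ r in Ioi (0 : ℝ), |gradient m α u r| ^ (2 : ℝ) * r ^ α =
      ∫ t, diffOp (gradPoly m α) (profile m α u) t ^ 2 := by
    simp only [Real.rpow_two, sq_abs]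
    simpa only [sq] using integral_gradient_mul hm hu hu
  have h2 : 0 ≤ ∫ t, diffOp (gradPoly m α) (profile m α u) t ^ 2 :=
    integral_nonneg fun t => sq_nonneg _
  rw [weightedNorm, h1, ← Real.rpow_natCast, ← Real.rpow_mul h2]
  norm_num

/-- The Sobolev quotient in Emden–Fowler coordinates. -/
theorem sobolevQuotient_eq (hm : 1 ≤ m) (hα : 0 < α - 2 * (m : ℝ) + 1)
    (hu : u ∈ dirichletSpace m α) :
    sobolevQuotient m α u = (∫ t, diffOp (gradPoly m α) (profile m α u) t ^ 2) /
      (∫ t, |profile m α u t| ^ critExp m α) ^ (2 / critExp m α) := by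
  have h2 : 0 ≤ ∫ t, |profile m α u t| ^ critExp m α :=
    integral_nonneg fun t => Real.rpow_nonneg (abs_nonneg _) _
  rw [sobolevQuotient, weightedNorm_gradient_sq hm hu, weightedNorm, integral_abs_rpow hα,
    ← Real.rpow_natCast, ← Real.rpow_mul h2]
  congr 2
  push_cast
  ring

theorem integrable_abs_rpow (hm : 1 ≤ m) (hα : 0 < α - 2 * (m : ℝ) + 1)
    (hu : u ∈ dirichletSpace m α) : Integrable fun t => |profile m α u t| ^ critExp m α := by
  obtain ⟨C, hC⟩ := exists_abs_profile_le hm hα hu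
  have hc : Continuous (profile m α u) := (contDiff_profile hu.1).continuous
  have hp := two_lt_critExp hm hα
  have h2 : Integrable fun t => profile m α u t ^ 2 := by
    have := memLp_iteratedDeriv_profile hm hα hu (Nat.zero_le m)
    rw [iteratedDeriv_zero] at this
    exact this.integrable_sq
  refine (h2.const_mul (C ^ (critExp m α - 2))).mono'
    ((hc.abs.rpow_const fun t => Or.inr (by linarith)).aestronglyMeasurable)
    (Eventually.of_forall fun t => ?_)
  rw [Real.norm_of_nonneg (Real.rpow_nonneg (abs_nonneg _) _)]
  have h3 : |profile m α u t| ^ critExp m α =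
      |profile m α u t| ^ (critExp m α - 2) * profile m α u t ^ 2 := by
    rw [← sq_abs (profile m α u t), ← Real.rpow_natCast,
      ← Real.rpow_add_of_nonneg (abs_nonneg _) (by linarith) (by norm_num)]
    congr 1
    push_cast
    ring
  rw [h3]
  exact mul_le_mul_of_nonneg_right
    (Real.rpow_le_rpow (abs_nonneg _) (hC t) (by linarith)) (sq_nonneg _)

theorem integral_abs_rpow_pos (hm : 1 ≤ m) (hα : 0 < α - 2 * (m : ℝ) + 1)
    (hu : u ∈ dirichletSpace m α) (hne : ¬ IsZero u) :
    0 < ∫ t, |profile m α u t| ^ critExp m α := by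
  have hc : Continuous (profile m α u) := (contDiff_profile hu.1).continuous
  have hp := two_lt_critExp hm hα
  obtain ⟨r, hr, hr'⟩ : ∃ r, 0 < r ∧ u r ≠ 0 := by
    by_contra! h
    exact hne fun r hr => h r hr
  refine integral_pos_of_integrable_nonneg_nonzero (x := Real.log r)
    (hc.abs.rpow_const fun t => Or.inr (by linarith)) (integrable_abs_rpow hm hα hu)
    (fun t => Real.rpow_nonneg (abs_nonneg _) _) ?_
  rw [profile, Real.exp_log hr]
  exact (Real.rpow_pos_of_pos (abs_pos.2 (mul_ne_zero (Real.exp_pos _).ne' hr')) _).ne'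

end Symbols

/-! ### The linear structure of `𝓓^{m,2}_∞(α)` -/

section EulerLagrange

variable {m : ℕ} {α : ℝ} {u v z : ℝ → ℝ}

theorem iteratedDeriv_add_mul_of_contDiffOn {n : ℕ} (hu : ContDiffOn ℝ n u (Ioi 0))
    (hv : ContDiffOn ℝ n v (Ioi 0)) (c : ℝ) {k : ℕ} (hk : k ≤ n) :
    EqOn (iteratedDeriv k fun s => u s + c * v s)
      (fun r => iteratedDeriv k u r + c * iteratedDeriv k v r) (Ioi 0) := by
  induction k with
  | zero => intro r _; simp
  | succ k ih =>
    intro r hr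
    have h1 : iteratedDeriv k (fun s => u s + c * v s) =ᶠ[𝓝 r]
        fun r => iteratedDeriv k u r + c * iteratedDeriv k v r := by
      filter_upwards [Ioi_mem_nhds hr] with s hs
      exact ih (by omega) hs
    simp only
    rw [iteratedDeriv_succ, h1.deriv_eq, iteratedDeriv_succ, iteratedDeriv_succ]
    exact ((differentiableAt_iteratedDeriv_of_contDiffOn hu hk hr).hasDerivAt.add
      ((differentiableAt_iteratedDeriv_of_contDiffOn hv hk hr).hasDerivAt.const_mul c)).deriv

theorem add_mul_mem_dirichletSpace (hm : 1 ≤ m) (hu : u ∈ dirichletSpace m α)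
    (hv : v ∈ dirichletSpace m α) (c : ℝ) : (fun r => u r + c * v r) ∈ dirichletSpace m α := by
  have hadd := fun k (hk : k ≤ m - 1) => iteratedDeriv_add_mul_of_contDiffOn hu.1 hv.1 c hk
  refine ⟨hu.1.add (contDiffOn_const.mul hv.1), ?_, fun j hj => ?_, ?_⟩
  · refine ACLoc.congr (fun a b ha hb => ?_) (hadd (m - 1) le_rfl)
    exact (hu.2.1 a b ha hb).fun_add ((hv.2.1 a b ha hb).const_mul c)
  · have h1 := (hu.2.2.1 j hj).add ((hv.2.2.1 j hj).const_mul c)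
    rw [mul_zero, add_zero] at h1
    refine h1.congr' ?_
    filter_upwards [eventually_gt_atTop 0] with r hr
    exact (hadd j (by omega) hr).symm
  · have hae : ∀ᵐ r ∂volume.restrict (Ioi (0 : ℝ)), iteratedDeriv m (fun s => u s + c * v s) r =
        iteratedDeriv m u r + c * iteratedDeriv m v r := by
      filter_upwards [hu.2.1.ae_differentiableAt, hv.2.1.ae_differentiableAt,
        ae_restrict_mem measurableSet_Ioi] with r h1 h2 hr
      have h3 : iteratedDeriv (m - 1) (fun s => u s + c * v s) =ᶠ[𝓝 r]
          fun r => iteratedDeriv (m - 1) u r + c * iteratedDeriv (m - 1) v r := by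
        filter_upwards [Ioi_mem_nhds hr] with s hs
        exact hadd _ le_rfl hs
      rw [show m = m - 1 + 1 by omega, iteratedDeriv_succ, h3.deriv_eq, iteratedDeriv_succ,
        iteratedDeriv_succ]
      exact (h1.hasDerivAt.add (h2.hasDerivAt.const_mul c)).deriv
    refine Integrable.mono' ((hu.2.2.2.const_mul 2).add (hv.2.2.2.const_mul (2 * c ^ 2))) ?_ ?_
    · rw [show m = m - 1 + 1 by omega, iteratedDeriv_succ]
      exact (((measurable_deriv _).pow_const 2).mul (by fun_prop)).aestronglyMeasurable
    · filter_upwards [hae, ae_restrict_mem measurableSet_Ioi] with r hr hr0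
      have hp : 0 ≤ r ^ α := Real.rpow_nonneg (le_of_lt hr0) α
      rw [hr, Real.norm_of_nonneg (mul_nonneg (sq_nonneg _) hp)]
      simp only [Pi.add_apply]
      have h1 : (iteratedDeriv m u r + c * iteratedDeriv m v r) ^ 2 ≤
          2 * iteratedDeriv m u r ^ 2 + 2 * c ^ 2 * iteratedDeriv m v r ^ 2 := by
        nlinarith [sq_nonneg (iteratedDeriv m u r - c * iteratedDeriv m v r)]
      calc _ ≤ (2 * iteratedDeriv m u r ^ 2 + 2 * c ^ 2 * iteratedDeriv m v r ^ 2) * r ^ α :=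
            mul_le_mul_of_nonneg_right h1 hp
        _ = _ := by ring

theorem profile_add_mul (u v : ℝ → ℝ) (c : ℝ) :
    profile m α (fun r => u r + c * v r) = fun t => profile m α u t + c * profile m α v t := by
  funext t; simp only [profile]; ring

/-! ### The Euler–Lagrange equation -/

/-- The tangent line inequality for the convex function `|x|^p`. -/
theorem abs_rpow_add_le {p : ℝ} (hp : 1 ≤ p) (a b : ℝ) :
    |a| ^ p + p * (|a| ^ (p - 2) * a * b) ≤ |a + b| ^ p := by
  by_cases ha : a = 0
  · rw [ha, abs_zero, Real.zero_rpow (by linarith)]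
    have := Real.rpow_nonneg (abs_nonneg (0 + b)) p
    simpa using this
  · have ha' : 0 < |a| := abs_pos.2 ha
    have h1 : |a + b| ^ p = |a| ^ p * |1 + b / a| ^ p := by
      rw [← Real.mul_rpow (abs_nonneg _) (abs_nonneg _), ← abs_mul]
      congr 2; field_simp
    have h2 : |a| ^ (p - 2) * a * b = |a| ^ p * (b / a) := by
      have h3 : |a| ^ p = |a| ^ (p - 2) * a ^ 2 := by
        rw [← sq_abs a, ← Real.rpow_natCast, ← Real.rpow_add ha']
        congr 1; push_cast; ring
      rw [h3]; field_simp
    have h4 : 1 + p * (b / a) ≤ |1 + b / a| ^ p := by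
      rcases le_or_gt (-1) (b / a) with h | h
      · refine (one_add_mul_self_le_rpow_one_add h hp).trans ?_
        exact Real.rpow_le_rpow (by linarith) (le_abs_self _) (by linarith)
      · have h5 : 1 + p * (b / a) ≤ 0 := by nlinarith
        exact h5.trans (Real.rpow_nonneg (abs_nonneg _) _)
    rw [h1, h2]
    calc _ = |a| ^ p * (1 + p * (b / a)) := by ring
      _ ≤ _ := mul_le_mul_of_nonneg_left h4 (Real.rpow_nonneg ha'.le _)

theorem sobolevInf_nonneg : 0 ≤ sobolevInf m α := by
  refine Real.sInf_nonneg ?_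
  rintro _ ⟨w, -, rfl⟩
  exact div_nonneg (sq_nonneg _) (sq_nonneg _)

/-- The Sobolev inequality with the constant `𝓢`. -/
theorem sobolevInf_mul_le (hm : 1 ≤ m) (hα : 0 < α - 2 * (m : ℝ) + 1)
    (hu : u ∈ dirichletSpace m α) :
    sobolevInf m α * (∫ t, |profile m α u t| ^ critExp m α) ^ (2 / critExp m α) ≤
      ∫ t, diffOp (gradPoly m α) (profile m α u) t ^ 2 := by
  have hp := two_lt_critExp hm hα
  by_cases h0 : IsZero u
  · have h1 : ∫ t, |profile m α u t| ^ critExp m α = 0 := by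
      rw [← integral_zero ℝ ℝ]
      refine integral_congr_ae (Eventually.of_forall fun t => ?_)
      have h3 : u (Real.exp t) = 0 := h0 (Real.exp_pos t)
      simp only [profile, h3, mul_zero, abs_zero]
      exact Real.zero_rpow (by linarith)
    rw [h1, Real.zero_rpow (by positivity), mul_zero]
    exact integral_nonneg fun t => sq_nonneg _
  · have h1 : sobolevInf m α ≤ sobolevQuotient m α u := by
      refine csInf_le ⟨0, ?_⟩ ⟨u, ⟨hu, h0⟩, rfl⟩
      rintro _ ⟨w, -, rfl⟩
      exact div_nonneg (sq_nonneg _) (sq_nonneg _)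
    rw [sobolevQuotient_eq hm hα hu, le_div_iff₀
      (Real.rpow_pos_of_pos (integral_abs_rpow_pos hm hα hu h0) _)] at h1
    exact h1

theorem integrable_abs_rpow_mul (hm : 1 ≤ m) (hα : 0 < α - 2 * (m : ℝ) + 1)
    (hu : u ∈ dirichletSpace m α) (hv : v ∈ dirichletSpace m α) :
    Integrable fun t =>
      |profile m α u t| ^ (critExp m α - 2) * profile m α u t * profile m α v t := by
  obtain ⟨C, hC⟩ := exists_abs_profile_le hm hα hu
  have hcu : Continuous (profile m α u) := (contDiff_profile hu.1).continuous
  have hcv : Continuous (profile m α v) := (contDiff_profile hv.1).continuous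
  have hp := two_lt_critExp hm hα
  have h1 := memLp_iteratedDeriv_profile hm hα hu (Nat.zero_le m)
  have h2 := memLp_iteratedDeriv_profile hm hα hv (Nat.zero_le m)
  rw [iteratedDeriv_zero] at h1 h2
  refine ((h1.integrable_mul h2).norm.const_mul (C ^ (critExp m α - 2))).mono'
    (((hcu.abs.rpow_const fun t => Or.inr (by linarith)).mul hcu).mul hcv).aestronglyMeasurable
    (Eventually.of_forall fun t => ?_)
  rw [mul_assoc, norm_mul, Real.norm_of_nonneg (Real.rpow_nonneg (abs_nonneg _) _)]
  exact mul_le_mul_of_nonneg_right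
    (Real.rpow_le_rpow (abs_nonneg _) (hC t) (by linarith)) (norm_nonneg _)

/-- The Lagrange multiplier of a minimizer: the value that makes the equation hold when tested
against the minimizer itself. -/
noncomputable def multiplier (m : ℕ) (α : ℝ) (z : ℝ → ℝ) : ℝ :=
  (∫ t, diffOp (gradPoly m α) (profile m α z) t ^ 2) / ∫ t, |profile m α z t| ^ critExp m α

theorem multiplier_nonneg : 0 ≤ multiplier m α z :=
  div_nonneg (integral_nonneg fun _ => sq_nonneg _)
    (integral_nonneg fun _ => Real.rpow_nonneg (abs_nonneg _) _)

/-- The Euler–Lagrange equation of a minimizer, in weak form. -/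
theorem IsMinimizer.euler_lagrange (hm : 1 ≤ m) (hα : 0 < α - 2 * (m : ℝ) + 1)
    (hz : IsMinimizer m α z) (hv : v ∈ dirichletSpace m α) :
    ∫ t, diffOp (gradPoly m α) (profile m α z) t * diffOp (gradPoly m α) (profile m α v) t =
      multiplier m α z * ∫ t,
        |profile m α z t| ^ (critExp m α - 2) * profile m α z t * profile m α v t := by
  obtain ⟨hzD, hz0, hzmin⟩ := hz
  have hp := two_lt_critExp hm hα
  rw [sobolevQuotient_eq hm hα hzD] at hzmin
  unfold multiplier
  set p := critExp m α
  set φ := profile m α z with hφ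
  set η := profile m α v with hη
  set G := gradPoly m α with hG
  set E := ∫ t, diffOp G φ t ^ 2
  set B := ∫ t, diffOp G φ t * diffOp G η t
  set D := ∫ t, diffOp G η t ^ 2
  set N := ∫ t, |φ t| ^ p
  set B' := ∫ t, |φ t| ^ (p - 2) * φ t * η t
  set S := sobolevInf m α
  have hN : 0 < N := integral_abs_rpow_pos hm hα hzD hz0
  have hS0 : 0 ≤ S := sobolevInf_nonneg
  have hSE : S * N ^ (2 / p) = E := by
    rw [← hzmin, div_mul_cancel₀ _ (Real.rpow_pos_of_pos hN _).ne']
  have hmz := memLp_diffOp_gradPoly hm hα hzD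
  have hmv := memLp_diffOp_gradPoly hm hα hv
  have hexp : ∀ s : ℝ, ∫ t, diffOp G (fun t => φ t + s * η t) t ^ 2 =
      E + 2 * s * B + s ^ 2 * D := by
    intro s
    have h1 : ∫ t, diffOp G (fun t => φ t + s * η t) t ^ 2 =
        ∫ t, (diffOp G φ t ^ 2 + 2 * s * (diffOp G φ t * diffOp G η t) +
          s ^ 2 * diffOp G η t ^ 2) := by
      refine integral_congr_ae ?_
      filter_upwards [ae_differentiableAt_profile hzD, ae_differentiableAt_profile hv]
        with t h1 h2
      rw [diffOp_add_fun s fun k hk => iteratedDeriv_add_mul_succ (contDiff_profile hzD.1)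
        (contDiff_profile hv.1) s h1 h2 ?_]
      · ring
      · have := hk.trans natDegree_gradPoly_le
        omega
    have i1 : Integrable fun t => diffOp G φ t ^ 2 := hmz.integrable_sq
    have i2 : Integrable fun t => 2 * s * (diffOp G φ t * diffOp G η t) :=
      (hmz.integrable_mul hmv).const_mul _
    have i3 : Integrable fun t => s ^ 2 * diffOp G η t ^ 2 := hmv.integrable_sq.const_mul _
    have i12 : Integrable fun t =>
        diffOp G φ t ^ 2 + 2 * s * (diffOp G φ t * diffOp G η t) := i1.add i2
    rw [h1, integral_add i12 i3, integral_add i1 i2, integral_const_mul,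
      integral_const_mul]
  have hmass : ∀ s : ℝ, N + s * (p * B') ≤ ∫ t, |φ t + s * η t| ^ p := by
    intro s
    have i1 : Integrable fun t => |φ t| ^ p := integrable_abs_rpow hm hα hzD
    have i2 : Integrable fun t => s * p * (|φ t| ^ (p - 2) * φ t * η t) :=
      (integrable_abs_rpow_mul hm hα hzD hv).const_mul _
    have i3 : Integrable fun t => |φ t + s * η t| ^ p := by
      have := integrable_abs_rpow hm hα (add_mul_mem_dirichletSpace hm hzD hv s)
      rwa [profile_add_mul] at this
    have h1 := integral_mono (i1.add i2) i3 fun t => by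
      have := abs_rpow_add_le (p := p) (by linarith) (φ t) (s * η t)
      simp only [Pi.add_apply]
      linarith
    simp only [Pi.add_apply] at h1
    rw [integral_add i1 i2, integral_const_mul] at h1
    calc N + s * (p * B') = N + s * p * B' := by ring
      _ ≤ _ := h1
  -- by convexity it suffices to differentiate the quotient with its mass linearized
  set H : ℝ → ℝ := fun s => E + 2 * s * B + s ^ 2 * D - S * (N + s * (p * B')) ^ (2 / p) with hH
  have hmin : IsLocalMin H 0 := by
    have hpos : ∀ᶠ s in 𝓝 (0 : ℝ), 0 < N + s * (p * B') := by
      have : Tendsto (fun s : ℝ => N + s * (p * B')) (𝓝 0) (𝓝 (N + 0 * (p * B'))) :=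
        (Continuous.tendsto (by fun_prop) 0)
      rw [zero_mul, add_zero] at this
      exact this.eventually (lt_mem_nhds hN)
    filter_upwards [hpos] with s hs
    have h1 : H 0 = 0 := by simp [hH, hSE]
    rw [h1]
    have h2 := sobolevInf_mul_le hm hα (add_mul_mem_dirichletSpace hm hzD hv s)
    rw [profile_add_mul, hexp] at h2
    have h3 : (N + s * (p * B')) ^ (2 / p) ≤ (∫ t, |φ t + s * η t| ^ p) ^ (2 / p) :=
      Real.rpow_le_rpow hs.le (hmass s) (by positivity)
    have h4 := mul_le_mul_of_nonneg_left h3 hS0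
    simp only [hH]
    linarith
  have hderiv : HasDerivAt H (2 * B - S * ((p * B') * (2 / p) * N ^ (2 / p - 1))) 0 := by
    have d1 : HasDerivAt (fun s : ℝ => N + s * (p * B')) (p * B') 0 := by
      simpa using ((hasDerivAt_id (0 : ℝ)).mul_const (p * B')).const_add N
    have d2 := (d1.rpow_const (p := 2 / p) (Or.inl (by simpa using hN.ne'))).const_mul S
    have d3 : HasDerivAt (fun s : ℝ => E + 2 * s * B + s ^ 2 * D) (2 * B) 0 := by
      have := ((((hasDerivAt_id (0 : ℝ)).const_mul 2).mul_const B).const_add E).fun_add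
        (((hasDerivAt_id (0 : ℝ)).fun_pow 2).mul_const D)
      simpa using this
    refine (d3.fun_sub d2).congr_deriv ?_
    simp
  have h0 := hmin.hasDerivAt_eq_zero hderiv
  have hN1 : N ^ (2 / p - 1) = N ^ (2 / p) / N := by rw [Real.rpow_sub_one hN.ne']
  rw [hN1] at h0
  rw [← hSE]
  have hp0 : p ≠ 0 := by linarith
  field_simp at h0 ⊢
  linarith

/-! ### Regular minimizers solve the differential equation -/

theorem hasCompactSupport_iteratedDeriv {η : ℝ → ℝ} (hη : HasCompactSupport η) (k : ℕ) :
    HasCompactSupport (iteratedDeriv k η) := by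
  induction k with
  | zero => simpa using hη
  | succ k ih => rw [iteratedDeriv_succ]; exact ih.deriv

theorem integral_diffOp_mul_iteratedDeriv {φ η : ℝ → ℝ} {n : ℕ} (hφ : ContDiff ℝ n φ)
    (hη : ContDiff ℝ (⊤ : ℕ∞) η) (hηc : HasCompactSupport η) (k : ℕ) {P : ℝ[X]}
    (hP : P.natDegree + k ≤ n) :
    ∫ t, diffOp P φ t * iteratedDeriv k η t = ∫ t, diffOp (P * (-X) ^ k) φ t * η t := by
  have hηk : ∀ j, ContDiff ℝ 1 (iteratedDeriv j η) := fun j => by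
    have h := hη.iterate_deriv j
    rw [← iteratedDeriv_eq_iterate] at h
    exact h.of_le (by exact_mod_cast le_top)
  induction k generalizing P with
  | zero => simp
  | succ k ih =>
    have hint : ∀ (Q : ℝ[X]) (j : ℕ), Q.natDegree ≤ n →
        Integrable (diffOp Q φ * iteratedDeriv j η) := fun Q j hQ =>
      ((continuous_diffOp hφ hQ).mul (hηk j).continuous).integrable_of_hasCompactSupport
        (hasCompactSupport_iteratedDeriv hηc j).mul_left
    have hXP : (X * P).natDegree ≤ P.natDegree + 1 := by
      refine natDegree_mul_le.trans ?_
      rw [natDegree_X, add_comm]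
    have h1 := integral_mul_deriv_eq_deriv_mul_of_integrable (u := diffOp P φ)
      (v := iteratedDeriv k η) (u' := diffOp (X * P) φ) (v' := iteratedDeriv (k + 1) η)
      (fun t _ => hasDerivAt_diffOp' hφ (by omega) t)
      (fun t _ => by
        rw [iteratedDeriv_succ]
        exact ((hηk k).differentiable one_ne_zero t).hasDerivAt)
      (hint _ _ (by omega)) (hint _ _ (by omega)) (hint _ _ (by omega))
    rw [h1, ih (by omega), ← integral_neg]
    refine integral_congr_ae (Eventually.of_forall fun t => ?_)
    have h2 : P * (-X) ^ (k + 1) = C (-1) * (X * P * (-X) ^ k) := by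
      rw [C_neg, C_1]; ring
    simp only
    rw [h2, diffOp_C_mul]
    ring

/-- Integration by parts: the formal adjoint of `Q(d/dt)` is `Q(-d/dt)`. -/
theorem integral_diffOp_mul_diffOp {φ η : ℝ → ℝ} {n : ℕ} (hφ : ContDiff ℝ n φ)
    (hη : ContDiff ℝ (⊤ : ℕ∞) η) (hηc : HasCompactSupport η) {P Q : ℝ[X]}
    (hPQ : P.natDegree + Q.natDegree ≤ n) :
    ∫ t, diffOp P φ t * diffOp Q η t = ∫ t, diffOp (P * Q.comp (-X)) φ t * η t := by
  have hηk : ∀ j, Continuous (iteratedDeriv j η) := fun j =>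
    hη.continuous_iteratedDeriv j (by exact_mod_cast le_top)
  have h1 : ∀ t, diffOp P φ t * diffOp Q η t =
      ∑ k ∈ Q.support, Q.coeff k * (diffOp P φ t * iteratedDeriv k η t) := fun t => by
    conv_lhs => rw [diffOp.eq_def Q, Polynomial.sum_def, Finset.mul_sum]
    exact Finset.sum_congr rfl fun k _ => by ring
  have h2 : ∀ t, diffOp (P * Q.comp (-X)) φ t * η t =
      ∑ k ∈ Q.support, Q.coeff k * (diffOp (P * (-X) ^ k) φ t * η t) := fun t => by
    rw [comp_eq_sum_left, Polynomial.sum_def, Finset.mul_sum, diffOp_sum, Finset.sum_mul]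
    refine Finset.sum_congr rfl fun k _ => ?_
    rw [mul_left_comm, diffOp_C_mul]
    ring
  have hdeg : ∀ k ∈ Q.support, P.natDegree + k ≤ n := fun k hk =>
    (Nat.add_le_add_left (le_natDegree_of_mem_supp k hk) _).trans hPQ
  simp only [h1, h2]
  rw [integral_finsetSum, integral_finsetSum]
  · refine Finset.sum_congr rfl fun k hk => ?_
    rw [integral_const_mul, integral_const_mul,
      integral_diffOp_mul_iteratedDeriv hφ hη hηc k (hdeg k hk)]
  · intro k hk
    refine Integrable.const_mul ?_ _
    refine Continuous.integrable_of_hasCompactSupport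
      ((continuous_diffOp hφ ?_).mul hη.continuous) hηc.mul_left
    refine natDegree_mul_le.trans ?_
    rw [natDegree_pow, natDegree_neg, natDegree_X, mul_one]
    exact hdeg k hk
  · intro k hk
    exact (Continuous.integrable_of_hasCompactSupport
      ((continuous_diffOp hφ (by have := hdeg k hk; omega)).mul (hηk k))
      (hasCompactSupport_iteratedDeriv hηc k).mul_left).const_mul _

/-- Every smooth compactly supported function on `ℝ` is the profile of a test function. -/
theorem exists_profile_eq {η : ℝ → ℝ} (hη : ContDiff ℝ (⊤ : ℕ∞) η)
    (hηc : HasCompactSupport η) : ∃ v ∈ dirichletSpace m α, profile m α v = η := by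
  set v : ℝ → ℝ := fun r => Real.exp (-rate m α * Real.log r) * η (Real.log r) with hv
  obtain ⟨R, hR⟩ := hηc.isCompact.isBounded.subset_closedBall 0
  have hη0 : ∀ t, R < |t| → η t = 0 := fun t ht => by
    by_contra h
    have := hR (subset_tsupport η (Function.mem_support.2 h))
    rw [Metric.mem_closedBall, dist_zero_right, Real.norm_eq_abs] at this
    linarith
  have hsmooth : ∀ n : ℕ, ContDiffOn ℝ n v (Ioi 0) := by
    intro n r hr
    have h1 : ContDiffAt ℝ n Real.log r := Real.contDiffAt_log.2 (ne_of_gt hr)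
    have h2 : ContDiff ℝ n η := hη.of_le (by exact_mod_cast le_top)
    exact (((contDiffAt_const.mul h1).exp).mul
      (h2.contDiffAt.comp r h1)).contDiffWithinAt
  have hv0 : ∀ r > 0, r ∉ Icc (Real.exp (-R)) (Real.exp R) → v =ᶠ[𝓝 r] 0 := by
    intro r hr hr'
    have h1 : ∀ᶠ s in 𝓝 r, s ∉ Icc (Real.exp (-R)) (Real.exp R) :=
      isClosed_Icc.isOpen_compl.mem_nhds hr'
    filter_upwards [h1, Ioi_mem_nhds hr] with s hs hs0
    have h2 : R < |Real.log s| := by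
      by_contra! h
      refine hs ⟨?_, ?_⟩
      · rw [← Real.le_log_iff_exp_le hs0]; exact (abs_le.1 h).1
      · rw [← Real.log_le_iff_le_exp hs0]; exact (abs_le.1 h).2
    simp [hv, hη0 _ h2]
  have hvd0 : ∀ k, ∀ r > 0, r ∉ Icc (Real.exp (-R)) (Real.exp R) → iteratedDeriv k v r = 0 := by
    intro k r hr hr'
    rw [(hv0 r hr hr').iteratedDeriv_eq]
    exact iteratedDeriv_const_zero
  have hcd : ∀ k : ℕ, ContDiffOn ℝ 1 (iteratedDeriv k v) (Ioi 0) := fun k => by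
    simpa using contDiffOn_iteratedDeriv (k := 1) (hsmooth (k + 1)) le_rfl
  refine ⟨v, ⟨hsmooth _, acLoc_of_contDiffOn (hcd _), fun j _ => ?_, ?_⟩, ?_⟩
  · refine tendsto_const_nhds.congr' ?_
    filter_upwards [eventually_gt_atTop (Real.exp R)] with r hr
    exact (hvd0 j r ((Real.exp_pos R).trans hr) fun h => hr.not_ge h.2).symm
  · have h1 : IntegrableOn (fun r => iteratedDeriv m v r ^ 2 * r ^ α)
        (Icc (Real.exp (-R)) (Real.exp R)) := by
      refine ContinuousOn.integrableOn_Icc fun r hr => ?_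
      have hr0 : 0 < r := (Real.exp_pos _).trans_le hr.1
      refine ((ContinuousAt.pow ?_ 2).mul
        (Real.continuousAt_rpow_const _ _ (Or.inl hr0.ne'))).continuousWithinAt
      exact (hcd m).continuousOn.continuousAt (Ioi_mem_nhds hr0)
    refine h1.of_forall_sdiff_eq_zero measurableSet_Ioi fun r hr => ?_
    rw [hvd0 m r hr.1 hr.2]
    simp
  · funext t
    simp only [profile, hv, Real.log_exp]
    rw [← mul_assoc, ← Real.exp_add]
    simp

theorem natDegree_polyLap_le : (polyLap m α).natDegree ≤ 2 * m := by
  rw [← gradPoly_mul_comp_neg]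
  refine natDegree_mul_le.trans ?_
  rw [natDegree_comp, natDegree_neg, natDegree_X]
  have := natDegree_gradPoly_le (m := m) (α := α)
  omega

/-- A `C^{2m}` solution of the weak equation is a classical solution. -/
theorem diffOp_polyLap_eq (hm : 1 ≤ m) (hα : 0 < α - 2 * (m : ℝ) + 1)
    (hz : ContDiffOn ℝ (2 * m : ℕ) z (Ioi 0)) {μ : ℝ}
    (hweak : ∀ v ∈ dirichletSpace m α,
      ∫ t, diffOp (gradPoly m α) (profile m α z) t * diffOp (gradPoly m α) (profile m α v) t =
        μ * ∫ t, |profile m α z t| ^ (critExp m α - 2) * profile m α z t * profile m α v t)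
    (t : ℝ) :
    diffOp (polyLap m α) (profile m α z) t =
      μ * (|profile m α z t| ^ (critExp m α - 2) * profile m α z t) := by
  have hp := two_lt_critExp hm hα
  have hφ := contDiff_profile (m := m) (α := α) hz
  set φ := profile m α z with hφdef
  have hc1 : Continuous (diffOp (polyLap m α) φ) := continuous_diffOp hφ natDegree_polyLap_le
  have hc2 : Continuous fun t => μ * (|φ t| ^ (critExp m α - 2) * φ t) :=
    continuous_const.mul ((hφ.continuous.abs.rpow_const fun t => Or.inr (by linarith)).mul
      hφ.continuous)
  have hae := ae_eq_zero_of_integral_contDiff_smul_eq_zero (μ := volume)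
    (hc1.sub hc2).locallyIntegrable fun η hη hηc => by
      obtain ⟨v, hv, hvη⟩ := exists_profile_eq (m := m) (α := α) hη hηc
      have h1 := hweak v hv
      rw [hvη, integral_diffOp_mul_diffOp hφ hη hηc
        (by have := natDegree_gradPoly_le (m := m) (α := α); omega),
        gradPoly_mul_comp_neg, ← integral_const_mul] at h1
      have h2 : ∀ t, η t • (diffOp (polyLap m α) φ t -
          μ * (|φ t| ^ (critExp m α - 2) * φ t)) = diffOp (polyLap m α) φ t * η t -
          μ * (|φ t| ^ (critExp m α - 2) * φ t * η t) := fun t => by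
        rw [smul_eq_mul]; ring
      simp only [Pi.sub_apply, h2]
      rw [integral_sub, h1, sub_self]
      · exact (hc1.mul hη.continuous).integrable_of_hasCompactSupport hηc.mul_left
      · have h3 := (hc2.mul hη.continuous).integrable_of_hasCompactSupport (μ := volume)
          hηc.mul_left
        refine h3.congr (Eventually.of_forall fun t => ?_)
        simp only [Pi.mul_apply]
        ring
  have h4 := (Continuous.ae_eq_iff_eq volume (hc1.sub hc2) continuous_const).1 hae
  exact sub_eq_zero.1 (congrFun h4 t)

end EulerLagrange

section Bubbles

variable {m : ℕ} {α : ℝ}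

/-! ### The bubbles solve the differential equation -/

/-- The function `2 cosh (t - s)`. -/
noncomputable def twoCosh (s t : ℝ) : ℝ := Real.exp (t - s) + Real.exp (-(t - s))

theorem twoCosh_pos (s t : ℝ) : 0 < twoCosh s t :=
  add_pos (Real.exp_pos _) (Real.exp_pos _)

theorem hasDerivAt_twoCosh (s t : ℝ) :
    HasDerivAt (twoCosh s) (Real.exp (t - s) - Real.exp (-(t - s))) t := by
  have h := (hasDerivAt_id t).sub_const s
  exact (h.exp.add h.neg.exp).congr_deriv (by simp; ring)

theorem contDiff_twoCosh_rpow (s κ : ℝ) {n : WithTop ℕ∞} :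
    ContDiff ℝ n fun t => twoCosh s t ^ κ := by
  have h : ContDiff ℝ n (twoCosh s) := by unfold twoCosh; fun_prop
  exact h.rpow_const_of_ne fun t => (twoCosh_pos s t).ne'

theorem hasDerivAt_twoCosh_rpow (s κ t : ℝ) :
    HasDerivAt (fun t => twoCosh s t ^ κ)
      (κ * ((Real.exp (t - s) - Real.exp (-(t - s))) * twoCosh s t ^ (κ - 1))) t :=
  ((hasDerivAt_twoCosh s t).rpow_const (Or.inl (twoCosh_pos s t).ne')).congr_deriv (by ring)

/-- The function `w = 2 cosh (t - s)` satisfies `(w^κ)'' = κ² w^κ - 4κ(κ - 1) w^{κ-2}`. -/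
theorem hasDerivAt_deriv_twoCosh_rpow (s κ t : ℝ) :
    HasDerivAt
      (fun t => κ * ((Real.exp (t - s) - Real.exp (-(t - s))) * twoCosh s t ^ (κ - 1)))
      (κ ^ 2 * twoCosh s t ^ κ - 4 * κ * (κ - 1) * twoCosh s t ^ (κ - 2)) t := by
  have h := (hasDerivAt_id t).sub_const s
  have h1 : HasDerivAt (fun t => Real.exp (t - s) - Real.exp (-(t - s))) (twoCosh s t) t :=
    (h.exp.fun_sub h.neg.exp).congr_deriv (by simp [twoCosh])
  refine ((h1.fun_mul (hasDerivAt_twoCosh_rpow s (κ - 1) t)).const_mul κ).congr_deriv ?_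
  have hw := twoCosh_pos s t
  have e1 : twoCosh s t ^ κ = twoCosh s t ^ (κ - 2) * twoCosh s t ^ 2 := by
    rw [← Real.rpow_natCast, ← Real.rpow_add hw]; congr 1; push_cast; ring
  have e2 : twoCosh s t ^ (κ - 1) = twoCosh s t ^ (κ - 2) * twoCosh s t := by
    rw [← Real.rpow_add_one hw.ne']; congr 1; ring
  have e3 : κ - 1 - 1 = κ - 2 := by ring
  have e4 : (Real.exp (t - s) - Real.exp (-(t - s))) ^ 2 = twoCosh s t ^ 2 - 4 := by
    have : Real.exp (t - s) * Real.exp (-(t - s)) = 1 := by rw [← Real.exp_add]; simp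
    unfold twoCosh
    linear_combination -4 * this
  rw [e3, e1, e2]
  linear_combination κ * (κ - 1) * twoCosh s t ^ (κ - 2) * e4

/-- Each factor of `(-Δ_α)^m` lowers the exponent by two. -/
theorem diffOp_twoCosh_rpow (s : ℝ) (k : ℕ) (t : ℝ) :
    diffOp (∏ i ∈ Finset.range k, (C ((rate m α + 2 * i) ^ 2) - X ^ 2))
        (fun t => twoCosh s t ^ (-rate m α)) t =
      (∏ i ∈ Finset.range k, (4 * (rate m α + 2 * i) * (rate m α + 2 * i + 1))) *
        twoCosh s t ^ (-(rate m α + 2 * k)) := by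
  induction k generalizing t with
  | zero => simp [diffOp_one]
  | succ k ih =>
    rw [Finset.prod_range_succ, Finset.prod_range_succ]
    set Q : ℝ[X] := ∏ i ∈ Finset.range k, (C ((rate m α + 2 * i) ^ 2) - X ^ 2)
    set K := ∏ i ∈ Finset.range k, (4 * (rate m α + 2 * i) * (rate m α + 2 * i + 1))
    set κ := rate m α + 2 * (k : ℝ) with hκ
    have hd : ∀ (P : ℝ[X]) t, HasDerivAt (diffOp P fun t => twoCosh s t ^ (-rate m α))
        (diffOp (X * P) (fun t => twoCosh s t ^ (-rate m α)) t) t := fun P t =>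
      hasDerivAt_diffOp' (n := P.natDegree + 1) (contDiff_twoCosh_rpow s _) (by omega) t
    have h1 : ∀ t, diffOp (X * Q) (fun t => twoCosh s t ^ (-rate m α)) t =
        K * (-κ * ((Real.exp (t - s) - Real.exp (-(t - s))) * twoCosh s t ^ (-κ - 1))) :=
      fun t => (hd Q t).unique (by
        rw [funext ih]
        exact (hasDerivAt_twoCosh_rpow s (-κ) t).const_mul K)
    have h2 : diffOp (X * (X * Q)) (fun t => twoCosh s t ^ (-rate m α)) t =
        K * ((-κ) ^ 2 * twoCosh s t ^ (-κ) - 4 * (-κ) * (-κ - 1) * twoCosh s t ^ (-κ - 2)) :=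
      (hd (X * Q) t).unique (by
        rw [funext h1]
        exact (hasDerivAt_deriv_twoCosh_rpow s (-κ) t).const_mul K)
    have h3 : Q * (C (κ ^ 2) - X ^ 2) = C (κ ^ 2) * Q + C (-1) * (X * (X * Q)) := by
      rw [C_neg, C_1]; ring
    have h4 : -(rate m α + 2 * ((k + 1 : ℕ) : ℝ)) = -κ - 2 := by rw [hκ]; push_cast; ring
    rw [h3, diffOp_add, diffOp_C_mul, diffOp_C_mul, h2, ih, h4]
    ring

/-- Consecutive factors of `𝓟` are paired: the factors for `h = 2i - m` and `h = 2i + 1 - m` are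
`2(γ + 2i)` and `2(γ + 2i + 1)`. -/
theorem prodConst_eq : prodConst m α =
    ∏ i ∈ Finset.range m, (4 * (rate m α + 2 * i) * (rate m α + 2 * i + 1)) := by
  have h1 : prodConst m α = ∏ i ∈ Finset.range (2 * m), (α + 1 + 2 * ((i : ℝ) - m)) := by
    unfold prodConst
    symm
    refine Finset.prod_bij (fun i _ => (i : ℤ) - m) (fun i hi => ?_) (fun i _ j _ h => ?_)
      (fun h hh => ?_) fun i _ => ?_
    · rw [Finset.mem_range] at hi; rw [Finset.mem_Ico]; omega
    · omega
    · rw [Finset.mem_Ico] at hh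
      exact ⟨(h + m).toNat, by rw [Finset.mem_range]; omega, by omega⟩
    · push_cast; ring
  have h2 : ∀ (g : ℕ → ℝ) k, ∏ i ∈ Finset.range (2 * k), g i =
      ∏ i ∈ Finset.range k, (g (2 * i) * g (2 * i + 1)) := by
    intro g k
    induction k with
    | zero => simp
    | succ k ih =>
      rw [show 2 * (k + 1) = 2 * k + 1 + 1 by ring, Finset.prod_range_succ,
        Finset.prod_range_succ, ih, Finset.prod_range_succ]
      ring
  rw [h1, h2]
  refine Finset.prod_congr rfl fun i _ => ?_
  unfold rate
  push_cast
  ring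

theorem prodConst_pos (hα : 0 < α - 2 * (m : ℝ) + 1) : 0 < prodConst m α := by
  rw [prodConst_eq]
  have := rate_pos hα
  exact Finset.prod_pos fun i _ => by positivity

/-- The amplitude `𝓟^{(α-2m+1)/(4m)}` of the bubbles. -/
noncomputable def bubbleConst (m : ℕ) (α : ℝ) : ℝ :=
  prodConst m α ^ ((α - 2 * m + 1) / (4 * m))

theorem bubbleConst_pos (hα : 0 < α - 2 * (m : ℝ) + 1) : 0 < bubbleConst m α :=
  Real.rpow_pos_of_pos (prodConst_pos hα) _

theorem bubbleConst_rpow (hm : 1 ≤ m) (hα : 0 < α - 2 * (m : ℝ) + 1) :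
    bubbleConst m α ^ (critExp m α - 2) = prodConst m α := by
  have hm' : (m : ℝ) ≠ 0 := by positivity
  rw [bubbleConst, ← Real.rpow_mul (prodConst_pos hα).le]
  have : (α - 2 * m + 1) / (4 * m) * (critExp m α - 2) = 1 := by
    unfold critExp
    field_simp
    ring
  rw [this, Real.rpow_one]

theorem profile_bubble {ε : ℝ} (hε : 0 < ε) :
    profile m α (bubble m α ε) =
      fun t => bubbleConst m α * twoCosh (Real.log ε) t ^ (-rate m α) := by
  funext t
  have h1 : (ε / (ε ^ 2 + Real.exp t ^ 2)) * Real.exp t = (twoCosh (Real.log ε) t)⁻¹ := by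
    have e1 : twoCosh (Real.log ε) t = Real.exp t / ε + ε / Real.exp t := by
      rw [twoCosh, Real.exp_sub, neg_sub, Real.exp_sub, Real.exp_log hε]
    have := Real.exp_pos t
    rw [e1]
    field_simp
    ring
  have h2 : (ε / (ε ^ 2 + Real.exp t ^ 2)) ^ rate m α * Real.exp (rate m α * t) =
      twoCosh (Real.log ε) t ^ (-rate m α) := by
    rw [mul_comm (rate m α), Real.exp_mul, ← Real.mul_rpow (by positivity) (Real.exp_pos t).le,
      h1, Real.inv_rpow (twoCosh_pos _ _).le, Real.rpow_neg (twoCosh_pos _ _).le]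
  rw [← h2, profile, bubble, bubbleConst, rate]
  ring

/-- The bubbles solve `(-Δ_α)^m w = w^{2^* - 1}`. -/
theorem diffOp_polyLap_bubble (hm : 1 ≤ m) (hα : 0 < α - 2 * (m : ℝ) + 1) {ε : ℝ} (hε : 0 < ε)
    (t : ℝ) :
    diffOp (polyLap m α) (profile m α (bubble m α ε)) t =
      |profile m α (bubble m α ε) t| ^ (critExp m α - 2) * profile m α (bubble m α ε) t := by
  have hK := bubbleConst_pos hα
  have hw := twoCosh_pos (Real.log ε) t
  have hlin : diffOp (polyLap m α) (profile m α (bubble m α ε)) t = bubbleConst m α *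
      diffOp (polyLap m α) (fun t => twoCosh (Real.log ε) t ^ (-rate m α)) t := by
    rw [profile_bubble hε, diffOp_const_mul]
  rw [hlin, polyLap, diffOp_twoCosh_rpow, ← prodConst_eq, profile_bubble hε]
  simp only
  rw [abs_of_pos (mul_pos hK (Real.rpow_pos_of_pos hw _)),
    Real.mul_rpow hK.le (Real.rpow_nonneg hw.le _), bubbleConst_rpow hm hα, ← Real.rpow_mul hw.le]
  have h1 : -(rate m α + 2 * (m : ℝ)) = -rate m α * (critExp m α - 2) + -rate m α := by
    have h2 := rate_mul_critExp hα
    have h3 : α + 1 = 2 * rate m α + 2 * m := by unfold rate; ring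
    linear_combination h2 + h3
  rw [h1, Real.rpow_add hw]
  ring

theorem contDiff_bubble {ε : ℝ} (hε : 0 < ε) {n : WithTop ℕ∞} : ContDiff ℝ n (bubble m α ε) := by
  have h : ∀ r : ℝ, ε ^ 2 + r ^ 2 ≠ 0 := fun r => by positivity
  have h1 : ContDiff ℝ n fun r : ℝ => ε / (ε ^ 2 + r ^ 2) :=
    contDiff_const.div (by fun_prop) h
  exact contDiff_const.mul (h1.rpow_const_of_ne fun r => by positivity)

theorem tendsto_profile_bubble_atTop (hα : 0 < α - 2 * (m : ℝ) + 1) {ε : ℝ} (hε : 0 < ε) :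
    Tendsto (profile m α (bubble m α ε)) atTop (𝓝 0) := by
  rw [profile_bubble hε]
  have h1 : Tendsto (twoCosh (Real.log ε)) atTop atTop :=
    tendsto_atTop_mono (fun t => (le_add_of_nonneg_right (Real.exp_pos _).le))
      (Real.tendsto_exp_atTop.comp (tendsto_atTop_add_const_right _ (-Real.log ε) tendsto_id))
  simpa using ((tendsto_rpow_neg_atTop (rate_pos hα)).comp h1).const_mul (bubbleConst m α)

end Bubbles

section Classification

variable {m : ℕ} {α : ℝ} {z : ℝ → ℝ}

/-! ### Uniqueness for the profile equation -/

/-- The roots `±(γ + 2i)` of the symbol of `(-Δ_α)^m`. -/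
noncomputable def symbolRoot (m : ℕ) (α : ℝ) : Fin m ⊕ Fin m → ℝ :=
  Sum.elim (fun i => rate m α + 2 * (i : ℕ)) fun i => -(rate m α + 2 * (i : ℕ))

theorem rootProd_symbolRoot :
    rootProd (symbolRoot m α) Finset.univ = C ((-1) ^ m) * polyLap m α := by
  rw [rootProd, Fintype.prod_sum_type, polyLap, ← Fin.prod_univ_eq_prod_range
    (fun i => C ((rate m α + 2 * (i : ℝ)) ^ 2) - X ^ 2), ← Finset.prod_mul_distrib]
  have : (C ((-1 : ℝ) ^ m) : ℝ[X]) = ∏ _i : Fin m, C (-1) := by simp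
  rw [this, ← Finset.prod_mul_distrib]
  refine Finset.prod_congr rfl fun i _ => ?_
  simp only [symbolRoot, Sum.elim_inl, Sum.elim_inr, C_neg, C_pow, C_1]
  ring

theorem symbolRoot_ne_zero (hα : 0 < α - 2 * (m : ℝ) + 1) (i : Fin m ⊕ Fin m) :
    symbolRoot m α i ≠ 0 := by
  have hr := rate_pos hα
  rcases i with i | i
  · have : 0 < rate m α + 2 * ((i : ℕ) : ℝ) := by positivity
    exact this.ne'
  · have : 0 < rate m α + 2 * ((i : ℕ) : ℝ) := by positivity
    exact neg_ne_zero.2 this.ne'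

theorem symbolRoot_injective (hα : 0 < α - 2 * (m : ℝ) + 1) :
    Function.Injective (symbolRoot m α) := by
  have hr := rate_pos hα
  have hpos : ∀ i : Fin m, 0 < rate m α + 2 * ((i : ℕ) : ℝ) := fun i => by positivity
  rintro (i | i) (j | j) h <;> simp only [symbolRoot, Sum.elim_inl, Sum.elim_inr] at h
  · congr 1
    have : ((i : ℕ) : ℝ) = (j : ℕ) := by linarith
    exact Fin.ext (by exact_mod_cast this)
  · linarith [hpos i, hpos j]
  · linarith [hpos i, hpos j]
  · congr 1
    have : ((i : ℕ) : ℝ) = (j : ℕ) := by linarith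
    exact Fin.ext (by exact_mod_cast this)

section Nonlinearity

variable {p : ℝ}

/-- The nonlinearity `|x|^{p-2} x` is increasing. -/
theorem abs_rpow_mul_monotone (hp : 2 < p) (a b : ℝ) :
    0 ≤ (|a| ^ (p - 2) * a - |b| ^ (p - 2) * b) * (a - b) := by
  have h1 := abs_rpow_add_le (p := p) (by linarith) a (b - a)
  have h2 := abs_rpow_add_le (p := p) (by linarith) b (a - b)
  rw [add_sub_cancel] at h1 h2
  have h3 : 0 ≤ p * ((|a| ^ (p - 2) * a - |b| ^ (p - 2) * b) * (a - b)) := by linarith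
  exact nonneg_of_mul_nonneg_right h3 (by linarith)

theorem one_sub_rpow_le {q ρ : ℝ} (hq : 0 < q) (h0 : 0 ≤ ρ) (h1 : ρ ≤ 1) :
    1 - ρ ^ q ≤ (1 + q) * (1 - ρ) := by
  rcases le_total 1 q with h | h
  · have h2 := one_add_mul_self_le_rpow_one_add (s := ρ - 1) (by linarith) h
    rw [add_sub_cancel] at h2
    linarith
  · have h2 := Real.rpow_le_rpow_of_exponent_ge' h0 h1 hq.le h
    rw [Real.rpow_one] at h2
    nlinarith

theorem abs_sub_abs_rpow_mul_le_of_le (hp : 2 < p) {a b : ℝ} (hab : |b| ≤ |a|) :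
    |(|a| ^ (p - 2) * a - |b| ^ (p - 2) * b)| ≤ p * |a| ^ (p - 2) * |a - b| := by
  rcases (abs_nonneg a).eq_or_lt with h0 | h0
  · have hb : b = 0 := abs_eq_zero.1 (le_antisymm (hab.trans h0.symm.le) (abs_nonneg b))
    have ha : a = 0 := abs_eq_zero.1 h0.symm
    simp [ha, hb]
  have hA : 0 < |a| ^ (p - 2) := Real.rpow_pos_of_pos h0 _
  set ρ := |b| / |a| with hρ
  have hρ0 : 0 ≤ ρ := by positivity
  have hρ1 : ρ ≤ 1 := (div_le_one h0).2 hab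
  have hb : |b| = |a| * ρ := by rw [hρ]; field_simp
  have hbq : |b| ^ (p - 2) = |a| ^ (p - 2) * ρ ^ (p - 2) := by
    rw [hb, Real.mul_rpow h0.le hρ0]
  have h1 := one_sub_rpow_le (q := p - 2) (by linarith) hρ0 hρ1
  have h2 : ρ ^ (p - 2) ≤ 1 := Real.rpow_le_one hρ0 hρ1 (by linarith)
  have h3 : |a| - |b| ≤ |a - b| := abs_sub_abs_le_abs_sub a b
  have h4 : (1 - ρ ^ (p - 2)) * |b| ≤ (p - 1) * |a - b| := by
    calc (1 - ρ ^ (p - 2)) * |b| ≤ (1 - ρ ^ (p - 2)) * |a| :=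
          mul_le_mul_of_nonneg_left hab (by linarith)
      _ ≤ (1 + (p - 2)) * (1 - ρ) * |a| := mul_le_mul_of_nonneg_right h1 h0.le
      _ = (p - 1) * (|a| - |b|) := by rw [hb]; ring
      _ ≤ _ := mul_le_mul_of_nonneg_left h3 (by linarith)
  calc |(|a| ^ (p - 2) * a - |b| ^ (p - 2) * b)|
      = |a| ^ (p - 2) * |(a - b) + (1 - ρ ^ (p - 2)) * b| := by
        rw [hbq, ← abs_of_pos hA, ← abs_mul, abs_of_pos hA]; congr 1; ring
    _ ≤ |a| ^ (p - 2) * (|a - b| + (1 - ρ ^ (p - 2)) * |b|) := by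
        refine mul_le_mul_of_nonneg_left ((abs_add_le _ _).trans ?_) hA.le
        rw [abs_mul, abs_of_nonneg (by linarith : 0 ≤ 1 - ρ ^ (p - 2))]
    _ ≤ |a| ^ (p - 2) * (|a - b| + (p - 1) * |a - b|) :=
        mul_le_mul_of_nonneg_left (by linarith) hA.le
    _ = _ := by ring

/-- The nonlinearity `|x|^{p-2} x` is locally Lipschitz, with a constant that tends to zero at the
origin. -/
theorem abs_sub_abs_rpow_mul_le (hp : 2 < p) (a b : ℝ) :
    |(|a| ^ (p - 2) * a - |b| ^ (p - 2) * b)| ≤ p * (|a| + |b|) ^ (p - 2) * |a - b| := by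
  have hmono : ∀ x y : ℝ, |x| ^ (p - 2) ≤ (|x| + |y|) ^ (p - 2) := fun x y =>
    Real.rpow_le_rpow (abs_nonneg _) (le_add_of_nonneg_right (abs_nonneg _)) (by linarith)
  rcases le_total |b| |a| with h | h
  · refine (abs_sub_abs_rpow_mul_le_of_le hp h).trans ?_
    have := hmono a b
    gcongr
  · rw [abs_sub_comm, abs_sub_comm a b, add_comm |a|]
    refine (abs_sub_abs_rpow_mul_le_of_le hp h).trans ?_
    have := hmono b a
    gcongr

end Nonlinearity

theorem exists_abs_le_of_tendsto_zero {f : ℝ → ℝ} (hf : Continuous f)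
    (h0 : Tendsto f atBot (𝓝 0)) (h1 : Tendsto f atTop (𝓝 0)) : ∃ M, ∀ t, |f t| ≤ M := by
  obtain ⟨a, ha⟩ := eventually_atBot.1 (h0.abs.eventually (gt_mem_nhds (by simp : |(0 : ℝ)| < 1)))
  obtain ⟨b, hb⟩ := eventually_atTop.1 (h1.abs.eventually (gt_mem_nhds (by simp : |(0 : ℝ)| < 1)))
  obtain ⟨M, hM⟩ := isCompact_Icc.exists_bound_of_continuousOn (s := Icc a b) hf.continuousOn
  refine ⟨max 1 M, fun t => ?_⟩
  by_cases h : t ∈ Icc a b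
  · exact (hM t h).trans (le_max_right _ _)
  · rw [mem_Icc, not_and_or, not_le, not_le] at h
    rcases h with h | h
    · exact (ha t h.le).le.trans (le_max_left _ _)
    · exact (hb t h.le).le.trans (le_max_left _ _)

/-- Two solutions of the profile equation that vanish at `+∞` and have the same leading
coefficient of order `e^{γt}` at `-∞` coincide. -/
theorem profile_unique (hm : 1 ≤ m) (hα : 0 < α - 2 * (m : ℝ) + 1) {p : ℝ} (hp : 2 < p)
    {φ ψ : ℝ → ℝ} (hφ : ContDiff ℝ (2 * m : ℕ) φ) (hψ : ContDiff ℝ (2 * m : ℕ) ψ)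
    (hφeq : ∀ t, diffOp (polyLap m α) φ t = |φ t| ^ (p - 2) * φ t)
    (hψeq : ∀ t, diffOp (polyLap m α) ψ t = |ψ t| ^ (p - 2) * ψ t)
    (hφ1 : Tendsto φ atTop (𝓝 0)) (hψ1 : Tendsto ψ atTop (𝓝 0)) {L : ℝ}
    (hφL : Tendsto (fun t => Real.exp (-rate m α * t) * φ t) atBot (𝓝 L))
    (hψL : Tendsto (fun t => Real.exp (-rate m α * t) * ψ t) atBot (𝓝 L)) : φ = ψ := by
  have hr := rate_pos hα
  have hvan : ∀ χ : ℝ → ℝ, Tendsto (fun t => Real.exp (-rate m α * t) * χ t) atBot (𝓝 L) →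
      Tendsto χ atBot (𝓝 0) := by
    intro χ hχ
    have h1 : Tendsto (fun t => Real.exp (rate m α * t)) atBot (𝓝 0) :=
      Real.tendsto_exp_atBot.comp (tendsto_id.const_mul_atBot hr)
    have h2 := h1.mul hχ
    rw [zero_mul] at h2
    refine h2.congr fun t => ?_
    rw [← mul_assoc, ← Real.exp_add]
    simp
  have hφ0 := hvan φ hφL
  have hψ0 := hvan ψ hψL
  set f : ℝ → ℝ := fun t => φ t + (-1) * ψ t with hf
  have hfsub : ∀ t, f t = φ t - ψ t := fun t => by simp only [hf]; ring
  set B : ℝ → ℝ := fun t => p * (|φ t| + |ψ t|) ^ (p - 2) with hB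
  -- the difference quotient of the nonlinearity, set to zero where `φ = ψ` since `x / 0 = 0`
  set W : ℝ → ℝ := fun t =>
    (|φ t| ^ (p - 2) * φ t - |ψ t| ^ (p - 2) * ψ t) / (φ t - ψ t) with hW
  have hWmul : ∀ t, W t * f t = |φ t| ^ (p - 2) * φ t - |ψ t| ^ (p - 2) * ψ t := by
    intro t
    rw [hfsub]
    by_cases h : φ t - ψ t = 0
    · rw [h, mul_zero, sub_eq_zero.1 h, sub_self]
    · exact div_mul_cancel₀ _ h
  have hW0 : ∀ t, 0 ≤ W t := fun t => by
    have h1 := abs_rpow_mul_monotone hp (φ t) (ψ t)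
    rcases eq_or_ne (φ t - ψ t) 0 with h | h
    · simp [hW, h]
    · have h2 : W t = ((|φ t| ^ (p - 2) * φ t - |ψ t| ^ (p - 2) * ψ t) * (φ t - ψ t)) /
          (φ t - ψ t) ^ 2 := by simp only [hW]; field_simp
      rw [h2]
      exact div_nonneg h1 (sq_nonneg _)
  have hB0 : ∀ t, 0 ≤ B t := fun t =>
    mul_nonneg (by linarith) (Real.rpow_nonneg (by positivity) _)
  have hWB : ∀ t, W t ≤ B t := fun t => by
    rcases eq_or_ne (φ t - ψ t) 0 with h | h
    · simp only [hW, h, div_zero]; exact hB0 t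
    · refine (le_abs_self _).trans ?_
      simp only [hW]
      rw [abs_div, div_le_iff₀ (abs_pos.2 h)]
      exact abs_sub_abs_rpow_mul_le hp _ _
  have hBlim : ∀ l : Filter ℝ, Tendsto φ l (𝓝 0) → Tendsto ψ l (𝓝 0) → Tendsto B l (𝓝 0) := by
    intro l h1 h2
    have h3 := ((h1.abs.add h2.abs).rpow_const (p := p - 2)
      (Or.inr (by linarith))).const_mul p
    simpa [Real.zero_rpow (by linarith : p - 2 ≠ 0)] using h3
  have hBc : Continuous B := continuous_const.mul
    ((hφ.continuous.abs.add hψ.continuous.abs).rpow_const fun t => Or.inr (by linarith))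
  obtain ⟨M, hM⟩ := exists_abs_le_of_tendsto_zero hBc (hBlim _ hφ0 hψ0) (hBlim _ hφ1 hψ1)
  have hWlim : ∀ l : Filter ℝ, Tendsto φ l (𝓝 0) → Tendsto ψ l (𝓝 0) → Tendsto W l (𝓝 0) :=
    fun l h1 h2 => squeeze_zero hW0 hWB (hBlim l h1 h2)
  have hcard : Fintype.card (Fin m ⊕ Fin m) = 2 * m := by
    rw [Fintype.card_sum, Fintype.card_fin]; ring
  have hfC : ContDiff ℝ (Fintype.card (Fin m ⊕ Fin m)) f := by
    rw [hcard]; exact hφ.add (contDiff_const.mul hψ)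
  have : Nonempty (Fin m ⊕ Fin m) := ⟨Sum.inl ⟨0, hm⟩⟩
  have heq : ∀ t, diffOp (rootProd (symbolRoot m α) Finset.univ) f t = (-1) ^ m * W t * f t := by
    intro t
    rw [rootProd_symbolRoot, diffOp_C_mul, diffOp_add_fun (-1) fun k hk => by
      rw [iteratedDeriv_add_mul hφ hψ (-1) (hk.trans natDegree_polyLap_le)], hφeq, hψeq, mul_assoc,
      hWmul]
    ring
  have hroot : symbolRoot m α (Sum.inl ⟨0, hm⟩) = rate m α := by simp [symbolRoot]
  have hftop : Tendsto f atTop (𝓝 0) := by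
    have h1 := hφ1.sub hψ1
    rw [sub_zero] at h1
    exact h1.congr fun t => (hfsub t).symm
  have hzero := eq_zero_of_rootProd_eq_mul (symbolRoot_injective hα) hfC (symbolRoot_ne_zero hα)
    heq hW0 (fun t => (hWB t).trans ((le_abs_self _).trans (hM t))) (hWlim _ hφ0 hψ0)
    (hWlim _ hφ1 hψ1) hftop (i₀ := Sum.inl ⟨0, hm⟩)
    (by rw [hroot]; exact hr) (by
      rw [hroot]
      have h1 := hφL.sub hψL
      rw [sub_self] at h1
      refine h1.congr fun t => ?_
      rw [hfsub, mul_sub])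
  funext t
  have := hzero t
  rw [hfsub] at this
  exact sub_eq_zero.1 this

/-! ### Classification of the regular minimizers -/

/-- Functions in `H^1(ℝ)` vanish at infinity. -/
theorem tendsto_zero_of_memLp {f f' : ℝ → ℝ} (hf : ∀ t, HasDerivAt f (f' t) t)
    (h : MemLp f 2) (h' : MemLp f' 2) : Tendsto f atBot (𝓝 0) ∧ Tendsto f atTop (𝓝 0) := by
  have hd : ∀ t, HasDerivAt (fun t => f t ^ 2) (2 * (f t * f' t)) t := fun t =>
    ((hf t).fun_pow 2).congr_deriv (by simp; ring)
  have h1 : Integrable fun t => 2 * (f t * f' t) := (h.integrable_mul h').const_mul 2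
  have h2 : Integrable fun t => f t ^ 2 := h.integrable_sq
  have hsqrt : ∀ l : Filter ℝ, Tendsto (fun t => f t ^ 2) l (𝓝 0) → Tendsto f l (𝓝 0) := by
    intro l hl
    have h3 := hl.sqrt
    simp only [Real.sqrt_sq_eq_abs, Real.sqrt_zero] at h3
    exact (tendsto_zero_iff_abs_tendsto_zero _).2 h3
  exact ⟨hsqrt _ (tendsto_zero_of_hasDerivAt_of_integrableOn_Iic (a := 0) (fun t _ => hd t)
    h1.integrableOn h2.integrableOn),
    hsqrt _ (tendsto_zero_of_hasDerivAt_of_integrableOn_Ioi (a := 0) (fun t _ => hd t)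
    h1.integrableOn h2.integrableOn)⟩

theorem exp_neg_mul_profile (u : ℝ → ℝ) (t : ℝ) :
    Real.exp (-rate m α * t) * profile m α u t = u (Real.exp t) := by
  rw [profile, ← mul_assoc, ← Real.exp_add]
  simp

theorem tendsto_exp_atBot_nhdsGT : Tendsto Real.exp atBot (𝓝[>] 0) :=
  tendsto_nhdsWithin_iff.2 ⟨Real.tendsto_exp_atBot, Eventually.of_forall Real.exp_pos⟩

theorem eqOn_of_profile_eq {u v : ℝ → ℝ} (h : profile m α u = profile m α v) :
    EqOn u v (Ioi 0) := by
  intro r hr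
  have h1 := congrFun h (Real.log r)
  simp only [profile, Real.exp_log hr] at h1
  exact mul_left_cancel₀ (Real.exp_pos _).ne' h1

theorem profile_congr {u v : ℝ → ℝ} (h : EqOn u v (Ioi 0)) : profile m α u = profile m α v := by
  funext t
  rw [profile, profile, h (Real.exp_pos t)]

theorem profile_const_mul (c : ℝ) (u : ℝ → ℝ) :
    profile m α (fun r => c * u r) = fun t => c * profile m α u t := by
  funext t; simp only [profile]; ring

theorem bubble_zero {ε : ℝ} (hε : 0 < ε) :
    bubble m α ε 0 = bubbleConst m α * ε ^ (-rate m α) := by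
  have h : ε / (ε ^ 2 + 0 ^ 2) = ε⁻¹ := by field_simp; ring
  rw [bubble, h, Real.inv_rpow hε.le, ← Real.rpow_neg hε.le]
  rfl

/-- A nonzero regular solution of `(-Δ_α)^m z = μ |z|^{2^*-2} z` is a bubble up to scaling. -/
theorem exists_eqOn_bubble (hm : 1 ≤ m) (hα : 0 < α - 2 * (m : ℝ) + 1)
    (hzD : z ∈ dirichletSpace m α) (hne : ¬ IsZero z)
    (hzC : ContDiffOn ℝ (2 * m : ℕ) z (Ioi 0)) {L : ℝ} (hL : Tendsto z (𝓝[>] 0) (𝓝 L)) {μ : ℝ}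
    (hμ : 0 ≤ μ)
    (heq : ∀ t, diffOp (polyLap m α) (profile m α z) t =
      μ * (|profile m α z t| ^ (critExp m α - 2) * profile m α z t)) :
    0 < μ ∧ ∃ ε, 0 < ε ∧ ∃ σ : ℝ, (σ = 1 ∨ σ = -1) ∧
      EqOn z (fun r => σ * (μ ^ (1 / (critExp m α - 2)))⁻¹ * bubble m α ε r) (Ioi 0) := by
  have hp := two_lt_critExp hm hα
  have hr := rate_pos hα
  have hφC : ContDiff ℝ (2 * m : ℕ) (profile m α z) := contDiff_profile hzC
  obtain ⟨hbot, htop⟩ := tendsto_zero_of_memLp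
    (fun t => ((hφC.differentiable (by simpa using Nat.one_le_iff_ne_zero.1 hm)) t).hasDerivAt)
    (by simpa using memLp_iteratedDeriv_profile hm hα hzD (Nat.zero_le m))
    (by simpa [iteratedDeriv_one] using memLp_iteratedDeriv_profile hm hα hzD hm)
  have hφL : Tendsto (fun t => Real.exp (-rate m α * t) * profile m α z t) atBot (𝓝 L) := by
    simp only [exp_neg_mul_profile]
    exact hL.comp tendsto_exp_atBot_nhdsGT
  have hnz : profile m α z ≠ fun _ => 0 := fun h => hne fun r hr' => by
    have h1 := congrFun h (Real.log r)
    rw [profile, Real.exp_log hr'] at h1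
    exact (mul_eq_zero.1 h1).resolve_left (Real.exp_pos _).ne'
  have hμpos : 0 < μ := by
    refine hμ.lt_of_ne fun h => hnz ?_
    have hcard : Fintype.card (Fin m ⊕ Fin m) = 2 * m := by
      rw [Fintype.card_sum, Fintype.card_fin]; ring
    have : Nonempty (Fin m ⊕ Fin m) := ⟨Sum.inl ⟨0, hm⟩⟩
    exact funext (eq_zero_of_rootProd_eq_zero (symbolRoot_injective hα) (by rwa [hcard])
      (symbolRoot_ne_zero hα) (fun t => by
        rw [rootProd_symbolRoot, diffOp_C_mul, heq, ← h, zero_mul, mul_zero]) hbot htop)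
  refine ⟨hμpos, ?_⟩
  -- normalize the multiplier to one
  set k := μ ^ (1 / (critExp m α - 2)) with hk
  have hk0 : 0 < k := Real.rpow_pos_of_pos hμpos _
  have hkp : k ^ (critExp m α - 2) = μ := by
    rw [hk, ← Real.rpow_mul hμ, one_div_mul_cancel (by linarith), Real.rpow_one]
  have hkeq : ∀ t, diffOp (polyLap m α) (fun t => k * profile m α z t) t =
      |k * profile m α z t| ^ (critExp m α - 2) * (k * profile m α z t) := fun t => by
    rw [diffOp_const_mul, heq, abs_mul, abs_of_pos hk0, Real.mul_rpow hk0.le (abs_nonneg _), hkp]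
    ring
  have hkC : ContDiff ℝ (2 * m : ℕ) fun t => k * profile m α z t := contDiff_const.mul hφC
  have hktop : Tendsto (fun t => k * profile m α z t) atTop (𝓝 0) := by
    simpa using htop.const_mul k
  have hkL : Tendsto (fun t => Real.exp (-rate m α * t) * (k * profile m α z t)) atBot
      (𝓝 (k * L)) := (hφL.const_mul k).congr fun t => by ring
  have hL0 : L ≠ 0 := fun h0 => hnz <| by
    have h1 := profile_unique hm hα hp hkC (contDiff_const (c := (0 : ℝ))) hkeq
      (fun t => by simp [diffOp, Polynomial.sum_def]) hktop tendsto_const_nhds hkL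
      (by simp [h0])
    funext t
    exact (mul_eq_zero.1 (congrFun h1 t)).resolve_left hk0.ne'
  -- the sign and the scale of the bubble are read off from the value at the origin
  obtain ⟨σ, hσ, hσL⟩ : ∃ σ : ℝ, (σ = 1 ∨ σ = -1) ∧ k * L = σ * |k * L| := by
    rcases le_total 0 (k * L) with h | h
    · exact ⟨1, Or.inl rfl, by rw [abs_of_nonneg h, one_mul]⟩
    · exact ⟨-1, Or.inr rfl, by rw [abs_of_nonpos h]; ring⟩
  have hkL0 : 0 < |k * L| := abs_pos.2 (mul_ne_zero hk0.ne' hL0)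
  have hK := bubbleConst_pos hα
  set ε := (|k * L| / bubbleConst m α) ^ (-(rate m α)⁻¹) with hε
  have hε0 : 0 < ε := Real.rpow_pos_of_pos (div_pos hkL0 hK) _
  have hbz : bubble m α ε 0 = |k * L| := by
    rw [bubble_zero hε0, hε, ← Real.rpow_mul (div_pos hkL0 hK).le, neg_mul_neg,
      inv_mul_cancel₀ hr.ne', Real.rpow_one]
    field_simp
  have hσabs : |σ| = 1 := by rcases hσ with h | h <;> simp [h]
  have hu := profile_unique hm hα hp hkC (ψ := fun t => σ * profile m α (bubble m α ε) t)
    (contDiff_const.mul (contDiff_profile (contDiff_bubble hε0).contDiffOn)) hkeq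
    (fun t => by
      rw [diffOp_const_mul, diffOp_polyLap_bubble hm hα hε0, abs_mul, hσabs, one_mul]
      ring)
    hktop (by simpa using (tendsto_profile_bubble_atTop hα hε0).const_mul σ) hkL (by
      have h1 : Tendsto (fun t => σ * bubble m α ε (Real.exp t)) atBot
          (𝓝 (σ * bubble m α ε 0)) :=
        (((contDiff_bubble (n := 0) hε0).continuous.tendsto 0).comp
          Real.tendsto_exp_atBot).const_mul σ
      rw [hbz, ← hσL] at h1
      refine h1.congr fun t => ?_
      rw [← exp_neg_mul_profile (m := m) (α := α) (bubble m α ε) t]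
      ring)
  refine ⟨ε, hε0, σ, hσ, eqOn_of_profile_eq (m := m) (α := α) ?_⟩
  funext t
  have h1 : k * profile m α z t = σ * profile m α (bubble m α ε) t := congrFun hu t
  rw [profile_const_mul]
  field_simp
  linarith

theorem exists_eqOn_bubble_of_isNonsingularMinimizer (hm : 1 ≤ m)
    (hα : 0 < α - 2 * (m : ℝ) + 1) (hz : IsNonsingularMinimizer m α z) :
    ∃ c : ℝ, c ≠ 0 ∧ ∃ ε : ℝ, 0 < ε ∧ EqOn z (fun r => c * bubble m α ε r) (Ioi 0) := by
  obtain ⟨hzm, ⟨hzC, hzL⟩, -⟩ := hz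
  obtain ⟨L, hL⟩ := hzL 0 (Nat.zero_le _)
  rw [iteratedDeriv_zero] at hL
  obtain ⟨hμ, ε, hε, σ, hσ, h⟩ := exists_eqOn_bubble hm hα hzm.1 hzm.2.1 hzC hL multiplier_nonneg
    (diffOp_polyLap_eq hm hα hzC fun v hv => hzm.euler_lagrange hm hα hv)
  refine ⟨_, mul_ne_zero ?_ (inv_ne_zero (Real.rpow_pos_of_pos hμ _).ne'), ε, hε, h⟩
  rcases hσ with h | h <;> simp [h]

/-- The profiles of the bubbles are translates of one function. -/
theorem profile_eq_of_eqOn_bubble {c ε : ℝ} (hε : 0 < ε)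
    (h : EqOn z (fun r => c * bubble m α ε r) (Ioi 0)) :
    profile m α z = fun t => c * bubbleConst m α * twoCosh 0 (t - Real.log ε) ^ (-rate m α) := by
  rw [profile_congr h, profile_const_mul, profile_bubble hε]
  funext t
  have : twoCosh (Real.log ε) t = twoCosh 0 (t - Real.log ε) := by simp [twoCosh]
  simp only [this]
  ring

/-- The Sobolev quotient takes the same value at all multiples of all bubbles. -/
theorem sobolevQuotient_of_eqOn_bubble (hm : 1 ≤ m) (hα : 0 < α - 2 * (m : ℝ) + 1)
    (hzD : z ∈ dirichletSpace m α) {c ε : ℝ} (hc : c ≠ 0) (hε : 0 < ε)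
    (h : EqOn z (fun r => c * bubble m α ε r) (Ioi 0)) :
    sobolevQuotient m α z =
      (∫ t, diffOp (gradPoly m α) (fun t => twoCosh 0 t ^ (-rate m α)) t ^ 2) /
        (∫ t, |twoCosh 0 t ^ (-rate m α)| ^ critExp m α) ^ (2 / critExp m α) := by
  have hp := two_lt_critExp hm hα
  set k := c * bubbleConst m α with hk
  have hk0 : 0 < |k| := abs_pos.2 (mul_ne_zero hc (bubbleConst_pos hα).ne')
  rw [sobolevQuotient_eq hm hα hzD, profile_eq_of_eqOn_bubble hε h, ← hk]
  have h1 : ∀ t, diffOp (gradPoly m α)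
      (fun t => k * twoCosh 0 (t - Real.log ε) ^ (-rate m α)) t ^ 2 =
      k ^ 2 * (fun t => diffOp (gradPoly m α) (fun t => twoCosh 0 t ^ (-rate m α)) t ^ 2)
        (t - Real.log ε) := fun t => by
    rw [diffOp_const_mul, diffOp_comp_sub_const (gradPoly m α) fun t => twoCosh 0 t ^ (-rate m α)]
    ring
  have h2 : ∀ t, |k * twoCosh 0 (t - Real.log ε) ^ (-rate m α)| ^ critExp m α =
      |k| ^ critExp m α * (fun t => |twoCosh 0 t ^ (-rate m α)| ^ critExp m α)
        (t - Real.log ε) := fun t => by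
    rw [abs_mul, Real.mul_rpow (abs_nonneg _) (abs_nonneg _)]
  have hI : 0 ≤ ∫ t, |twoCosh 0 t ^ (-rate m α)| ^ critExp m α :=
    integral_nonneg fun t => Real.rpow_nonneg (abs_nonneg _) _
  simp only [h1, h2]
  rw [integral_const_mul, integral_const_mul,
    integral_sub_right_eq_self (fun t =>
      diffOp (gradPoly m α) (fun t => twoCosh 0 t ^ (-rate m α)) t ^ 2),
    integral_sub_right_eq_self (fun t => |twoCosh 0 t ^ (-rate m α)| ^ critExp m α),
    Real.mul_rpow (Real.rpow_nonneg hk0.le _) hI, ← Real.rpow_mul hk0.le,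
    mul_div_cancel₀ _ (by linarith), Real.rpow_two, sq_abs,
    mul_div_mul_left _ _ (by rw [← sq_abs]; positivity)]

theorem iteratedDeriv_bubble_zero_of_odd {ε : ℝ} {i : ℕ} (hi : Odd i) :
    iteratedDeriv i (bubble m α ε) 0 = 0 := by
  have h := iteratedDeriv_comp_neg i (bubble m α ε) 0
  have heven : (fun r => bubble m α ε (-r)) = bubble m α ε := by
    funext r; simp [bubble]
  rw [heven, hi.neg_one_pow, neg_zero, neg_one_smul] at h
  linarith

/-- Since some regular minimizer exists and is a multiple of a bubble, the common value of the
quotient at multiples of bubbles is the infimum. -/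
theorem isNonsingularMinimizer_of_eqOn_bubble (hm : 1 ≤ m) (hα : 0 < α - 2 * (m : ℝ) + 1)
    (hmin : ∃ z₀ : ℝ → ℝ, IsNonsingularMinimizer m α z₀) (hzD : z ∈ dirichletSpace m α)
    {c ε : ℝ} (hc : c ≠ 0) (hε : 0 < ε)
    (h : EqOn z (fun r => c * bubble m α ε r) (Ioi 0)) : IsNonsingularMinimizer m α z := by
  obtain ⟨z₀, hz₀⟩ := hmin
  obtain ⟨c₀, hc₀, ε₀, hε₀, h₀⟩ := exists_eqOn_bubble_of_isNonsingularMinimizer hm hα hz₀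
  have hsm : ∀ n : ℕ, ContDiff ℝ n fun r => c * bubble m α ε r := fun n =>
    contDiff_const.mul (contDiff_bubble hε)
  have hlim : ∀ i, Tendsto (iteratedDeriv i z) (𝓝[>] 0)
      (𝓝 (c * iteratedDeriv i (bubble m α ε) 0)) := by
    intro i
    have h1 : Tendsto (iteratedDeriv i fun r => c * bubble m α ε r) (𝓝[>] 0)
        (𝓝 (iteratedDeriv i (fun r => c * bubble m α ε r) 0)) :=
      (((hsm i).continuous_iteratedDeriv i le_rfl).tendsto 0).mono_left nhdsWithin_le_nhds
    rw [iteratedDeriv_const_mul_field] at h1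
    refine h1.congr' ?_
    filter_upwards [self_mem_nhdsWithin] with r hr
    apply Filter.EventuallyEq.iteratedDeriv_eq
    filter_upwards [Ioi_mem_nhds hr] with s hs
    exact (h hs).symm
  refine ⟨⟨hzD, fun h0 => ?_, ?_⟩, ⟨?_, fun i _ => ⟨_, hlim i⟩⟩, fun i _ hi => ?_⟩
  · have h1 : z (Real.exp 0) = 0 := h0 (Real.exp_pos 0)
    have h2 : profile m α z 0 = 0 := by rw [profile, h1, mul_zero]
    rw [profile_eq_of_eqOn_bubble hε h] at h2
    exact mul_ne_zero (mul_ne_zero hc (bubbleConst_pos hα).ne')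
      (Real.rpow_pos_of_pos (twoCosh_pos _ _) _).ne' h2
  · rw [← hz₀.1.2.2, sobolevQuotient_of_eqOn_bubble hm hα hzD hc hε h,
      sobolevQuotient_of_eqOn_bubble hm hα hz₀.1.1 hc₀ hε₀ h₀]
  · exact (hsm _).contDiffOn.congr h
  · have := hlim i
    rwa [iteratedDeriv_bubble_zero_of_odd hi, mul_zero] at this

/-- In the weak equation of `±w_ε`, which holds with some multiplier because these functions are
minimizers, the multiplier is one because the pointwise equation has that normalization. -/
theorem isWeakSolution_of_eqOn_bubble (hm : 1 ≤ m) (hα : 0 < α - 2 * (m : ℝ) + 1)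
    (hz : IsNonsingularMinimizer m α z) {σ ε : ℝ} (hσ : |σ| = 1) (hε : 0 < ε)
    (h : EqOn z (fun r => σ * bubble m α ε r) (Ioi 0)) : IsWeakSolution m α z := by
  have hEL := fun v hv => hz.1.euler_lagrange hm hα (v := v) hv
  have h1 := diffOp_polyLap_eq hm hα hz.2.1.1 hEL 0
  have hprof : profile m α z = fun t => σ * profile m α (bubble m α ε) t := by
    rw [profile_congr h, profile_const_mul]
  have h2 : diffOp (polyLap m α) (profile m α z) 0 =
      |profile m α z 0| ^ (critExp m α - 2) * profile m α z 0 := by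
    rw [hprof, diffOp_const_mul, diffOp_polyLap_bubble hm hα hε, abs_mul, hσ, one_mul]
    ring
  have hb : profile m α z 0 ≠ 0 := by
    rw [profile_eq_of_eqOn_bubble hε h]
    refine mul_ne_zero (mul_ne_zero (fun h0 => ?_) (bubbleConst_pos hα).ne')
      (Real.rpow_pos_of_pos (twoCosh_pos _ _) _).ne'
    rw [h0, abs_zero] at hσ
    exact zero_ne_one hσ
  have hμ : multiplier m α z = 1 := by
    rw [h2] at h1
    exact (mul_right_cancel₀ (mul_ne_zero (Real.rpow_pos_of_pos (abs_pos.2 hb) _).ne' hb)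
      ((one_mul _).trans h1)).symm
  refine ⟨hz.1.1, fun v hv => ?_⟩
  rw [integral_gradient_mul hm hz.1.1 hv, integral_abs_rpow_mul hα, hEL v hv, hμ, one_mul]

end Classification

end RadialSobolev

theorem mainTheorem3 (m : ℕ) (hm : 1 ≤ m) (α : ℝ) (hα : 0 < α - 2 * (m : ℝ) + 1)
    (hmin : ∃ z₀ : ℝ → ℝ, IsNonsingularMinimizer m α z₀)
    (z : ℝ → ℝ) (hz : z ∈ dirichletSpace m α) :
    (IsNonsingularMinimizer m α z ↔
      ∃ c : ℝ, c ≠ 0 ∧ ∃ ε : ℝ, 0 < ε ∧ EqOn z (fun r => c * bubble m α ε r) (Ioi 0)) ∧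
    (IsNonsingularMinimizer m α z ∧ IsWeakSolution m α z ↔
      ∃ ε : ℝ, 0 < ε ∧
        (EqOn z (bubble m α ε) (Ioi 0) ∨ EqOn z (fun r => -bubble m α ε r) (Ioi 0))) := by
  refine ⟨⟨exists_eqOn_bubble_of_isNonsingularMinimizer hm hα, ?_⟩, ⟨?_, ?_⟩⟩
  · rintro ⟨c, hc, ε, hε, h⟩
    exact isNonsingularMinimizer_of_eqOn_bubble hm hα hmin hz hc hε h
  · rintro ⟨⟨hzm, ⟨hzC, hzL⟩, -⟩, -, hweak⟩
    obtain ⟨L, hL⟩ := hzL 0 (Nat.zero_le _)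
    rw [iteratedDeriv_zero] at hL
    obtain ⟨-, ε, hε, σ, hσ, h⟩ := exists_eqOn_bubble hm hα hz hzm.2.1 hzC hL zero_le_one
      (diffOp_polyLap_eq hm hα hzC fun v hv => by
        rw [one_mul, ← integral_gradient_mul hm hz hv, ← integral_abs_rpow_mul hα]
        exact hweak v hv)
    refine ⟨ε, hε, ?_⟩
    rcases hσ with rfl | rfl
    · exact Or.inl (by simpa using h)
    · exact Or.inr (by simpa using h)
  · rintro ⟨ε, hε, h⟩
    obtain ⟨σ, hσ, h⟩ : ∃ σ : ℝ, |σ| = 1 ∧ EqOn z (fun r => σ * bubble m α ε r) (Ioi 0) := by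
      rcases h with h | h
      · exact ⟨1, by simp, by simpa using h⟩
      · exact ⟨-1, by simp, by simpa using h⟩
    have hσ0 : σ ≠ 0 := fun h0 => by simp [h0] at hσ
    have hzm := isNonsingularMinimizer_of_eqOn_bubble hm hα hmin hz hσ0 hε h
    exact ⟨hzm, isWeakSolution_of_eqOn_bubble hm hα hzm hσ hε h⟩
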